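/- Let $n\ge 2$, $\eta\in\{1,-1\}$, with $\eta=1$ if $n$ is even. Let $(M^{2n},\omega)$ be a real-analytic symplectic manifold and let $\mathcal F=(H,F_1,\dots,F_{n-1})\colon M\to\mathbb R^n$ be a real-analytic integrable system (its components Poisson commute and are independent on a dense set). **Unfolded $A_n^\eta$ points.** $P\in M$ is an unfolded $A_n^\eta$ singular point if there are real-analytic coordinates $(\varepsilon,\tau,u,v)$ centered at $P$ with $\varepsilon_j=F_j-F_j(P)$ and $\omega=\sum_{j=1}^{n-1} dF_j\wedge d\tau_j+du\wedge dv$ such that the reduced Hamiltonian $H^\varepsilon(u,v)=H|_{(\varepsilon,0,u,v)}$ satisfies the following: $dH^0(0)=0$; for some linear coordinates $(u_1,v_1)$ in the $(u,v)$-plane, $d^2H^0(0)=\eta u_1^2$; for some polynomial $Q$ of degree $\le\frac{n-3}{2}$ ($Q=0$ if $n=2$), in the coordinates $x=u_1+v_1^2Q(v_1)$, $y=v_1$, at the origin, $\partial_x\partial_y^{i+1}H^0=0$ for $1\le i\le[\frac{n-1}{2}]$, $\partial_y^kH^0=0$ for $3\le k\le n$, $\partial_y^{n+1}H^0>0$,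 and the matrix $(\partial_{\varepsilon_i}\partial_y^jH^\varepsilon|_{\varepsilon=0})_{1\le i,j\le n-1}$ is nondegenerate. Let $P$ be such a point. **Normal forms.** Write $\mathcal F_{can}(\lambda,\mu,p,q)=(\eta p^2+q^{n+1}+\sum_{j=1}^{n-1}\lambda_jq^j,\ \lambda_1,\dots,\lambda_{n-1})$. (a) Let $\widehat\Phi=(\lambda,\mu,p,q)$ and $\widehat\phi$ be any real-analytic local coordinates centered at $P$ and at $\mathcal F(P)$ such that $\widehat\phi(h,\varepsilon)=(h-\lambda_0(\varepsilon),\lambda(\varepsilon))$, $\widehat\phi\circ\mathcal F\circ\widehat\Phi^{-1}=\mathcal F_{can}$ and $(\widehat\Phi^{-1})^*\omega=\sum_j d\lambda_j\wedge d\mu_j+d\alpha$, where $\alpha$ is a real-analytic 1-form in the variables $(\lambda,p,q)$ and the coefficient of $dp\wedge dq$ in $d\alpha$ is positive at the origin (preliminary normal form). (b) Let $\Phi=(\tilde\lambda,\tilde\mu,\tilde p,\tilde q)$ and $\phi=(\tilde h,\tilde\lambda)$ be any real-analytic local coordinates centered at $P$ and at $\mathcal F(P)$ such that $\phi\circ\mathcal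 F\circ\Phi^{-1}=\mathcal F_{can}$ and $(\Phi^{-1})^*\omega=\sum_j d\tilde\lambda_j\wedge d\tilde\mu_j+d\tilde p\wedge d\tilde q$ (symplectic normal form). **Swallowtail domain and actions.** The swallowtail domain $D$ is the preimage under $\widehat\phi$ of the set of all $(h,\lambda)\in\mathbb R^n$ for which $q^{n+1}+\sum_{j=1}^{n-1}\lambda_jq^j-h=\prod_{i=1}^{n+1}(q-q_i)$ with real $q_1<\dots<q_{n+1}$. For $f\in D$ with $\widehat\phi(f)=(h,\lambda)$ and $1\le k\le n$, the vanishing cycle $\gamma_{f,k}$ is the closed curve $\eta p^2+\prod_i(q-q_i)=0$, $q_k\le q\le q_{k+1}$, at constant $\lambda$, with $p$ real if $(-1)^{n+k}=\eta$ and $p$ purely imaginary otherwise, oriented so that $p\in\mathbb R_{>0}$, respectively $p\in i\mathbb R_{>0}$, while $q$ increases. For $f\in D$ close to $\mathcal F(P)$, put $I_k(f)=\frac1{2\pi}\oint_{\gamma_{f,k}}\alpha$ ($\alpha$ extended holomorphically near the origin) and $I=(I_1,\dots,I_n)$. Put $\varsigma_k=1$ if $(-1)^{n+k}=\eta$ and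 $\varsigma_k=i$ otherwise, let $\Delta=\prod_{k=1}^n\varsigma_k\mathbb R_{>0}\subset\mathbb C^n$, and let $\chi\colon\Delta\to\Delta$ be $(a_1,\dots,a_n)\mapsto(a_n,\dots,a_1)$ under the identification $\mathbb R^n_{>0}\approx\Delta$, $(a_k)\mapsto(\varsigma_ka_k)$. Let $\psi(\tilde h,\tilde\lambda)=\big((-1)^{n+1}\tilde h,\ ((-1)^{n+1+j}\tilde\lambda_j)_{1\le j\le n-1}\big)$. **Claim.** There is an open neighbourhood $V$ of $\mathcal F(P)$ in $\mathbb R^n$ on which $\phi^{-1}\circ\psi\circ\phi$ is defined and is an involution $V\to V$, such that $D\cap V$ is invariant under $\phi^{-1}\circ\psi\circ\phi$, the local action mapping $I$ sends $D\cap V$ into $\Delta$, and $$\chi\circ I=I\circ(\phi^{-1}\circ\psi\circ\phi)\quad\text{on } D\cap V .$$ -/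

import Mathlib

open scoped Manifold ContDiff Topology

noncomputable section

namespace Unfolding

/-! ### Coordinate spaces -/

/-- The target `ℝⁿ` of the momentum map `(H, F₁, …, Fₙ₋₁)`. A point is `(h, ε)` (or `(h, λ)`);
the entry of index `j : Fin (n - 1)` is the one that is classically numbered `j + 1`. -/
abbrev Base (n : ℕ) : Type := ℝ × (Fin (n - 1) → ℝ)

/-- The local model `ℝ²ⁿ` of the phase space, with coordinates `(λ, μ, p, q)`. -/
abbrev Phase (n : ℕ) : Type := (Fin (n - 1) → ℝ) × (Fin (n - 1) → ℝ) × ℝ × ℝ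

/-- The `(n + 1)`-dimensional space with coordinates `(λ, p, q)`, over `ℝ` or `ℂ`. -/
abbrev Reduced (𝕜 : Type) (n : ℕ) : Type := (Fin (n - 1) → 𝕜) × 𝕜 × 𝕜

/-- The projection `(λ, μ, p, q) ↦ (λ, p, q)`. -/
def forgetMu {n : ℕ} (z : Phase n) : Reduced ℝ n := (z.1, z.2.2)

/-- The inclusion of the real `(λ, p, q)`-space in the complex one. -/
def toComplex {n : ℕ} (z : Reduced ℝ n) : Reduced ℂ n :=
  (fun j => (z.1 j : ℂ), (z.2.1 : ℂ), (z.2.2 : ℂ))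

/-- The 2-form `∑ⱼ dλⱼ ∧ dμⱼ`. -/
def lambdaMuForm {n : ℕ} (v w : Phase n) : ℝ :=
  ∑ j, (v.1 j * w.2.1 j - w.1 j * v.2.1 j)

/-- The canonical symplectic form `∑ⱼ dλⱼ ∧ dμⱼ + dp ∧ dq`. -/
def canonicalForm {n : ℕ} (v w : Phase n) : ℝ :=
  lambdaMuForm v w + (v.2.2.1 * w.2.2.2 - w.2.2.1 * v.2.2.2)

/-- The exterior derivative of a 1-form on a normed space. -/
def dOneForm {V : Type*} [NormedAddCommGroup V] [NormedSpace ℝ V]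
    (α : V → (V →L[ℝ] ℝ)) (z v w : V) : ℝ :=
  fderiv ℝ α z v w - fderiv ℝ α z w v

/-- The standard momentum map
`(λ, μ, p, q) ↦ (η p² + q ^ (n + 1) + ∑ⱼ λⱼ qʲ, λ₁, …, λₙ₋₁)`. -/
def canonicalMomentum (n : ℕ) (η : ℝ) (z : Phase n) : Base n :=
  (η * z.2.2.1 ^ 2 + z.2.2.2 ^ (n + 1) + ∑ j : Fin (n - 1), z.1 j * z.2.2.2 ^ ((j : ℕ) + 1), z.1)

/-! ### Real-analytic integrable systems -/

section Manifold

variable {E : Type*} [NormedAddCommGroup E] [NormedSpace ℝ E]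
  {M : Type*} [TopologicalSpace M] [ChartedSpace E M]

/-- The pull-back of a field of bilinear forms on `M` by a map `f : V → M`. -/
def pullbackForm
    (Ω : (x : M) → TangentSpace 𝓘(ℝ, E) x →L[ℝ] TangentSpace 𝓘(ℝ, E) x →L[ℝ] ℝ)
    {V : Type*} [NormedAddCommGroup V] [NormedSpace ℝ V] (f : V → M) (z v w : V) : ℝ :=
  Ω (f z) (mfderiv 𝓘(ℝ, V) 𝓘(ℝ, E) f z v) (mfderiv 𝓘(ℝ, V) 𝓘(ℝ, E) f z w)

/-- `Ω` is a real-analytic symplectic form: alternating, nondegenerate, and analytic and closed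
in the charts of `M`. -/
structure IsSymplecticForm
    (Ω : (x : M) → TangentSpace 𝓘(ℝ, E) x →L[ℝ] TangentSpace 𝓘(ℝ, E) x →L[ℝ] ℝ) : Prop where
  alternating : ∀ (x : M) (v : TangentSpace 𝓘(ℝ, E) x), Ω x v v = 0
  nondegenerate : ∀ (x : M) (v : TangentSpace 𝓘(ℝ, E) x), (∀ w, Ω x v w = 0) → v = 0
  analytic : ∀ (x₀ : M) (v w : E),
    AnalyticOnNhd ℝ (fun z => pullbackForm Ω (chartAt E x₀).symm z v w) (chartAt E x₀).target
  closed : ∀ (x₀ : M), ∀ z ∈ (chartAt E x₀).target, ∀ u v w : E,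
    fderiv ℝ (fun y => pullbackForm Ω (chartAt E x₀).symm y v w) z u
      - fderiv ℝ (fun y => pullbackForm Ω (chartAt E x₀).symm y u w) z v
      + fderiv ℝ (fun y => pullbackForm Ω (chartAt E x₀).symm y u v) z w = 0

/-- The components of a momentum map `(H, F₁, …, Fₙ₋₁)`: `none` stands for `H`. -/
def component {n : ℕ} (F : M → Base n) : Option (Fin (n - 1)) → M → ℝ
  | none => fun x => (F x).1
  | some j => fun x => (F x).2 j

/-- A real-analytic integrable system with `n` degrees of freedom on a `2n`-dimensional manifold.
Hamiltonian vector fields are given by `Ω(X_f, ·) = -df`. -/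
structure IsIntegrableSystem (n : ℕ)
    (Ω : (x : M) → TangentSpace 𝓘(ℝ, E) x →L[ℝ] TangentSpace 𝓘(ℝ, E) x →L[ℝ] ℝ)
    (F : M → Base n) : Prop where
  finrank_eq : Module.finrank ℝ E = 2 * n
  symplectic : IsSymplecticForm Ω
  analytic : ContMDiff 𝓘(ℝ, E) 𝓘(ℝ, Base n) ω F
  poisson_commute : ∀ (i j : Option (Fin (n - 1))) (x : M) (X Y : TangentSpace 𝓘(ℝ, E) x),
    (∀ v, Ω x X v = -(mfderiv 𝓘(ℝ, E) 𝓘(ℝ, ℝ) (component F i) x v)) →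
    (∀ v, Ω x Y v = -(mfderiv 𝓘(ℝ, E) 𝓘(ℝ, ℝ) (component F j) x v)) →
    Ω x X Y = 0
  independent : Dense {x : M | Function.Surjective (mfderiv 𝓘(ℝ, E) 𝓘(ℝ, Base n) F x)}

/-- `Φ` is a system of real-analytic local coordinates on `M`, centered at `P`. -/
structure IsCenteredAnalyticChart {n : ℕ} (Φ : OpenPartialHomeomorph M (Phase n)) (P : M) :
    Prop where
  mem_source : P ∈ Φ.source
  map_eq_zero : Φ P = 0
  analytic : ContMDiffOn 𝓘(ℝ, E) 𝓘(ℝ, Phase n) ω Φ Φ.source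
  analytic_symm : ContMDiffOn 𝓘(ℝ, Phase n) 𝓘(ℝ, E) ω Φ.symm Φ.target

/-- `φ` is a system of real-analytic local coordinates on `ℝⁿ`, centered at `b`. -/
structure IsCenteredAnalyticBaseChart {n : ℕ} (φ : OpenPartialHomeomorph (Base n) (Base n))
    (b : Base n) : Prop where
  mem_source : b ∈ φ.source
  map_eq_zero : φ b = 0
  analytic : ContDiffOn ℝ ω φ φ.source
  analytic_symm : ContDiffOn ℝ ω φ.symm φ.target

/-! ### Unfolded `Aₙ` singular points -/

/-- Symplectic coordinates `(ε, τ, u, v)` centered at `P` with `εⱼ = Fⱼ - Fⱼ(P)`, in which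
`Ω = ∑ⱼ dFⱼ ∧ dτⱼ + du ∧ dv` (local symplectic reduction by `F₁, …, Fₙ₋₁`). -/
structure IsReductionChart {n : ℕ}
    (Ω : (x : M) → TangentSpace 𝓘(ℝ, E) x →L[ℝ] TangentSpace 𝓘(ℝ, E) x →L[ℝ] ℝ)
    (F : M → Base n) (P : M) (Ξ : OpenPartialHomeomorph M (Phase n)) : Prop where
  chart : IsCenteredAnalyticChart (E := E) Ξ P
  epsilon_eq : ∀ x ∈ Ξ.source, (Ξ x).1 = (F x).2 - (F P).2
  form_eq : ∀ z ∈ Ξ.target, ∀ v w : Phase n, pullbackForm Ω Ξ.symm z v w = canonicalForm v w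

/-- The reduced Hamiltonian `H^ε(u, v)`. -/
def reducedHamiltonian {n : ℕ} (F : M → Base n) (Ξ : OpenPartialHomeomorph M (Phase n))
    (ε : Fin (n - 1) → ℝ) (w : ℝ × ℝ) : ℝ :=
  (F (Ξ.symm (ε, 0, w))).1

/-- The reduced Hamiltonian in the coordinates `(x, y)` given by `(u₁, v₁) = L (u, v)`,
`x = u₁ + v₁² Q(v₁)`, `y = v₁`. -/
def adaptedHamiltonian {n : ℕ} (F : M → Base n) (Ξ : OpenPartialHomeomorph M (Phase n))
    (L : (ℝ × ℝ) ≃L[ℝ] (ℝ × ℝ)) (Q : Polynomial ℝ) (ε : Fin (n - 1) → ℝ) (x y : ℝ) : ℝ :=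
  reducedHamiltonian F Ξ ε (L.symm (x - y ^ 2 * Q.eval y, y))

/-- `P` is an unfolded `Aₙ^η` singular point (`n ≥ 2`) of the system `F`. -/
def IsUnfoldedAn (n : ℕ) (η : ℝ)
    (Ω : (x : M) → TangentSpace 𝓘(ℝ, E) x →L[ℝ] TangentSpace 𝓘(ℝ, E) x →L[ℝ] ℝ)
    (F : M → Base n) (P : M) : Prop :=
  ∃ (Ξ : OpenPartialHomeomorph M (Phase n)) (L : (ℝ × ℝ) ≃L[ℝ] (ℝ × ℝ)) (Q : Polynomial ℝ),
    IsReductionChart Ω F P Ξ ∧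
    -- the point has corank one
    fderiv ℝ (reducedHamiltonian F Ξ 0) 0 = 0 ∧
    -- `d²H⁰ = η u₁²`, and `∂ₓ ∂ᵧ^(i+1) H⁰ = 0` for `1 ≤ i ≤ (n - 1) / 2`, `deg Q ≤ (n - 3) / 2`
    (∀ w : ℝ × ℝ, iteratedFDeriv ℝ 2 (reducedHamiltonian F Ξ 0) 0 ![w, w] = η * (L w).1 ^ 2) ∧
    Q ∈ Polynomial.degreeLT ℝ ((n - 1) / 2) ∧
    (∀ i : ℕ, 1 ≤ i → i ≤ (n - 1) / 2 →
      iteratedDeriv (i + 1) (fun y => deriv (fun x => adaptedHamiltonian F Ξ L Q 0 x y) 0) 0 = 0) ∧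
    -- `∂ᵧ³ H⁰ = ⋯ = ∂ᵧⁿ H⁰ = 0` and `∂ᵧ^(n+1) H⁰ > 0`
    (∀ k : ℕ, 3 ≤ k → k ≤ n →
      iteratedDeriv k (fun y => adaptedHamiltonian F Ξ L Q 0 0 y) 0 = 0) ∧
    0 < iteratedDeriv (n + 1) (fun y => adaptedHamiltonian F Ξ L Q 0 0 y) 0 ∧
    -- the matrix `∂ᵧʲ ∂_{εᵢ} H^ε`, `1 ≤ i, j ≤ n - 1`, is nondegenerate
    (Matrix.of fun i j : Fin (n - 1) =>
      iteratedDeriv ((j : ℕ) + 1)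
        (fun y => deriv (fun s => adaptedHamiltonian F Ξ L Q (Pi.single i s) 0 y) 0) 0).det ≠ 0

/-! ### Normal forms -/

/-- A preliminary normal form near `P`: real-analytic coordinates `Φ = (λ, μ, p, q)` centered at
`P` and `φ (h, ε) = (h - λ₀(ε), λ(ε))` centered at `F(P)` with
`φ ∘ F ∘ Φ⁻¹ = (η p² + q ^ (n + 1) + ∑ⱼ λⱼ qʲ, λ)` and
`(Φ⁻¹)^* Ω = ∑ⱼ dλⱼ ∧ dμⱼ + dα`, where `α` is a real-analytic 1-form in `(λ, p, q)` and the
coefficient of `dp ∧ dq` in `dα` is positive at `0`. The form `αC` is the holomorphic extension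
of `α` to a neighbourhood of `0` in `ℂⁿ⁺¹`. -/
structure PreliminaryNormalForm (n : ℕ) (η : ℝ)
    (Ω : (x : M) → TangentSpace 𝓘(ℝ, E) x →L[ℝ] TangentSpace 𝓘(ℝ, E) x →L[ℝ] ℝ)
    (F : M → Base n) (P : M) where
  Φ : OpenPartialHomeomorph M (Phase n)
  φ : OpenPartialHomeomorph (Base n) (Base n)
  α : Reduced ℝ n → (Reduced ℝ n →L[ℝ] ℝ)
  αC : Reduced ℂ n → (Reduced ℂ n →L[ℂ] ℂ)
  chart : IsCenteredAnalyticChart (E := E) Φ P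
  base_chart : IsCenteredAnalyticBaseChart φ (F P)
  base_form : ∃ (lam0 : (Fin (n - 1) → ℝ) → ℝ) (lam : (Fin (n - 1) → ℝ) → (Fin (n - 1) → ℝ)),
    ∀ f ∈ φ.source, φ f = (f.1 - lam0 f.2, lam f.2)
  momentum_eq : ∀ x ∈ Φ.source, F x ∈ φ.source ∧ φ (F x) = canonicalMomentum n η (Φ x)
  alpha_analytic : AnalyticOnNhd ℝ α (forgetMu '' Φ.target)
  form_eq : ∀ z ∈ Φ.target, ∀ v w : Phase n,
    pullbackForm Ω Φ.symm z v w =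
      lambdaMuForm v w + dOneForm α (forgetMu z) (forgetMu v) (forgetMu w)
  area_pos : 0 < dOneForm α 0 (0, 1, 0) (0, 0, 1)
  alphaC_analytic : AnalyticAt ℂ αC 0
  alphaC_extends : ∀ᶠ z in 𝓝 (0 : Reduced ℝ n), ∀ v : Reduced ℝ n,
    αC (toComplex z) (toComplex v) = (α z v : ℂ)

/-- A symplectic normal form near `P`: real-analytic coordinates `Φ = (λ, μ, p, q)` centered at
`P` and `φ` centered at `F(P)` with `φ ∘ F ∘ Φ⁻¹ = (η p² + q ^ (n + 1) + ∑ⱼ λⱼ qʲ, λ)` and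
`(Φ⁻¹)^* Ω = ∑ⱼ dλⱼ ∧ dμⱼ + dp ∧ dq`. -/
structure SymplecticNormalForm (n : ℕ) (η : ℝ)
    (Ω : (x : M) → TangentSpace 𝓘(ℝ, E) x →L[ℝ] TangentSpace 𝓘(ℝ, E) x →L[ℝ] ℝ)
    (F : M → Base n) (P : M) where
  Φ : OpenPartialHomeomorph M (Phase n)
  φ : OpenPartialHomeomorph (Base n) (Base n)
  chart : IsCenteredAnalyticChart (E := E) Φ P
  base_chart : IsCenteredAnalyticBaseChart φ (F P)
  momentum_eq : ∀ x ∈ Φ.source, F x ∈ φ.source ∧ φ (F x) = canonicalMomentum n η (Φ x)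
  form_eq : ∀ z ∈ Φ.target, ∀ v w : Phase n, pullbackForm Ω Φ.symm z v w = canonicalForm v w

end Manifold

/-! ### The swallowtail domain -/

/-- `q₁ < ⋯ < qₙ₊₁` are the roots of `x ^ (n + 1) + ∑ⱼ λⱼ xʲ - h`, where `b = (h, λ)`. -/
def IsRootTuple {n : ℕ} (b : Base n) (q : Fin (n + 1) → ℝ) : Prop :=
  StrictMono q ∧
    ∀ x : ℝ, ∏ i, (x - q i) = x ^ (n + 1) + ∑ j : Fin (n - 1), b.2 j * x ^ ((j : ℕ) + 1) - b.1

/-- The standard swallowtail domain in `ℝⁿ`. -/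
def standardSwallowtail (n : ℕ) : Set (Base n) := {b | ∃ q, IsRootTuple b q}

open Classical in
/-- The increasing tuple of roots attached to a point of the standard swallowtail domain. -/
def rootTuple {n : ℕ} (b : Base n) : Fin (n + 1) → ℝ :=
  if hb : ∃ q, IsRootTuple b q then hb.choose else 0

/-- The involution `ψ` of `ℝⁿ`: `h ↦ (-1) ^ (n + 1) h` and `λⱼ ↦ (-1) ^ (n + 1 + j) λⱼ` for
`1 ≤ j ≤ n - 1`. -/
def psi {n : ℕ} (b : Base n) : Base n :=
  ((-1) ^ (n + 1) * b.1, fun j => (-1) ^ (n + 1 + ((j : ℕ) + 1)) * b.2 j)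

/-! ### Vanishing cycles and the octant `Δ` -/

open Classical in
/-- The factor `1` if the `k`-th vanishing cycle is real, i.e. `(-1) ^ (n + k) = η` for
`1 ≤ k ≤ n`, and the imaginary unit otherwise. Here `k : Fin n` starts from `0`. -/
def unitFactor {n : ℕ} (η : ℝ) (k : Fin n) : ℂ :=
  if (-1 : ℝ) ^ (n + ((k : ℕ) + 1)) = η then 1 else Complex.I

/-- The `q`-coordinate of the vanishing cycle between two consecutive roots; it runs from the
smaller root to the larger one and back as `t` runs through `[0, 2π]`. -/
def cycleQ {n : ℕ} (q : Fin (n + 1) → ℝ) (k : Fin n) (t : ℝ) : ℝ :=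
  (q k.castSucc + q k.succ) / 2 - (q k.succ - q k.castSucc) / 2 * Real.cos t

/-- The modulus `± √|∏ᵢ (q - qᵢ)|` of the `p`-coordinate along the vanishing cycle, with the
sign of `sin t`; the two factors that vanish on the cycle are `(q - q_k) (q_{k+1} - q) =
((q_{k+1} - q_k) / 2 · sin t)²`, so that this is smooth in `t`. -/
def cycleP {n : ℕ} (q : Fin (n + 1) → ℝ) (k : Fin n) (t : ℝ) : ℝ :=
  (q k.succ - q k.castSucc) / 2 * Real.sin t *
    √(∏ i ∈ Finset.univ \ {k.castSucc, k.succ}, |cycleQ q k t - q i|)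

/-- The vanishing cycle `η p² + ∏ᵢ (q - qᵢ) = 0`, `q_k ≤ q ≤ q_{k+1}`, as a closed curve in the
complex `(p, q)`-plane. It lies in `ℝ × ℝ` or in `iℝ × ℝ`, and is oriented so that `p` is in
`ℝ_{>0}`, respectively in `iℝ_{>0}`, while `q` increases. -/
def vanishingCycle {n : ℕ} (η : ℝ) (q : Fin (n + 1) → ℝ) (k : Fin n) (t : ℝ) : ℂ × ℂ :=
  (unitFactor η k * (cycleP q k t : ℂ), (cycleQ q k t : ℂ))

/-- The set `Δ`, a product of half-lines `ℝ_{>0}` and `iℝ_{>0}`. -/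
def octant (n : ℕ) (η : ℝ) : Set (Fin n → ℂ) :=
  {z | ∀ k, ∃ a : ℝ, 0 < a ∧ z k = unitFactor η k * (a : ℂ)}

/-- The involution `(a₁, …, aₙ) ↦ (aₙ, …, a₁)` of `Δ ≈ ℝⁿ_{>0}`, where `a_k` is the quotient of
the `k`-th coordinate by its factor `1` or `i`. -/
def chi {n : ℕ} (η : ℝ) (z : Fin n → ℂ) : Fin n → ℂ :=
  fun k => unitFactor η k * (z k.rev / unitFactor η k.rev)

section Manifold

variable {E : Type*} [NormedAddCommGroup E] [NormedSpace ℝ E]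
  {M : Type*} [TopologicalSpace M] [ChartedSpace E M]
  {n : ℕ} {η : ℝ}
  {Ω : (x : M) → TangentSpace 𝓘(ℝ, E) x →L[ℝ] TangentSpace 𝓘(ℝ, E) x →L[ℝ] ℝ}
  {F : M → Base n} {P : M}

/-- The swallowtail domain `D`: the preimage of the standard one by the base coordinates of a
preliminary normal form. -/
def PreliminaryNormalForm.swallowtail (N : PreliminaryNormalForm n η Ω F P) : Set (Base n) :=
  {f | f ∈ N.φ.source ∧ N.φ f ∈ standardSwallowtail n}

/-- The local action mapping: `I_k = (1 / 2π) ∮ α` over the `k`-th vanishing cycle, on which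
`λ` is constant. -/
def PreliminaryNormalForm.action (N : PreliminaryNormalForm n η Ω F P) (f : Base n) :
    Fin n → ℂ :=
  fun k => (1 / (2 * Real.pi) : ℂ) * ∫ t in (0 : ℝ)..(2 * Real.pi),
    N.αC (fun j => ((N.φ f).2 j : ℂ), vanishingCycle η (rootTuple (N.φ f)) k t)
      (0, deriv (vanishingCycle η (rootTuple (N.φ f)) k) t)

/-- The involution `φ⁻¹ ∘ ψ ∘ φ`. -/
def SymplecticNormalForm.involution (S : SymplecticNormalForm n η Ω F P) (f : Base n) : Base n :=
  S.φ.symm (psi (S.φ f))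

end Manifold

end Unfolding

end

noncomputable section

namespace Unfolding

/-! Give `q` weight 1, `λⱼ` weight `n + 1 - j` and `h` weight `n + 1`. The polynomial `swPoly` is
then quasi-homogeneous: `scale a` multiplies its roots by `a`. The involution `psi` is `scale (-1)`,
so it negates the roots and reverses their order. The reflection `q ↦ -q` exchanges the `k`-th gap
between roots with the reversed one and preserves the area `∮ p dq` up to the factor 1 or `i`
(`cycleArea_neg_rev`).

The theorem therefore follows from an exact formula for the actions
(`PreliminaryNormalForm.eventually_action`): in the symplectic base coordinate `b`, `I_k` is
`unitFactor η k` times `ρ / 2π` times the `k`-th area for `scale a b`. Here `ρ > 0` is the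
coefficient of `dp ∧ dq` in `dα` at the origin and `a ≠ 0` is a constant. Scalings commute, so
`scale (-1)` passes through `scale a`, whatever the sign of `a`; positivity of `ρ` and of the areas
puts the actions in the octant.

The formula comes from the transition map `G` from the symplectic to the preliminary coordinates,
which covers a base map `g`. Since `G` preserves critical points of the momentum map, `g` is
asymptotically quasi-homogeneous: `scale s⁻¹ (g (scale s b))` tends to `scale a b`
(`IsTransition.tendsto_scale`). Together with a connectedness argument this shows that `g` preserves
the swallowtail domain (`IsTransition.eventually_mapsTo`).

After complexification, the integral of `α` over a vanishing cycle of `g b` becomes `∮ p dq` over an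
image loop on the curve `η p² + swPoly b (q) = 0` (`IsTransition.exists_cycleIntegral_eq`). Along `b
= scale (r²) β` these loops, divided by `r ^ (n + 1)` in `p` and by `r²` in `q`, move on one fixed
smooth curve. As `dp ∧ dq` vanishes on a curve, the integral is exactly a constant times `r ^ (n +
3)` (`rescaled_area_eq`). The constant is found by letting `r → 0` in the preliminary coordinates,
where the rescaled cycles tend to those of `scale a β` and the area density tends to `ρ`
(`tendsto_cycleIntegral`). In this way the homology class of the image loops never has to be
identified. -/

/-! ### Complexification of real-analytic functions -/

/-- The complexification of a formal power series in finitely many real variables. -/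
def complexSeries {ι : Type*} [Fintype ι] [DecidableEq ι] (p : FormalMultilinearSeries ℝ (ι → ℝ) ℝ) :
    FormalMultilinearSeries ℂ (ι → ℂ) ℂ := fun k =>
  ∑ r : Fin k → ι, ((p k (fun i => Function.update (0 : ι → ℝ) (r i) 1) : ℝ) : ℂ) •
    (ContinuousMultilinearMap.mkPiAlgebra ℂ (Fin k) ℂ).compContinuousLinearMap
      (fun i => ContinuousLinearMap.proj (R := ℂ) (φ := fun _ : ι => ℂ) (r i))

lemma complexSeries_apply {ι : Type*} [Fintype ι] [DecidableEq ι]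
    (p : FormalMultilinearSeries ℝ (ι → ℝ) ℝ) (k : ℕ) (m : Fin k → ι → ℂ) :
    complexSeries p k m = ∑ r : Fin k → ι,
      ((p k (fun i => Function.update (0 : ι → ℝ) (r i) 1) : ℝ) : ℂ) * ∏ i, m i (r i) := by
  simp [complexSeries]

/-- A multilinear map is determined by its values on basis vectors, and these values are the
coefficients of `complexSeries`. -/
lemma complexSeries_ofReal {ι : Type*} [Fintype ι] [DecidableEq ι]
    (p : FormalMultilinearSeries ℝ (ι → ℝ) ℝ) (k : ℕ) (x : ι → ℝ) :
    complexSeries p k (fun _ i => (x i : ℂ)) = ((p k (fun _ => x) : ℝ) : ℂ) := by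
  have hx : x = ∑ j, x j • Function.update (0 : ι → ℝ) j 1 := by
    ext l
    simp [Finset.sum_apply, Function.update_apply]
  have h : p k (fun _ => x) =
      ∑ r : Fin k → ι, (∏ i, x (r i)) * p k (fun i => Function.update (0 : ι → ℝ) (r i) 1) := by
    conv_lhs => rw [hx]
    rw [ContinuousMultilinearMap.map_sum]
    refine Finset.sum_congr rfl fun r _ => ?_
    rw [ContinuousMultilinearMap.map_smul_univ, smul_eq_mul]
  rw [complexSeries_apply, h]
  push_cast
  exact Finset.sum_congr rfl fun r _ => mul_comm _ _

/-- There is one term for each of the `card ι ^ k` index tuples, and basis vectors have sup norm at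
most 1. -/
lemma norm_complexSeries_le {ι : Type*} [Fintype ι] [DecidableEq ι]
    (p : FormalMultilinearSeries ℝ (ι → ℝ) ℝ) (k : ℕ) :
    ‖complexSeries p k‖ ≤ (Fintype.card ι : ℝ) ^ k * ‖p k‖ := by
  refine ContinuousMultilinearMap.opNorm_le_bound (by positivity) fun m => ?_
  rw [complexSeries_apply]
  calc _ ≤ ∑ r : Fin k → ι, ‖p k‖ * ∏ i, ‖m i‖ := by
        refine norm_sum_le_of_le _ fun r _ => ?_
        rw [norm_mul, norm_prod, Complex.norm_real]
        gcongr with i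
        · refine ((p k).le_opNorm _).trans ?_
          refine mul_le_of_le_one_right (norm_nonneg _) (Finset.prod_le_one (fun _ _ => norm_nonneg _)
            fun i _ => ?_)
          refine (pi_norm_le_iff_of_nonneg zero_le_one).2 fun j => ?_
          by_cases h : j = r i <;> simp [h]
        · exact norm_le_pi_norm (m i) (r i)
    _ = _ := by simp [mul_assoc]

lemma complexSeries_radius_pos {ι : Type*} [Fintype ι] [DecidableEq ι]
    {p : FormalMultilinearSeries ℝ (ι → ℝ) ℝ} (hp : 0 < p.radius) :
    0 < (complexSeries p).radius := by
  obtain ⟨r, hr0, hr⟩ := ENNReal.lt_iff_exists_nnreal_btwn.1 hp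
  obtain ⟨C, hC, hb⟩ := p.norm_mul_pow_le_of_lt_radius hr
  have hr0' : 0 < r := by exact_mod_cast hr0
  -- The factor `card ι ^ k` costs a division of the radius by `card ι`; adding 1 keeps the divisor
  -- positive when `ι` is empty.
  set N : NNReal := (Fintype.card ι : NNReal) + 1
  have hN : 0 < N := by positivity
  refine lt_of_lt_of_le (b := ((r / N : NNReal) : ENNReal)) (by exact_mod_cast div_pos hr0' hN) ?_
  refine (complexSeries p).le_radius_of_bound C fun k => ?_
  have hle : (Fintype.card ι : ℝ) ≤ N := by simp [N]
  have hN' : (0 : ℝ) < N := hN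
  calc ‖complexSeries p k‖ * ((r / N : NNReal) : ℝ) ^ k
      ≤ ((N : ℝ) ^ k * ‖p k‖) * ((r / N : NNReal) : ℝ) ^ k := by
        gcongr
        exact (norm_complexSeries_le p k).trans (by gcongr)
    _ = ‖p k‖ * (r : ℝ) ^ k := by
        push_cast
        rw [div_pow]
        field_simp
    _ ≤ C := hb k

lemma exists_complexification_pi {ι : Type*} [Fintype ι] {f : (ι → ℝ) → ℝ}
    (hf : AnalyticAt ℝ f 0) :
    ∃ fC : (ι → ℂ) → ℂ, AnalyticAt ℂ fC 0 ∧
      ∀ᶠ x in 𝓝 (0 : ι → ℝ), fC (fun i => (x i : ℂ)) = (f x : ℂ) := by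
  classical
  obtain ⟨p, r, hp⟩ := hf
  have hpos := complexSeries_radius_pos (hp.r_pos.trans_le hp.r_le)
  have hC := (complexSeries p).hasFPowerSeriesOnBall hpos
  refine ⟨(complexSeries p).sum, hC.analyticAt, ?_⟩
  have hcont : Continuous fun x : ι → ℝ => (fun i => (x i : ℂ)) := by fun_prop
  have h0 : (fun i : ι => ((0 : ι → ℝ) i : ℂ)) = 0 := by ext; simp
  have h1 : ∀ᶠ x in 𝓝 (0 : ι → ℝ), (fun i => (x i : ℂ)) ∈ Metric.eball 0 (complexSeries p).radius := by
    refine hcont.continuousAt.eventually_mem ?_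
    rw [h0]
    exact Metric.eball_mem_nhds _ hpos
  filter_upwards [h1, Metric.eball_mem_nhds _ hp.r_pos] with x hx hx'
  have s1 := hC.hasSum hx
  have s2 := (hp.hasSum hx').mapL Complex.ofRealCLM
  simp only [zero_add, complexSeries_ofReal] at s1
  simp only [zero_add, Complex.ofRealCLM_apply] at s2
  exact s1.unique s2

/-- `toComplex` as a real-linear map. -/
def toComplexL (n : ℕ) : Reduced ℝ n →L[ℝ] Reduced ℂ n :=
  (ContinuousLinearMap.pi fun j => Complex.ofRealCLM ∘L ContinuousLinearMap.proj j ∘L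
      ContinuousLinearMap.fst ℝ _ _).prod
    ((Complex.ofRealCLM ∘L ContinuousLinearMap.fst ℝ _ _ ∘L ContinuousLinearMap.snd ℝ _ _).prod
      (Complex.ofRealCLM ∘L ContinuousLinearMap.snd ℝ _ _ ∘L ContinuousLinearMap.snd ℝ _ _))

@[simp] lemma toComplexL_apply {n : ℕ} (z : Reduced ℝ n) : toComplexL n z = toComplex z := rfl

lemma continuous_toComplex {n : ℕ} : Continuous (toComplex (n := n)) := (toComplexL n).continuous

@[simp] lemma toComplex_zero {n : ℕ} : toComplex (0 : Reduced ℝ n) = 0 := (toComplexL n).map_zero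

/-- Reindexing the coordinates by `Fin (n - 1) ⊕ Fin 2` reduces this to functions on `ι → ℝ`. -/
lemma exists_complexification {n : ℕ} {f : Reduced ℝ n → ℝ} (hf : AnalyticAt ℝ f 0) :
    ∃ fC : Reduced ℂ n → ℂ, AnalyticAt ℂ fC 0 ∧
      ∀ᶠ x in 𝓝 (0 : Reduced ℝ n), fC (toComplex x) = (f x : ℂ) := by
  let e : (Fin (n - 1) ⊕ Fin 2 → ℝ) →L[ℝ] Reduced ℝ n :=
    (ContinuousLinearMap.pi fun j => ContinuousLinearMap.proj (Sum.inl j)).prod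
      ((ContinuousLinearMap.proj (Sum.inr 0)).prod (ContinuousLinearMap.proj (Sum.inr 1)))
  let eC : Reduced ℂ n →L[ℂ] (Fin (n - 1) ⊕ Fin 2 → ℂ) :=
    ContinuousLinearMap.pi fun o => Sum.elim
      (fun j => ContinuousLinearMap.proj j ∘L ContinuousLinearMap.fst ℂ _ _)
      (fun i => if i = 0 then ContinuousLinearMap.fst ℂ _ _ ∘L ContinuousLinearMap.snd ℂ _ _
        else ContinuousLinearMap.snd ℂ _ _ ∘L ContinuousLinearMap.snd ℂ _ _) o
  have hfe : AnalyticAt ℝ (f ∘ e) 0 := by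
    refine AnalyticAt.comp ?_ (e.analyticAt 0)
    simpa using hf
  obtain ⟨g, hg, hge⟩ := exists_complexification_pi hfe
  refine ⟨g ∘ eC, AnalyticAt.comp (by simpa using hg) (eC.analyticAt 0), ?_⟩
  let d : Reduced ℝ n → (Fin (n - 1) ⊕ Fin 2 → ℝ) := fun z => Sum.elim z.1 ![z.2.1, z.2.2]
  have hd : Continuous d := by
    refine continuous_pi fun o => ?_
    rcases o with j | i
    · simp only [d, Sum.elim_inl]; fun_prop
    · fin_cases i <;> simp only [d, Sum.elim_inr] <;> simp <;> fun_prop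
  have hd0 : d 0 = 0 := by
    ext o; rcases o with j | i
    · simp [d]
    · fin_cases i <;> simp [d]
  have hd' : Filter.Tendsto d (𝓝 0) (𝓝 0) := hd.tendsto' 0 0 hd0
  have := hd'.eventually hge
  filter_upwards [this] with x hx
  have h1 : eC (toComplex x) = fun i => (d x i : ℂ) := by
    ext o; rcases o with j | i
    · simp [d, eC, toComplex]
    · fin_cases i <;> simp [d, eC, toComplex]
  have h2 : e (d x) = x := by
    refine Prod.ext ?_ (Prod.ext ?_ ?_) <;> simp [e, d]
  simp only [Function.comp_apply, h1, hx, h2]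

/-- Reduction to the one-variable identity theorem: for `z = x + i y` with `x`, `y` real, the
function `w ↦ f (x + w y)` vanishes for small real `w` and is analytic on a disc containing `i`.
This is how every identity below passes from real to complex points. -/
lemma eventually_eq_zero_of_toComplex {n : ℕ} {f : Reduced ℂ n → ℂ} (hf : AnalyticAt ℂ f 0)
    (h : ∀ᶠ x in 𝓝 (0 : Reduced ℝ n), f (toComplex x) = 0) : ∀ᶠ z in 𝓝 0, f z = 0 := by
  obtain ⟨ρ, hρ, hρf⟩ := Metric.eventually_nhds_iff_ball.1 hf.eventually_analyticAt
  have key : ∀ᶠ z : Reduced ℂ n in 𝓝 0, ∀ᶠ w : ℝ in 𝓝 0,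
      f (toComplex ((fun j => (z.1 j).re, z.2.1.re, z.2.2.re) : Reduced ℝ n) +
        (w : ℂ) • toComplex ((fun j => (z.1 j).im, z.2.1.im, z.2.2.im) : Reduced ℝ n)) = 0 := by
    obtain ⟨δ, hδ, hδf⟩ := Metric.eventually_nhds_iff_ball.1 h
    have hc : Continuous fun z : Reduced ℂ n =>
        ((fun j => (z.1 j).re, z.2.1.re, z.2.2.re) : Reduced ℝ n) := by
      refine (continuous_pi fun j => ?_).prodMk (Continuous.prodMk ?_ ?_) <;> fun_prop
    have h0 : ((fun j => ((0 : Reduced ℂ n).1 j).re, (0 : Reduced ℂ n).2.1.re,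
        (0 : Reduced ℂ n).2.2.re) : Reduced ℝ n) = 0 := by
      refine Prod.ext ?_ (Prod.ext ?_ ?_) <;> simp
      rfl
    have : ∀ᶠ z : Reduced ℂ n in 𝓝 0,
        ((fun j => (z.1 j).re, z.2.1.re, z.2.2.re) : Reduced ℝ n) ∈ Metric.ball 0 δ :=
      hc.continuousAt.eventually_mem (by rw [h0]; exact Metric.ball_mem_nhds _ hδ)
    filter_upwards [this] with z hz
    set x : Reduced ℝ n := (fun j => (z.1 j).re, z.2.1.re, z.2.2.re)
    set y : Reduced ℝ n := (fun j => (z.1 j).im, z.2.1.im, z.2.2.im)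
    have hcw : Continuous fun w : ℝ => x + w • y := by fun_prop
    have : ∀ᶠ w : ℝ in 𝓝 0, x + w • y ∈ Metric.ball 0 δ :=
      hcw.continuousAt.eventually_mem (Metric.isOpen_ball.mem_nhds (by simpa using hz))
    filter_upwards [this] with w hw
    rw [← hδf _ hw]
    congr 1
    simpa using ((toComplexL n).map_add x (w • y)).symm
  -- For `|w| < 2` the point `x + w y` has norm at most `3 ‖z‖`; hence the radius `ρ / 3`.
  filter_upwards [Metric.ball_mem_nhds (0 : Reduced ℂ n) (ε := ρ / 3) (by positivity), key]
    with z hz hw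
  set x : Reduced ℝ n := (fun j => (z.1 j).re, z.2.1.re, z.2.2.re)
  set y : Reduced ℝ n := (fun j => (z.1 j).im, z.2.1.im, z.2.2.im)
  have hz1 : toComplex x + Complex.I • toComplex y = z := by
    refine Prod.ext ?_ (Prod.ext ?_ ?_)
    · ext j; simp [toComplex, x, y, mul_comm Complex.I, Complex.re_add_im]
    · simp [toComplex, x, y, mul_comm Complex.I, Complex.re_add_im]
    · simp [toComplex, x, y, mul_comm Complex.I, Complex.re_add_im]
  rw [mem_ball_zero_iff] at hz
  have hc : ∀ j, ‖z.1 j‖ ≤ ‖z‖ := fun j => (norm_le_pi_norm z.1 j).trans (norm_fst_le z)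
  have hc1 : ‖z.2.1‖ ≤ ‖z‖ := (norm_fst_le z.2).trans (norm_snd_le z)
  have hc2 : ‖z.2.2‖ ≤ ‖z‖ := (norm_snd_le z.2).trans (norm_snd_le z)
  have hx : ‖toComplex x‖ ≤ ‖z‖ := by
    refine norm_prod_le_iff.2 ⟨(pi_norm_le_iff_of_nonneg (norm_nonneg _)).2 fun j => ?_,
      norm_prod_le_iff.2 ⟨?_, ?_⟩⟩
    · simpa [toComplex, x, y] using (Complex.abs_re_le_norm _).trans (hc j)
    · simpa [toComplex, x, y] using (Complex.abs_re_le_norm _).trans hc1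
    · simpa [toComplex, x, y] using (Complex.abs_re_le_norm _).trans hc2
  have hy : ‖toComplex y‖ ≤ ‖z‖ := by
    refine norm_prod_le_iff.2 ⟨(pi_norm_le_iff_of_nonneg (norm_nonneg _)).2 fun j => ?_,
      norm_prod_le_iff.2 ⟨?_, ?_⟩⟩
    · simpa [toComplex, x, y] using (Complex.abs_im_le_norm _).trans (hc j)
    · simpa [toComplex, x, y] using (Complex.abs_im_le_norm _).trans hc1
    · simpa [toComplex, x, y] using (Complex.abs_im_le_norm _).trans hc2
  have hana : AnalyticOnNhd ℂ (fun w : ℂ => f (toComplex x + w • toComplex y))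
      (Metric.ball 0 2) := by
    intro w hw
    refine AnalyticAt.fun_comp (hρf _ ?_) (by fun_prop)
    rw [mem_ball_zero_iff] at hw ⊢
    calc _ ≤ ‖toComplex x‖ + ‖w‖ * ‖toComplex y‖ := by
          simpa [norm_smul] using norm_add_le (toComplex x) (w • toComplex y)
      _ ≤ ‖z‖ + 2 * ‖z‖ := by gcongr
      _ < ρ := by linarith
  have hfr : ∃ᶠ w : ℂ in 𝓝[≠] 0, f (toComplex x + w • toComplex y) = 0 := by
    have ht : Filter.Tendsto (fun w : ℝ => (w : ℂ)) (𝓝[≠] 0) (𝓝[≠] 0) := by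
      refine tendsto_nhdsWithin_of_tendsto_nhds_of_eventually_within _ ?_ ?_
      · exact (Complex.continuous_ofReal.tendsto' 0 0 (by simp)).mono_left nhdsWithin_le_nhds
      · filter_upwards [self_mem_nhdsWithin] with w hw
        simpa using hw
    exact ht.frequently (Filter.Eventually.frequently (hw.filter_mono nhdsWithin_le_nhds))
  have := hana.eqOn_zero_of_preconnected_of_frequently_eq_zero
    (convex_ball (0 : ℂ) 2).isPreconnected (by simp) hfr
    (show Complex.I ∈ Metric.ball (0 : ℂ) 2 by simp)
  simpa [hz1] using this

lemma eventually_fderiv_complexification {n : ℕ} {fC : Reduced ℂ n → ℂ} {f : Reduced ℝ n → ℝ}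
    (hC : AnalyticAt ℂ fC 0) (hf : AnalyticAt ℝ f 0)
    (h : ∀ᶠ x in 𝓝 (0 : Reduced ℝ n), fC (toComplex x) = (f x : ℂ)) :
    ∀ᶠ x in 𝓝 (0 : Reduced ℝ n), ∀ v,
      fderiv ℂ fC (toComplex x) (toComplex v) = (fderiv ℝ f x v : ℂ) := by
  have h1 : ∀ᶠ x in 𝓝 (0 : Reduced ℝ n), AnalyticAt ℂ fC (toComplex x) :=
    continuous_toComplex.continuousAt.eventually
      (by rw [toComplex_zero]; exact hC.eventually_analyticAt)
  filter_upwards [h1, hf.eventually_analyticAt, h.eventually_nhds] with x hx hx' hxe v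
  have d1 : HasFDerivAt (fun y => fC (toComplex y))
      (((fderiv ℂ fC (toComplex x)).restrictScalars ℝ) ∘L toComplexL n) x :=
    (hx.differentiableAt.hasFDerivAt.restrictScalars ℝ).comp x (toComplexL n).hasFDerivAt
  have d2 : HasFDerivAt (fun y => (f y : ℂ)) (Complex.ofRealCLM ∘L fderiv ℝ f x) x :=
    Complex.ofRealCLM.hasFDerivAt.comp x hx'.differentiableAt.hasFDerivAt
  have := d1.unique (d2.congr_of_eventuallyEq hxe)
  simpa using congrArg (fun T => T v) this

/-! ### Green's formula for families of loops -/

/-- Stokes on a cylinder: the integrand is the pull-back of `dA`. The terms with second derivatives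
of `Λ` cancel by symmetry, and the sides `t = 0` and `t = 2π` cancel by periodicity. -/
lemma green_loops {V : Type*} [NormedAddCommGroup V] [NormedSpace ℝ V]
    {A : V → V →L[ℝ] ℂ} {Λ : ℝ × ℝ → V} {s₀ s₁ : ℝ}
    (hΛ : ∀ σ ∈ Set.uIcc s₀ s₁, ∀ t, ContDiffAt ℝ 2 Λ (σ, t))
    (hA : ∀ σ ∈ Set.uIcc s₀ s₁, ∀ t, ContDiffAt ℝ 1 A (Λ (σ, t)))
    (hper : ∀ σ t, Λ (σ, t + 2 * Real.pi) = Λ (σ, t)) :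
    (∫ σ in s₀..s₁, ∫ t in (0 : ℝ)..(2 * Real.pi),
        (fderiv ℝ A (Λ (σ, t)) (fderiv ℝ Λ (σ, t) (1, 0)) (fderiv ℝ Λ (σ, t) (0, 1)) -
          fderiv ℝ A (Λ (σ, t)) (fderiv ℝ Λ (σ, t) (0, 1)) (fderiv ℝ Λ (σ, t) (1, 0)))) =
      (∫ t in (0 : ℝ)..(2 * Real.pi), A (Λ (s₁, t)) (fderiv ℝ Λ (s₁, t) (0, 1))) -
        ∫ t in (0 : ℝ)..(2 * Real.pi), A (Λ (s₀, t)) (fderiv ℝ Λ (s₀, t) (0, 1)) := by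
  set F : ℝ × ℝ → ℝ × ℝ → ℂ := fun v x => A (Λ x) (fderiv ℝ Λ x v) with hF
  have hD : ∀ σ ∈ Set.uIcc s₀ s₁, ∀ t, ContDiffAt ℝ 1 (fderiv ℝ Λ) (σ, t) := fun σ hσ t =>
    (hΛ σ hσ t).fderiv_right (by norm_num)
  have hFc : ∀ v, ∀ σ ∈ Set.uIcc s₀ s₁, ∀ t, ContDiffAt ℝ 1 (F v) (σ, t) := fun v σ hσ t =>
    ((hA σ hσ t).comp (σ, t) ((hΛ σ hσ t).of_le (by norm_num))).clm_apply
      ((hD σ hσ t).clm_apply contDiffAt_const)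
  have hFd : ∀ v w, ∀ σ ∈ Set.uIcc s₀ s₁, ∀ t, fderiv ℝ (F v) (σ, t) w =
      fderiv ℝ A (Λ (σ, t)) (fderiv ℝ Λ (σ, t) w) (fderiv ℝ Λ (σ, t) v) +
        A (Λ (σ, t)) (fderiv ℝ (fderiv ℝ Λ) (σ, t) w v) := by
    intro v w σ hσ t
    have h1 : HasFDerivAt (fun x => A (Λ x))
        ((fderiv ℝ A (Λ (σ, t))) ∘L fderiv ℝ Λ (σ, t)) (σ, t) :=
      ((hA σ hσ t).differentiableAt (by norm_num)).hasFDerivAt.comp (σ, t)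
        ((hΛ σ hσ t).differentiableAt (by norm_num)).hasFDerivAt
    have h2 : HasFDerivAt (fun x => fderiv ℝ Λ x v)
        ((fderiv ℝ (fderiv ℝ Λ) (σ, t)).flip v) (σ, t) := by
      have := (((hD σ hσ t).differentiableAt (by norm_num)).hasFDerivAt).clm_apply
        (hasFDerivAt_const v (σ, t))
      simpa using this
    have := h1.clm_apply h2
    rw [this.fderiv]
    simp [add_comm]
  have hFcont : ∀ v, ContinuousOn (F v) (Set.uIcc s₀ s₁ ×ˢ Set.uIcc 0 (2 * Real.pi)) :=
    fun v x hx => (hFc v x.1 hx.1 x.2).continuousAt.continuousWithinAt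
  have hFdcont : ∀ v w, ContinuousOn (fun x => fderiv ℝ (F v) x w)
      (Set.uIcc s₀ s₁ ×ˢ Set.uIcc 0 (2 * Real.pi)) := fun v w x hx =>
    ((((hFc v x.1 hx.1 x.2).fderiv_right (m := 0) (by norm_num)).continuousAt).clm_apply
      continuousAt_const).continuousWithinAt
  have hsub : Set.Ioo (min s₀ s₁) (max s₀ s₁) ⊆ Set.uIcc s₀ s₁ := Set.Ioo_subset_Icc_self
  have key := MeasureTheory.integral2_divergence_prod_of_hasFDerivAt (F (0, 1))
    (fun x => -F (1, 0) x) (fderiv ℝ (F (0, 1))) (fun x => -fderiv ℝ (F (1, 0)) x)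
    s₀ 0 s₁ (2 * Real.pi) (hFcont _) (hFcont _).neg
    (fun x hx => ((hFc _ x.1 (hsub hx.1) x.2).differentiableAt (by norm_num)).hasFDerivAt)
    (fun x hx => ((hFc _ x.1 (hsub hx.1) x.2).differentiableAt (by norm_num)).hasFDerivAt.neg)
    (by
      refine ContinuousOn.integrableOn_compact (isCompact_uIcc.prod isCompact_uIcc) ?_
      exact (hFdcont _ _).add (hFdcont _ _).neg)
  have hperF : ∀ σ, F (1, 0) (σ, 2 * Real.pi) = F (1, 0) (σ, 0) := by
    intro σ
    have h1 : (fun x : ℝ × ℝ => Λ (x + (0, 2 * Real.pi))) = Λ := by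
      ext x
      rw [show x + (0, 2 * Real.pi) = (x.1, x.2 + 2 * Real.pi) by ext <;> simp]
      exact hper x.1 x.2
    have h2 : fderiv ℝ Λ (σ, 2 * Real.pi) = fderiv ℝ Λ (σ, 0) := by
      conv_rhs => rw [← h1, fderiv_comp_add_right]
      simp
    have h3 : Λ (σ, 2 * Real.pi) = Λ (σ, 0) := by simpa using hper σ 0
    simp only [hF, h2, h3]
  simp only [hperF, sub_self, zero_add] at key
  rw [← key]
  refine intervalIntegral.integral_congr fun σ hσ => intervalIntegral.integral_congr fun t _ => ?_
  have hsymm : fderiv ℝ (fderiv ℝ Λ) (σ, t) (1, 0) (0, 1) =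
      fderiv ℝ (fderiv ℝ Λ) (σ, t) (0, 1) (1, 0) :=
    ((hΛ σ hσ t).isSymmSndFDerivAt (by simp)).eq _ _
  simp only [neg_apply]
  rw [hFd _ _ σ hσ t, hFd _ _ σ hσ t, hsymm]
  ring

/-- The coefficient of `dp ∧ dq` in the exterior derivative of a complex 1-form. -/
def curlPQ {n : ℕ} (A : Reduced ℂ n → Reduced ℂ n →L[ℂ] ℂ) (z : Reduced ℂ n) : ℂ :=
  fderiv ℂ A z (0, 1, 0) (0, 0, 1) - fderiv ℂ A z (0, 0, 1) (0, 1, 0)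

/-- Green's formula for the contraction `(λ, σ p, q)` of the loop to the `q`-axis. Since `λ` is
fixed, only the `dp ∧ dq`-coefficient enters. -/
lemma loop_integral_eq {n : ℕ} {A : Reduced ℂ n → Reduced ℂ n →L[ℂ] ℂ} {p : ℝ → ℂ} {q : ℝ → ℝ}
    {lam : Fin (n - 1) → ℂ} (hp : ContDiff ℝ 2 p) (hq : ContDiff ℝ 2 q)
    (hpp : ∀ t, p (t + 2 * Real.pi) = p t) (hqp : ∀ t, q (t + 2 * Real.pi) = q t)
    (hA : ∀ σ ∈ Set.Icc (0 : ℝ) 1, ∀ t, AnalyticAt ℂ A (lam, σ * p t, q t)) :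
    ∫ t in (0 : ℝ)..(2 * Real.pi), A (lam, p t, q t) (0, deriv p t, ((deriv q t : ℝ) : ℂ)) =
      ∫ σ in (0 : ℝ)..1, ∫ t in (0 : ℝ)..(2 * Real.pi),
        curlPQ A (lam, σ * p t, q t) * (p t * ((deriv q t : ℝ) : ℂ)) := by
  set Λ : ℝ × ℝ → Reduced ℂ n := fun x => (lam, x.1 * p x.2, q x.2) with hΛdef
  have hofReal : ContDiff ℝ 2 (fun x : ℝ => (x : ℂ)) := Complex.ofRealCLM.contDiff
  have hΛ : ContDiff ℝ 2 Λ := by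
    refine contDiff_const.prodMk (ContDiff.prodMk ?_ ?_)
    · exact (hofReal.comp contDiff_fst).mul (hp.comp contDiff_snd)
    · exact hofReal.comp (hq.comp contDiff_snd)
  have hdp : ∀ t, HasDerivAt p (deriv p t) t := fun t =>
    (hp.differentiable (by norm_num) t).hasDerivAt
  have hdq : ∀ t, HasDerivAt (fun t => (q t : ℂ)) ((deriv q t : ℝ) : ℂ) t := fun t =>
    ((hq.differentiable (by norm_num) t).hasDerivAt).ofReal_comp
  have hD : ∀ σ t (v : ℝ × ℝ), fderiv ℝ Λ (σ, t) v =
      (0, v.1 * p t + σ * (v.2 * deriv p t), (v.2 : ℂ) * ((deriv q t : ℝ) : ℂ)) := by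
    intro σ t v
    have h1 : HasFDerivAt (fun x : ℝ × ℝ => (x.1 : ℂ)) (Complex.ofRealCLM ∘L
        ContinuousLinearMap.fst ℝ ℝ ℝ) (σ, t) :=
      (Complex.ofRealCLM ∘L ContinuousLinearMap.fst ℝ ℝ ℝ).hasFDerivAt
    have h2 : HasFDerivAt (fun x : ℝ × ℝ => p x.2) _ (σ, t) :=
      HasFDerivAt.comp (σ, t) (hdp t).hasFDerivAt hasFDerivAt_snd
    have h3 : HasFDerivAt (fun x : ℝ × ℝ => (q x.2 : ℂ)) _ (σ, t) :=
      HasFDerivAt.comp (g := fun t => (q t : ℂ)) (σ, t) (hdq t).hasFDerivAt hasFDerivAt_snd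
    have := (hasFDerivAt_const lam (σ, t)).prodMk ((h1.mul h2).prodMk h3)
    have hfd : fderiv ℝ Λ (σ, t) = _ := HasFDerivAt.fderiv this
    rw [hfd]
    simp
    ring
  have hAR : ∀ σ ∈ Set.Icc (0 : ℝ) 1, ∀ t, HasFDerivAt
      (fun z => (A z).restrictScalars ℝ)
      ((ContinuousLinearMap.restrictScalarsL ℂ (Reduced ℂ n) ℂ ℝ ℝ) ∘L
        (fderiv ℂ A (Λ (σ, t))).restrictScalars ℝ) (Λ (σ, t)) := fun σ hσ t =>
    (ContinuousLinearMap.restrictScalarsL ℂ (Reduced ℂ n) ℂ ℝ ℝ).hasFDerivAt.comp _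
      ((hA σ hσ t).differentiableAt.hasFDerivAt.restrictScalars ℝ)
  have hARc : ∀ σ ∈ Set.Icc (0 : ℝ) 1, ∀ t, ContDiffAt ℝ 1
      (fun z => (A z).restrictScalars ℝ) (Λ (σ, t)) := fun σ hσ t =>
    (ContinuousLinearMap.restrictScalarsL ℂ (Reduced ℂ n) ℂ ℝ ℝ).contDiff.contDiffAt.comp _
      ((hA σ hσ t).contDiffAt.restrict_scalars ℝ)
  have key := green_loops (A := fun z => (A z).restrictScalars ℝ) (Λ := Λ) (s₀ := 0) (s₁ := 1)
    (fun σ _ t => hΛ.contDiffAt) (fun σ hσ t => hARc σ (by simpa using hσ) t)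
    (fun σ t => by simp [hΛdef, hpp, hqp])
  -- The contracted loop runs back and forth along the `q`-axis: the substitution `x = q t` gives an
  -- integral between equal endpoints.
  have h0 : ∫ t in (0 : ℝ)..(2 * Real.pi),
      ((A (Λ (0, t))).restrictScalars ℝ) (fderiv ℝ Λ (0, t) (0, 1)) = 0 := by
    have hB : ContinuousOn (fun x : ℝ => A (lam, 0, (x : ℂ)) (0, 0, 1))
        (q '' Set.uIcc 0 (2 * Real.pi)) := by
      rintro _ ⟨t, _, rfl⟩
      have h1 : ContinuousAt A (lam, 0, (q t : ℂ)) := by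
        simpa using (hA 0 (by simp) t).continuousAt
      have h2 : ContinuousAt (fun x : ℝ => (lam, (0 : ℂ), (x : ℂ))) (q t) := by fun_prop
      exact ((ContinuousAt.comp (f := fun x : ℝ => (lam, (0 : ℂ), (x : ℂ))) h1 h2).clm_apply
        continuousAt_const).continuousWithinAt
    have := intervalIntegral.integral_deriv_smul_comp'' (a := 0) (b := 2 * Real.pi)
      (f := q) (f' := deriv q) (g := fun x : ℝ => A (lam, 0, (x : ℂ)) (0, 0, 1))
      hq.continuous.continuousOn
      (fun t _ => (hq.differentiable (by norm_num) t).hasDerivAt.hasDerivWithinAt)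
      (hq.continuous_deriv (by norm_num)).continuousOn hB
    rw [show q (2 * Real.pi) = q 0 by simpa using hqp 0, intervalIntegral.integral_same] at this
    rw [← this]
    refine intervalIntegral.integral_congr fun t _ => ?_
    simp only [hD, ContinuousLinearMap.coe_restrictScalars', Function.comp_apply]
    simp only [hΛdef]
    rw [show ((0 : Fin (n - 1) → ℂ), ((0 : ℝ) : ℂ) * p t + ((0 : ℝ) : ℂ) * (((1 : ℝ) : ℂ) * deriv p t),
        ((1 : ℝ) : ℂ) * ((deriv q t : ℝ) : ℂ)) = ((deriv q t : ℝ) : ℂ) • ((0 : Fin (n - 1) → ℂ), (0 : ℂ), (1 : ℂ))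
        by simp, map_smul]
    simp
  rw [h0, sub_zero] at key
  have h1 : ∫ t in (0 : ℝ)..(2 * Real.pi), A (lam, p t, q t) (0, deriv p t, ((deriv q t : ℝ) : ℂ)) =
      ∫ t in (0 : ℝ)..(2 * Real.pi),
      ((A (Λ (1, t))).restrictScalars ℝ) (fderiv ℝ Λ (1, t) (0, 1)) := by
    refine intervalIntegral.integral_congr fun t _ => ?_
    simp only [hD, ContinuousLinearMap.coe_restrictScalars']
    simp [hΛdef]
  rw [h1, ← key]
  refine intervalIntegral.integral_congr fun σ hσ => intervalIntegral.integral_congr fun t _ => ?_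
  have hv : ∀ v w, fderiv ℝ (fun z => (A z).restrictScalars ℝ) (Λ (σ, t)) v w =
      fderiv ℂ A (Λ (σ, t)) v w := fun v w => by
    rw [(hAR σ (by simpa using hσ) t).fderiv]
    rfl
  simp only [hD, hv]
  -- The tangent vectors are `p ∂_p` and `σ p' ∂_p + q' ∂_q`; the term `σ p'` drops out by
  -- antisymmetry.
  have e1 : ((0 : Fin (n - 1) → ℂ), ((1 : ℝ) : ℂ) * p t + (σ : ℂ) * (((0 : ℝ) : ℂ) * deriv p t),
      ((0 : ℝ) : ℂ) * ((deriv q t : ℝ) : ℂ)) = p t • ((0 : Fin (n - 1) → ℂ), (1 : ℂ), (0 : ℂ)) := by simp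
  have e2 : ((0 : Fin (n - 1) → ℂ), ((0 : ℝ) : ℂ) * p t + (σ : ℂ) * (((1 : ℝ) : ℂ) * deriv p t),
      ((1 : ℝ) : ℂ) * ((deriv q t : ℝ) : ℂ)) = ((σ : ℂ) * deriv p t) • ((0 : Fin (n - 1) → ℂ), (1 : ℂ), (0 : ℂ)) +
        ((deriv q t : ℝ) : ℂ) • ((0 : Fin (n - 1) → ℂ), (0 : ℂ), (1 : ℂ)) := by simp
  rw [e1, e2]
  simp only [map_smul, map_add, smul_apply, add_apply,
    smul_eq_mul, curlPQ, hΛdef]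
  ring

open Polynomial in
/-- The polynomial `x ^ (n + 1) + ∑ⱼ λⱼ xʲ - h` attached to `b = (h, λ)`. -/
def swPoly {n : ℕ} (b : Base n) : Polynomial ℝ :=
  X ^ (n + 1) + (∑ j : Fin (n - 1), C (b.2 j) * X ^ ((j : ℕ) + 1) - C b.1)

/-! ### The polynomial attached to a point of the base -/

lemma eval_swPoly {n : ℕ} (b : Base n) (x : ℝ) : (swPoly b).eval x =
    x ^ (n + 1) + ∑ j : Fin (n - 1), b.2 j * x ^ ((j : ℕ) + 1) - b.1 := by
  simp [swPoly, Polynomial.eval_finsetSum, add_sub_assoc]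

lemma aeval_swPoly {n : ℕ} (b : Base n) (x : ℂ) : Polynomial.aeval x (swPoly b) =
    x ^ (n + 1) + ∑ j : Fin (n - 1), (b.2 j : ℂ) * x ^ ((j : ℕ) + 1) - b.1 := by
  simp [swPoly, add_sub_assoc]

lemma eval_derivative_swPoly {n : ℕ} (b : Base n) (x : ℝ) :
    (Polynomial.derivative (swPoly b)).eval x =
      (n + 1) * x ^ n + ∑ j : Fin (n - 1), (((j : ℕ) : ℝ) + 1) * b.2 j * x ^ (j : ℕ) := by
  simp only [swPoly, Polynomial.derivative_add, Polynomial.derivative_sub, Polynomial.derivative_C,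
    Polynomial.derivative_sum, Polynomial.derivative_X_pow, Polynomial.derivative_C_mul_X_pow,
    Polynomial.eval_add, Polynomial.eval_finsetSum, Polynomial.eval_mul,
    Polynomial.eval_C, Polynomial.eval_pow, Polynomial.eval_X, sub_zero,
    Nat.add_sub_cancel]
  push_cast
  congr 1
  exact Finset.sum_congr rfl fun j _ => by ring

lemma degree_swPoly_tail {n : ℕ} (b : Base n) :
    (∑ j : Fin (n - 1), Polynomial.C (b.2 j) * Polynomial.X ^ ((j : ℕ) + 1)
      - Polynomial.C b.1).degree < ((n + 1 : ℕ) : WithBot ℕ) := by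
  refine (Polynomial.degree_sub_le _ _).trans_lt (max_lt ?_ ?_)
  · refine (Polynomial.degree_sum_le _ _).trans_lt ((Finset.sup_lt_iff ?_).2 fun j _ => ?_)
    · exact WithBot.bot_lt_coe _
    · refine (Polynomial.degree_C_mul_X_pow_le _ _).trans_lt ?_
      exact_mod_cast (by omega : (j : ℕ) + 1 < n + 1)
  · exact Polynomial.degree_C_le.trans_lt (by exact_mod_cast Nat.succ_pos n)

lemma swPoly_monic {n : ℕ} (b : Base n) : (swPoly b).Monic :=
  Polynomial.monic_X_pow_add (degree_swPoly_tail b)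

lemma degree_swPoly {n : ℕ} (b : Base n) : (swPoly b).degree = ((n + 1 : ℕ) : WithBot ℕ) := by
  rw [swPoly, Polynomial.degree_add_eq_left_of_degree_lt, Polynomial.degree_X_pow]
  rw [Polynomial.degree_X_pow]
  exact degree_swPoly_tail b

lemma prod_eq_swPoly_iff {n : ℕ} {b : Base n} {q : Fin (n + 1) → ℝ} :
    ∏ i, (Polynomial.X - Polynomial.C (q i)) = swPoly b ↔
      ∀ x : ℝ, ∏ i, (x - q i) = x ^ (n + 1) + ∑ j : Fin (n - 1), b.2 j * x ^ ((j : ℕ) + 1) - b.1 := by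
  constructor
  · intro h x
    rw [← eval_swPoly, ← h, Polynomial.eval_prod]
    simp
  · intro h
    refine Polynomial.funext fun x => ?_
    rw [eval_swPoly, ← h, Polynomial.eval_prod]
    simp

lemma IsRootTuple.prod_eq {n : ℕ} {b : Base n} {q : Fin (n + 1) → ℝ} (h : IsRootTuple b q) :
    ∏ i, (Polynomial.X - Polynomial.C (q i)) = swPoly b := prod_eq_swPoly_iff.2 h.2

/-- Two monic polynomials of degree `n + 1` that agree at `n + 1` distinct points coincide. -/
lemma isRootTuple_of_roots {n : ℕ} {b : Base n} {q : Fin (n + 1) → ℝ} (hq : StrictMono q)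
    (h : ∀ i, (swPoly b).eval (q i) = 0) : IsRootTuple b q := by
  refine ⟨hq, prod_eq_swPoly_iff.1 ?_⟩
  have hd : (∏ i, (Polynomial.X - Polynomial.C (q i))).degree = ((n + 1 : ℕ) : WithBot ℕ) := by
    rw [Polynomial.degree_prod]
    simp
  refine Polynomial.eq_of_degree_le_of_eval_index_eq (s := Finset.univ) (v := q)
    hq.injective.injOn (by simp [hd]) (by rw [hd, degree_swPoly]) ?_ fun i _ => ?_
  · rw [Polynomial.Monic.leadingCoeff (swPoly_monic b), Polynomial.Monic.leadingCoeff]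
    exact Polynomial.monic_prod_of_monic _ _ fun i _ => Polynomial.monic_X_sub_C _
  · rw [h, Polynomial.eval_prod]
    exact Finset.prod_eq_zero (Finset.mem_univ i) (by simp)

lemma mem_standardSwallowtail_of_injective {n : ℕ} {b : Base n} {q : Fin (n + 1) → ℝ}
    (hq : Function.Injective q) (h : ∀ i, (swPoly b).eval (q i) = 0) :
    b ∈ standardSwallowtail n :=
  ⟨q ∘ Tuple.sort q, isRootTuple_of_roots
    ((Tuple.monotone_sort q).strictMono_of_injective (hq.comp (Tuple.sort q).injective))
    fun _ => h _⟩

lemma IsRootTuple.eval_eq_zero_iff {n : ℕ} {b : Base n} {q : Fin (n + 1) → ℝ}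
    (h : IsRootTuple b q) (x : ℝ) : (swPoly b).eval x = 0 ↔ x ∈ Set.range q := by
  rw [← h.prod_eq, Polynomial.eval_prod, Finset.prod_eq_zero_iff]
  simp [sub_eq_zero, eq_comm]

lemma IsRootTuple.unique {n : ℕ} {b : Base n} {q q' : Fin (n + 1) → ℝ}
    (h : IsRootTuple b q) (h' : IsRootTuple b q') : q = q' := by
  refine (h.1.range_inj h'.1).1 ?_
  ext x
  rw [← h.eval_eq_zero_iff, ← h'.eval_eq_zero_iff]

lemma rootTuple_spec {n : ℕ} {b : Base n} (h : b ∈ standardSwallowtail n) :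
    IsRootTuple b (rootTuple b) := by
  have h' : ∃ q, IsRootTuple b q := h
  rw [rootTuple, dif_pos h']
  exact h'.choose_spec

lemma IsRootTuple.rootTuple_eq {n : ℕ} {b : Base n} {q : Fin (n + 1) → ℝ}
    (h : IsRootTuple b q) : rootTuple b = q := (rootTuple_spec ⟨q, h⟩).unique h

lemma IsRootTuple.separable {n : ℕ} {b : Base n} {q : Fin (n + 1) → ℝ}
    (h : IsRootTuple b q) : (swPoly b).Separable := by
  rw [← h.prod_eq]
  exact Polynomial.separable_prod_X_sub_C_iff.2 h.1.injective

/-- The polynomial attached to `b` has a multiple real root. -/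
def HasMultipleRoot {n : ℕ} (b : Base n) : Prop :=
  ∃ x : ℝ, (swPoly b).eval x = 0 ∧ (Polynomial.derivative (swPoly b)).eval x = 0

lemma not_hasMultipleRoot {n : ℕ} {b : Base n} (h : b ∈ standardSwallowtail n) :
    ¬ HasMultipleRoot b := by
  rintro ⟨x, hx, hx'⟩
  obtain ⟨q, hq⟩ := h
  have := hq.separable.eval₂_derivative_ne_zero (RingHom.id ℝ) (x := x)
    (by simpa [Polynomial.eval₂_id] using hx)
  exact this (by simpa [Polynomial.eval₂_id] using hx')

/-! ### Continuity of the roots -/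

lemma contDiff_eval_swPoly {n : ℕ} {k : ℕ∞ω} :
    ContDiff ℝ k (fun u : Base n × ℝ => (swPoly u.1).eval u.2) := by
  simp only [eval_swPoly]
  refine ((contDiff_snd.pow _).add (ContDiff.sum fun j _ => ?_)).sub (contDiff_fst.fst)
  exact ((contDiff_apply ℝ ℝ j).comp contDiff_fst.snd).mul (contDiff_snd.pow _)

lemma exists_smooth_root {n : ℕ} {b : Base n} {x : ℝ} (hx : (swPoly b).eval x = 0)
    (hx' : (Polynomial.derivative (swPoly b)).eval x ≠ 0) :
    ∃ r : Base n → ℝ, ContDiffAt ℝ 2 r b ∧ r b = x ∧ ∀ᶠ c in 𝓝 b, (swPoly c).eval (r c) = 0 := by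
  have hf : ContDiffAt ℝ 2 (fun u : Base n × ℝ => (swPoly u.1).eval u.2) (b, x) :=
    contDiff_eval_swPoly.contDiffAt
  set f := fun u : Base n × ℝ => (swPoly u.1).eval u.2
  have h1 : fderiv ℝ f (b, x) ∘L .inr ℝ (Base n) ℝ =
      ((ContinuousLinearEquiv.unitsEquivAut ℝ (Units.mk0 _ hx') : ℝ ≃L[ℝ] ℝ) : ℝ →L[ℝ] ℝ) := by
    have h2 : HasFDerivAt (fun y => f (b, y)) (fderiv ℝ f (b, x) ∘L .inr ℝ (Base n) ℝ) x :=
      HasFDerivAt.comp (g := f) x ((hf.differentiableAt (by norm_num)).hasFDerivAt)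
        (hasFDerivAt_prodMk_right b x)
    have h3 := (Polynomial.hasDerivAt (swPoly b) x).hasFDerivAt
    rw [h2.unique h3]
    ext
    simp
  have hinv : (fderiv ℝ f (b, x) ∘L .inr ℝ (Base n) ℝ).IsInvertible := ⟨_, h1.symm⟩
  refine ⟨hf.implicitFunction (by norm_num) hinv, hf.contDiffAt_implicitFunction _ _,
    hf.implicitFunction_apply_self _ _, ?_⟩
  filter_upwards [hf.eventually_apply_implicitFunction (by norm_num) hinv] with c hc
  rw [show f (b, x) = 0 from hx] at hc
  exact hc

/-- Each simple root continues smoothly by the implicit function theorem, the strict order persists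
nearby, and uniqueness identifies the continued tuple with the chosen one. Class `C²` is what
Green's formula needs. -/
lemma rootTuple_contDiffAt {n : ℕ} {b : Base n} (h : b ∈ standardSwallowtail n) :
    (∀ᶠ c in 𝓝 b, c ∈ standardSwallowtail n) ∧ ContDiffAt ℝ 2 (rootTuple (n := n)) b := by
  have hq := rootTuple_spec h
  have h0 : ∀ i, (swPoly b).eval (rootTuple b i) = 0 := fun i =>
    (hq.eval_eq_zero_iff _).2 ⟨i, rfl⟩
  choose r hr hrb hre using fun i => exists_smooth_root (h0 i)
    (fun h' => not_hasMultipleRoot h ⟨_, h0 i, h'⟩)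
  have hr' : ContDiffAt ℝ 2 (fun c i => r i c) b := contDiffAt_pi.2 hr
  have hev : ∀ᶠ c in 𝓝 b, IsRootTuple c (fun i => r i c) := by
    have hm : ∀ᶠ c in 𝓝 b, ∀ i j : Fin (n + 1), i < j → r i c < r j c := by
      simp only [Filter.eventually_all]
      intro i j hij
      exact (hr i).continuousAt.eventually_lt (hr j).continuousAt
        (by rw [hrb, hrb]; exact hq.1 hij)
    filter_upwards [hm, Filter.eventually_all.2 hre] with c hc1 hc2
    exact isRootTuple_of_roots (fun i j hij => hc1 i j hij) hc2
  refine ⟨hev.mono fun c hc => ⟨_, hc⟩, hr'.congr_of_eventuallyEq ?_⟩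
  filter_upwards [hev] with c hc
  exact hc.rootTuple_eq

lemma isOpen_standardSwallowtail (n : ℕ) : IsOpen (standardSwallowtail n) :=
  isOpen_iff_mem_nhds.2 fun _ h => (rootTuple_contDiffAt h).1

/-- A Cauchy-type root bound. It serves twice: to confine the roots to a bounded interval, and, once
`|x| ≤ 1`, to make them tend to 0 with `b`. -/
lemma abs_root_pow_le {n : ℕ} {b : Base n} {x : ℝ} (hx : (swPoly b).eval x = 0) :
    |x| ^ (n + 1) ≤ ‖b‖ * (n + 1) * max 1 |x| ^ n := by
  rw [eval_swPoly] at hx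
  set m := max 1 |x|
  have hm : 1 ≤ m := le_max_left _ _
  have hb1 : |b.1| ≤ ‖b‖ := norm_fst_le b
  have hb2 : ∀ j, |b.2 j| ≤ ‖b‖ := fun j => (norm_le_pi_norm b.2 j).trans (norm_snd_le b)
  have h1 : x ^ (n + 1) = b.1 - ∑ j : Fin (n - 1), b.2 j * x ^ ((j : ℕ) + 1) := by linarith
  calc |x| ^ (n + 1) = |b.1 - ∑ j : Fin (n - 1), b.2 j * x ^ ((j : ℕ) + 1)| := by
        rw [← abs_pow, h1]
    _ ≤ |b.1| + ∑ j : Fin (n - 1), |b.2 j| * |x| ^ ((j : ℕ) + 1) := by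
        refine (abs_sub _ _).trans (add_le_add le_rfl ((Finset.abs_sum_le_sum_abs _ _).trans ?_))
        simp [abs_mul, abs_pow]
    _ ≤ ‖b‖ * m ^ n + ∑ j : Fin (n - 1), ‖b‖ * m ^ n := by
        refine add_le_add ?_ (Finset.sum_le_sum fun j _ => ?_)
        · exact hb1.trans (le_mul_of_one_le_right (norm_nonneg _) (one_le_pow₀ hm))
        · refine mul_le_mul (hb2 j) ?_ (by positivity) (norm_nonneg _)
          exact (pow_le_pow_left₀ (abs_nonneg x) (le_max_right _ _) _).trans
            (pow_le_pow_right₀ hm (by omega))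
    _ ≤ ‖b‖ * (n + 1) * m ^ n := by
        simp only [Finset.sum_const, Finset.card_univ, Fintype.card_fin, nsmul_eq_mul]
        have : ((n - 1 : ℕ) : ℝ) ≤ n := by exact_mod_cast Nat.sub_le n 1
        have h0 : 0 ≤ ‖b‖ * m ^ n := by positivity
        nlinarith

lemma abs_root_le {n : ℕ} {b : Base n} {x : ℝ} (hx : (swPoly b).eval x = 0) :
    |x| ≤ max 1 (‖b‖ * (n + 1)) := by
  rcases le_total |x| 1 with h | h
  · exact h.trans (le_max_left _ _)
  · refine le_trans ?_ (le_max_right _ _)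
    have := abs_root_pow_le hx
    rw [max_eq_right h, pow_succ', mul_le_mul_iff_left₀ (by positivity)] at this
    exact this

lemma eventually_abs_root_lt (n : ℕ) {ε : ℝ} (hε : 0 < ε) :
    ∀ᶠ b in 𝓝 (0 : Base n), ∀ x, (swPoly b).eval x = 0 → |x| < ε := by
  have hc : Continuous fun b : Base n => ‖b‖ * ((n : ℝ) + 1) := by fun_prop
  have h1 : ∀ᶠ b in 𝓝 (0 : Base n), ‖b‖ * ((n : ℝ) + 1) < 1 :=
    hc.continuousAt.eventually_lt_const (by simp)
  have h2 : ∀ᶠ b in 𝓝 (0 : Base n), ‖b‖ * ((n : ℝ) + 1) < ε ^ (n + 1) :=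
    hc.continuousAt.eventually_lt_const (by simpa using by positivity)
  filter_upwards [h1, h2] with b hb1 hb2 x hx
  have h3 := abs_root_le hx
  rw [max_eq_left hb1.le] at h3
  have h4 := abs_root_pow_le hx
  rw [max_eq_left h3, one_pow, mul_one] at h4
  exact lt_of_pow_lt_pow_left₀ (n + 1) hε.le (h4.trans_lt hb2)

/-- By compactness the root tuples converge along a subsequence to real roots of the limit
polynomial, and two roots that collide in the limit would give a multiple root. -/
lemma mem_standardSwallowtail_of_mem_closure {n : ℕ} {b : Base n}
    (hb : b ∈ closure (standardSwallowtail n)) (hm : ¬ HasMultipleRoot b) :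
    b ∈ standardSwallowtail n := by
  obtain ⟨u, hu, hub⟩ := mem_closure_iff_seq_limit.1 hb
  obtain ⟨R, hR⟩ := (Metric.isBounded_range_of_tendsto u hub).exists_norm_le
  have hbd : ∀ m, rootTuple (u m) ∈
      Metric.closedBall (0 : Fin (n + 1) → ℝ) (max 1 (R * (n + 1))) := by
    intro m
    rw [mem_closedBall_zero_iff, pi_norm_le_iff_of_nonneg (by positivity)]
    intro i
    refine (abs_root_le (((rootTuple_spec (hu m)).eval_eq_zero_iff _).2 ⟨i, rfl⟩)).trans ?_
    gcongr
    exact hR _ ⟨m, rfl⟩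
  obtain ⟨q, -, φ, hφ, hq⟩ := tendsto_subseq_of_bounded Metric.isBounded_closedBall hbd
  have hprod : ∏ i, (Polynomial.X - Polynomial.C (q i)) = swPoly b := by
    refine prod_eq_swPoly_iff.2 fun x => ?_
    have h1 : Filter.Tendsto (fun m => ∏ i, (x - rootTuple (u (φ m)) i)) Filter.atTop
        (𝓝 (∏ i, (x - q i))) :=
      tendsto_finsetProd _ fun i _ => tendsto_const_nhds.sub ((tendsto_pi_nhds.1 hq) i)
    have hc : Continuous fun c : Base n =>
        x ^ (n + 1) + ∑ j : Fin (n - 1), c.2 j * x ^ ((j : ℕ) + 1) - c.1 := by fun_prop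
    have h2 := (hc.tendsto b).comp (hub.comp hφ.tendsto_atTop)
    refine tendsto_nhds_unique h1 (h2.congr fun m => ?_)
    exact ((rootTuple_spec (hu (φ m))).2 x).symm
  have hroot : ∀ i, (swPoly b).eval (q i) = 0 := fun i => by
    rw [← hprod, Polynomial.eval_prod]
    exact Finset.prod_eq_zero (Finset.mem_univ i) (by simp)
  refine mem_standardSwallowtail_of_injective (q := q) (fun i j hij => ?_) hroot
  by_contra hne
  refine hm ⟨q i, hroot i, ?_⟩
  -- Each term of the product rule omits one factor only, while the factors of index `i` and `j`
  -- both vanish at `q i`.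
  rw [← hprod, Polynomial.derivative_prod_finset, Polynomial.eval_finsetSum]
  refine Finset.sum_eq_zero fun l _ => ?_
  rw [Polynomial.eval_mul, Polynomial.eval_prod]
  rcases eq_or_ne l i with rfl | hl
  · rw [Finset.prod_eq_zero (Finset.mem_erase.2 ⟨Ne.symm hne, Finset.mem_univ j⟩) (by simp [hij]),
      zero_mul]
  · rw [Finset.prod_eq_zero (Finset.mem_erase.2 ⟨hl.symm, Finset.mem_univ i⟩) (by simp), zero_mul]

/-- The swallowtail domain is open, and closed relative to the complement of the multiple-root
locus. The parameter 0 is left out because the paths used below end at the origin, where all roots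
collide. -/
lemma mem_standardSwallowtail_of_path {n : ℕ} {c : ℝ → Base n}
    (hc : ContinuousOn c (Set.Ioc 0 1)) (hm : ∀ r ∈ Set.Ioc (0 : ℝ) 1, ¬ HasMultipleRoot (c r))
    (h0 : ∀ᶠ r in 𝓝[>] (0 : ℝ), c r ∈ standardSwallowtail n) :
    ∀ r ∈ Set.Ioc (0 : ℝ) 1, c r ∈ standardSwallowtail n := by
  have hpre : IsPreconnected (c '' Set.Ioc 0 1) := isPreconnected_Ioc.image _ hc
  obtain ⟨r, hr, hr'⟩ := (h0.and (Ioc_mem_nhdsGT zero_lt_one)).exists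
  have := hpre.subset_of_closure_inter_subset (isOpen_standardSwallowtail n)
    ⟨c r, ⟨r, hr', rfl⟩, hr⟩ (by
      rintro _ ⟨h, r, hr, rfl⟩
      exact mem_standardSwallowtail_of_mem_closure h (hm r hr))
  exact fun r hr => this ⟨r, hr, rfl⟩

/-! ### Quasi-homogeneous scaling -/

/-- The quasi-homogeneous scaling `(h, λⱼ) ↦ (a ^ (n + 1) h, a ^ (n + 1 - j) λⱼ)`. -/
def scale {n : ℕ} (a : ℝ) (b : Base n) : Base n :=
  (a ^ (n + 1) * b.1, fun j => a ^ (n - (j : ℕ)) * b.2 j)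

/-- The exponents of `-1` on the two sides have the same parity. This identity is the source of the
symmetry in the theorem. -/
lemma psi_eq_scale {n : ℕ} : psi (n := n) = scale (-1) := by
  funext b
  refine Prod.ext rfl (funext fun j => ?_)
  simp only [psi, scale]
  rw [show n + 1 + ((j : ℕ) + 1) = (n - j) + 2 * ((j : ℕ) + 1) by omega, pow_add, pow_mul]
  simp

lemma scale_scale {n : ℕ} (a a' : ℝ) (b : Base n) : scale a (scale a' b) = scale (a * a') b := by
  refine Prod.ext ?_ (funext fun j => ?_) <;> simp only [scale, mul_pow, mul_assoc]

@[simp] lemma scale_one {n : ℕ} (b : Base n) : scale 1 b = b := by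
  refine Prod.ext ?_ (funext fun j => ?_) <;> simp [scale]

@[simp] lemma scale_zero_right {n : ℕ} (a : ℝ) : scale a (0 : Base n) = 0 := by
  refine Prod.ext ?_ (funext fun j => ?_) <;> simp [scale]

lemma scale_zero_left {n : ℕ} (b : Base n) : scale 0 b = 0 := by
  refine Prod.ext ?_ (funext fun j => ?_)
  · simp [scale]
  · have : n - (j : ℕ) ≠ 0 := by omega
    simp [scale, this]

lemma norm_scale_le {n : ℕ} {a : ℝ} (ha : |a| ≤ 1) (b : Base n) : ‖scale a b‖ ≤ ‖b‖ := by
  refine norm_prod_le_iff.2 ⟨?_, (pi_norm_le_iff_of_nonneg (norm_nonneg _)).2 fun j => ?_⟩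
  · simp only [scale, norm_mul, norm_pow, Real.norm_eq_abs]
    exact (mul_le_of_le_one_left (abs_nonneg _) (pow_le_one₀ (abs_nonneg _) ha)).trans
      (norm_fst_le b)
  · simp only [scale, norm_mul, norm_pow, Real.norm_eq_abs]
    exact (mul_le_of_le_one_left (abs_nonneg _) (pow_le_one₀ (abs_nonneg _) ha)).trans
      ((norm_le_pi_norm b.2 j).trans (norm_snd_le b))

lemma contDiff_scale {n : ℕ} {k : ℕ∞ω} :
    ContDiff ℝ k (fun u : ℝ × Base n => scale u.1 u.2) := by
  refine ((contDiff_fst.pow _).mul contDiff_snd.fst).prodMk (contDiff_pi.2 fun j => ?_)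
  exact (contDiff_fst.pow _).mul ((contDiff_apply ℝ ℝ j).comp contDiff_snd.snd)

lemma continuous_scale {n : ℕ} : Continuous (fun u : ℝ × Base n => scale u.1 u.2) :=
  (contDiff_scale (k := 0)).continuous

/-- Every monomial, including `h`, has total weight `n + 1`. -/
lemma eval_swPoly_scale {n : ℕ} (a : ℝ) (b : Base n) (x : ℝ) :
    (swPoly (scale a b)).eval (a * x) = a ^ (n + 1) * (swPoly b).eval x := by
  rw [eval_swPoly, eval_swPoly, mul_sub, mul_add, Finset.mul_sum, mul_pow]
  congr 2
  refine Finset.sum_congr rfl fun j _ => ?_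
  simp only [scale]
  rw [show n + 1 = (n - j) + ((j : ℕ) + 1) by omega, pow_add a (n - j), mul_pow]
  ring

lemma scale_mem_standardSwallowtail {n : ℕ} {a : ℝ} (ha : a ≠ 0) {b : Base n}
    (h : b ∈ standardSwallowtail n) : scale a b ∈ standardSwallowtail n := by
  obtain ⟨q, hq⟩ := h
  refine mem_standardSwallowtail_of_injective (q := fun i => a * q i)
    (fun i j hij => hq.1.injective (mul_left_cancel₀ ha hij)) fun i => ?_
  rw [eval_swPoly_scale, (hq.eval_eq_zero_iff _).2 ⟨i, rfl⟩, mul_zero]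

lemma rootTuple_scale {n : ℕ} {a : ℝ} (ha : 0 < a) {b : Base n}
    (h : b ∈ standardSwallowtail n) : rootTuple (scale a b) = fun i => a * rootTuple b i := by
  have hq := rootTuple_spec h
  refine IsRootTuple.rootTuple_eq (isRootTuple_of_roots (fun i j hij => ?_) fun i => ?_)
  · exact mul_lt_mul_of_pos_left (hq.1 hij) ha
  · rw [eval_swPoly_scale, (hq.eval_eq_zero_iff _).2 ⟨i, rfl⟩, mul_zero]

lemma rootTuple_scale_neg_one {n : ℕ} {b : Base n} (h : b ∈ standardSwallowtail n) :
    rootTuple (scale (-1) b) = fun i => -rootTuple b i.rev := by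
  have hq := rootTuple_spec h
  refine IsRootTuple.rootTuple_eq (isRootTuple_of_roots (fun i j hij => ?_) fun i => ?_)
  · exact neg_lt_neg (hq.1 (Fin.rev_lt_rev.2 hij))
  · rw [← neg_one_mul, eval_swPoly_scale, (hq.eval_eq_zero_iff _).2 ⟨_, rfl⟩, mul_zero]

/-! ### Vanishing cycles -/

section Cycle

variable {n : ℕ} {q : Fin (n + 1) → ℝ} {k : Fin n}

lemma cycleQ_mem_Icc (hq : StrictMono q) (k : Fin n) (t : ℝ) :
    cycleQ q k t ∈ Set.Icc (q k.castSucc) (q k.succ) := by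
  have h := hq k.castSucc_lt_succ
  have h1 := Real.neg_one_le_cos t
  have h2 := Real.cos_le_one t
  constructor <;> simp only [cycleQ] <;> nlinarith

/-- The negative factors are those of the roots above `q k.succ`, and there are `n - 1 - k` of them.
-/
lemma prod_sub_eq_of_mem_Icc (hq : StrictMono q) {x : ℝ}
    (hx : x ∈ Set.Icc (q k.castSucc) (q k.succ)) :
    ∏ i ∈ Finset.univ \ {k.castSucc, k.succ}, (x - q i) =
      (-1) ^ (n - 1 - (k : ℕ)) * ∏ i ∈ Finset.univ \ {k.castSucc, k.succ}, |x - q i| := by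
  have h1 : ∀ i ∈ Finset.univ \ {k.castSucc, k.succ},
      x - q i = (if k.succ < i then -1 else 1) * |x - q i| := by
    intro i hi
    split_ifs with h
    · rw [abs_of_nonpos (by linarith [hx.2, (hq h).le])]
      ring
    · have hi' : i ≤ k.castSucc := by
        simp only [Finset.mem_sdiff, Finset.mem_insert, Finset.mem_singleton, not_or, Fin.ext_iff,
          Fin.lt_def, Fin.le_def, Fin.val_succ, Fin.val_castSucc, Finset.mem_univ] at hi h ⊢
        omega
      rw [abs_of_nonneg (by linarith [hx.1, hq.monotone hi']), one_mul]
  rw [Finset.prod_congr rfl h1, Finset.prod_mul_distrib]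
  congr 1
  rw [Finset.prod_ite, Finset.prod_const_one, mul_one, Finset.prod_const]
  congr 1
  rw [show (Finset.univ \ {k.castSucc, k.succ}).filter (fun i => k.succ < i) = Finset.Ioi k.succ from ?_,
    Fin.card_Ioi]
  · simp
    omega
  · ext i
    simp only [Finset.mem_filter, Finset.mem_sdiff, Finset.mem_insert, Finset.mem_singleton, not_or,
      Fin.ext_iff, Fin.lt_def, Fin.val_succ, Fin.val_castSucc, Finset.mem_univ, Finset.mem_Ioi,
      true_and]
    omega

lemma prod_eq_mul_prod_sdiff (k : Fin n) (f : Fin (n + 1) → ℝ) :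
    ∏ i, f i = f k.castSucc * f k.succ * ∏ i ∈ Finset.univ \ {k.castSucc, k.succ}, f i := by
  rw [← Finset.prod_sdiff (Finset.subset_univ {k.castSucc, k.succ}),
    Finset.prod_pair k.castSucc_lt_succ.ne, mul_comm]

/-- The two factors that vanish on the cycle multiply to minus the square of half the gap times `sin
t`; this accounts for one more sign than in `prod_sub_eq_of_mem_Icc`. -/
lemma prod_cycleQ_sub (hq : StrictMono q) (k : Fin n) (t : ℝ) :
    ∏ i, (cycleQ q k t - q i) = (-1) ^ (n - (k : ℕ)) * cycleP q k t ^ 2 := by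
  rw [prod_eq_mul_prod_sdiff k, prod_sub_eq_of_mem_Icc hq (cycleQ_mem_Icc hq k t), cycleP, mul_pow,
    Real.sq_sqrt (Finset.prod_nonneg fun i _ => abs_nonneg _),
    show n - (k : ℕ) = (n - 1 - k) + 1 by omega, pow_succ]
  have : (cycleQ q k t - q k.castSucc) * (cycleQ q k t - q k.succ) =
      - ((q k.succ - q k.castSucc) / 2 * Real.sin t) ^ 2 := by
    rw [mul_pow, Real.sin_sq]
    simp only [cycleQ]
    ring
  rw [this]
  ring

/-- The exponents `n + (k + 1)` and `n - 1 - k` have the same parity, so the choice between 1 and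
`i` is exactly the one that puts the cycle on the curve (`cycle_mem_curve`). -/
lemma unitFactor_sq {η : ℝ} (hη : η = 1 ∨ η = -1) (k : Fin n) :
    (η : ℂ) * unitFactor η k ^ 2 = (-1) ^ (n - 1 - (k : ℕ)) := by
  have h1 : (-1 : ℝ) ^ (n + ((k : ℕ) + 1)) = (-1) ^ (n - 1 - (k : ℕ)) := by
    rw [show n + ((k : ℕ) + 1) = (n - 1 - k) + 2 * (k + 1) by omega, pow_add, pow_mul]
    simp
  have h2 : ((-1 : ℂ)) ^ (n - 1 - (k : ℕ)) = (((-1 : ℝ) ^ (n - 1 - (k : ℕ)) : ℝ) : ℂ) := by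
    push_cast; rfl
  rw [h2, ← h1, unitFactor]
  rcases neg_one_pow_eq_or ℝ (n + ((k : ℕ) + 1)) with h | h <;> rcases hη with rfl | rfl <;>
    rw [h] <;> norm_num

lemma unitFactor_ne_zero (η : ℝ) (k : Fin n) : unitFactor η k ≠ 0 := by
  unfold unitFactor
  split_ifs <;> simp

lemma norm_unitFactor (η : ℝ) (k : Fin n) : ‖unitFactor η k‖ = 1 := by
  unfold unitFactor
  split_ifs <;> simp

lemma cycle_mem_curve {η : ℝ} (hη : η = 1 ∨ η = -1) {b : Base n} (hq : IsRootTuple b q)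
    (k : Fin n) (t : ℝ) :
    (η : ℂ) * (unitFactor η k * (cycleP q k t : ℂ)) ^ 2 +
      Polynomial.aeval (cycleQ q k t : ℂ) (swPoly b) = 0 := by
  have h1 : Polynomial.aeval (cycleQ q k t : ℂ) (swPoly b) =
      (((swPoly b).eval (cycleQ q k t) : ℝ) : ℂ) := by
    rw [aeval_swPoly, eval_swPoly]; push_cast; rfl
  rw [h1, ← hq.prod_eq, Polynomial.eval_prod]
  simp only [Polynomial.eval_sub, Polynomial.eval_X, Polynomial.eval_C]
  rw [prod_cycleQ_sub hq.1, mul_pow, ← mul_assoc, unitFactor_sq hη,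
    show n - (k : ℕ) = (n - 1 - k) + 1 by omega]
  push_cast
  ring

lemma cycleQ_periodic (q : Fin (n + 1) → ℝ) (k : Fin n) (t : ℝ) :
    cycleQ q k (t + 2 * Real.pi) = cycleQ q k t := by
  simp [cycleQ]

lemma cycleP_periodic (q : Fin (n + 1) → ℝ) (k : Fin n) (t : ℝ) :
    cycleP q k (t + 2 * Real.pi) = cycleP q k t := by
  simp [cycleP, cycleQ_periodic]

lemma hasDerivAt_cycleQ (q : Fin (n + 1) → ℝ) (k : Fin n) (t : ℝ) :
    HasDerivAt (cycleQ q k) ((q k.succ - q k.castSucc) / 2 * Real.sin t) t := by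
  have := ((Real.hasDerivAt_cos t).const_mul ((q k.succ - q k.castSucc) / 2)).const_sub
    ((q k.castSucc + q k.succ) / 2)
  convert! this using 1
  ring

lemma deriv_cycleQ (q : Fin (n + 1) → ℝ) (k : Fin n) (t : ℝ) :
    deriv (cycleQ q k) t = (q k.succ - q k.castSucc) / 2 * Real.sin t :=
  (hasDerivAt_cycleQ q k t).deriv

lemma prod_abs_pos (hq : StrictMono q) (k : Fin n) (t : ℝ) :
    0 < ∏ i ∈ Finset.univ \ {k.castSucc, k.succ}, |cycleQ q k t - q i| := by
  refine Finset.prod_pos fun i hi => abs_pos.2 (sub_ne_zero.2 fun h => ?_)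
  have hmem := cycleQ_mem_Icc hq k t
  rw [h] at hmem
  have h1 := hq.le_iff_le.1 hmem.1
  have h2 := hq.le_iff_le.1 hmem.2
  simp only [Finset.mem_sdiff, Finset.mem_insert, Finset.mem_singleton, not_or, Fin.ext_iff,
    Fin.le_def, Fin.val_succ, Fin.val_castSucc, Finset.mem_univ] at hi h1 h2
  omega

lemma contDiff_cycleQ (k : Fin n) :
    ContDiff ℝ 2 (fun u : (Fin (n + 1) → ℝ) × ℝ => cycleQ u.1 k u.2) := by
  have h : ∀ i, ContDiff ℝ 2 (fun u : (Fin (n + 1) → ℝ) × ℝ => u.1 i) := fun i =>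
    (contDiff_apply ℝ ℝ i).comp contDiff_fst
  have hc : ContDiff ℝ 2 (fun u : (Fin (n + 1) → ℝ) × ℝ => Real.cos u.2) :=
    Real.contDiff_cos.comp contDiff_snd
  exact (((h _).add (h _)).div_const _).sub ((((h _).sub (h _)).div_const _).mul hc)

lemma contDiffAt_cycleP (hq : StrictMono q) (k : Fin n) (t : ℝ) :
    ContDiffAt ℝ 2 (fun u : (Fin (n + 1) → ℝ) × ℝ => cycleP u.1 k u.2) (q, t) := by
  have h : ∀ i, ContDiff ℝ 2 (fun u : (Fin (n + 1) → ℝ) × ℝ => u.1 i) := fun i =>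
    (contDiff_apply ℝ ℝ i).comp contDiff_fst
  have hs : ContDiff ℝ 2 (fun u : (Fin (n + 1) → ℝ) × ℝ => Real.sin u.2) :=
    Real.contDiff_sin.comp contDiff_snd
  have hp := prod_abs_pos hq k t
  refine (((((h _).sub (h _)).div_const _).mul hs).contDiffAt).mul (ContDiffAt.sqrt ?_ hp.ne')
  refine contDiffAt_prod fun i hi => ?_
  have hne : cycleQ q k t - q i ≠ 0 := by
    intro h0
    exact (Finset.prod_ne_zero_iff.1 hp.ne' i hi) (by simp [h0])
  exact ContDiffAt.comp (g := abs) (f := fun u : (Fin (n + 1) → ℝ) × ℝ => cycleQ u.1 k u.2 - u.1 i)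
    (q, t) (contDiffAt_abs hne) (((contDiff_cycleQ k).sub (h i)).contDiffAt)

lemma contDiff_cycleQ_right (q : Fin (n + 1) → ℝ) (k : Fin n) : ContDiff ℝ 2 (cycleQ q k) :=
  (contDiff_cycleQ k).comp (contDiff_const.prodMk contDiff_id)

lemma contDiff_cycleP_right (hq : StrictMono q) (k : Fin n) : ContDiff ℝ 2 (cycleP q k) :=
  contDiff_iff_contDiffAt.2 fun t => ContDiffAt.comp (f := fun s : ℝ => (q, s)) t
    (contDiffAt_cycleP hq k t) (contDiff_const.prodMk contDiff_id).contDiffAt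

lemma abs_cycleQ_lt {ε : ℝ} (hq : StrictMono q) (h : ∀ i, |q i| < ε) (k : Fin n) (t : ℝ) :
    |cycleQ q k t| < ε := by
  have := cycleQ_mem_Icc hq k t
  exact abs_lt.2 ⟨(abs_lt.1 (h _)).1.trans_le this.1, this.2.trans_lt (abs_lt.1 (h _)).2⟩

/-- When the roots lie within `1 / 2` of 0, all differences under the square root are at most 1, and
half of a gap is at most `ε`. -/
lemma abs_cycleP_le {ε : ℝ} (hε : ε ≤ 1 / 2) (hq : StrictMono q) (h : ∀ i, |q i| < ε) (k : Fin n)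
    (t : ℝ) : |cycleP q k t| ≤ ε := by
  have h1 : √(∏ i ∈ Finset.univ \ {k.castSucc, k.succ}, |cycleQ q k t - q i|) ≤ 1 := by
    rw [Real.sqrt_le_one]
    refine Finset.prod_le_one (fun i _ => abs_nonneg _) fun i _ => ?_
    have := abs_sub (cycleQ q k t) (q i)
    have := abs_cycleQ_lt hq h k t
    have := h i
    linarith
  have h2 : |(q k.succ - q k.castSucc) / 2| ≤ ε := by
    have h3 := abs_lt.1 (h k.succ)
    have h4 := abs_lt.1 (h k.castSucc)
    rw [abs_le]
    constructor <;> linarith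
  rw [cycleP, abs_mul, abs_mul, abs_of_nonneg (Real.sqrt_nonneg _)]
  calc _ ≤ ε * 1 * 1 := by
        have := (abs_nonneg _).trans h2
        gcongr
        exact Real.abs_sin_le_one t
    _ = ε := by ring

lemma cycleQ_smul (s : ℝ) (q : Fin (n + 1) → ℝ) (k : Fin n) (t : ℝ) :
    cycleQ (fun i => s * q i) k t = s * cycleQ q k t := by
  simp only [cycleQ]; ring

/-- Half of the gap contributes `r ^ 2` and the square root of `n - 1` factors contributes `r ^ (n -
1)`. Scaling by `r ^ 2` instead of `r` keeps the weight of `p` an integer. -/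
lemma cycleP_smul {r : ℝ} (hr : 0 ≤ r) (q : Fin (n + 1) → ℝ) (k : Fin n) (t : ℝ) :
    cycleP (fun i => r ^ 2 * q i) k t = r ^ (n + 1) * cycleP q k t := by
  simp only [cycleP, cycleQ_smul, ← mul_sub, abs_mul, Finset.prod_mul_distrib, Finset.prod_const]
  rw [Finset.card_sdiff_of_subset (Finset.subset_univ _), Finset.card_pair k.castSucc_lt_succ.ne,
    Finset.card_univ, Fintype.card_fin, abs_of_nonneg (by positivity), ← pow_mul, mul_comm 2,
    pow_mul, Real.sqrt_mul (by positivity), Real.sqrt_sq (by positivity)]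
  obtain ⟨m, rfl⟩ : ∃ m, n = m + 1 := ⟨n - 1, by have := k.2; omega⟩
  rw [show m + 1 + 1 - 2 = m by omega]
  ring

lemma vanishingCycle_deriv {η : ℝ} (hq : StrictMono q) (k : Fin n) (t : ℝ) :
    deriv (vanishingCycle η q k) t =
      (deriv (fun s => unitFactor η k * (cycleP q k s : ℂ)) t, ((deriv (cycleQ q k) t : ℝ) : ℂ)) := by
  have h1 : HasDerivAt (fun s => (cycleP q k s : ℂ)) ((deriv (cycleP q k) t : ℝ) : ℂ) t :=
    (((contDiff_cycleP_right hq k).differentiable (by norm_num) t).hasDerivAt).ofReal_comp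
  have h2 : HasDerivAt (fun s => (cycleQ q k s : ℂ)) ((deriv (cycleQ q k) t : ℝ) : ℂ) t :=
    (((contDiff_cycleQ_right q k).differentiable (by norm_num) t).hasDerivAt).ofReal_comp
  have h3 := h1.const_mul (unitFactor η k)
  rw [h3.deriv]
  exact (h3.prodMk h2).deriv

/-! ### The area enclosed by a vanishing cycle -/

/-- The integral of `p dq` over the `k`-th vanishing cycle, up to the factor `1` or `i`. -/
def cycleArea (q : Fin (n + 1) → ℝ) (k : Fin n) : ℝ :=
  ∫ t in (0 : ℝ)..(2 * Real.pi), cycleP q k t * deriv (cycleQ q k) t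

lemma cycleP_mul_deriv (q : Fin (n + 1) → ℝ) (k : Fin n) (t : ℝ) :
    cycleP q k t * deriv (cycleQ q k) t = ((q k.succ - q k.castSucc) / 2 * Real.sin t) ^ 2 *
      √(∏ i ∈ Finset.univ \ {k.castSucc, k.succ}, |cycleQ q k t - q i|) := by
  rw [deriv_cycleQ, cycleP]; ring

lemma continuous_cycleP_mul_deriv (hq : StrictMono q) (k : Fin n) :
    Continuous fun t => cycleP q k t * deriv (cycleQ q k) t :=
  (contDiff_cycleP_right hq k).continuous.mul
    ((contDiff_cycleQ_right q k).continuous_deriv (by norm_num))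

lemma cycleArea_pos (hq : StrictMono q) (k : Fin n) : 0 < cycleArea q k := by
  refine intervalIntegral.integral_pos Real.two_pi_pos
    (continuous_cycleP_mul_deriv hq k).continuousOn (fun t _ => ?_) ⟨Real.pi / 2, ?_, ?_⟩
  · rw [cycleP_mul_deriv]; positivity
  · constructor <;> linarith [Real.pi_pos]
  · rw [cycleP_mul_deriv, Real.sin_pi_div_two]
    have h1 := Real.sqrt_pos.2 (prod_abs_pos hq k (Real.pi / 2))
    have h2 : 0 < q k.succ - q k.castSucc := sub_pos.2 (hq k.castSucc_lt_succ)
    positivity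

/-- The reflection `q ↦ -q` sends the `k`-th gap to the reversed one. The parametrisations
correspond under `t ↦ π - t`, which preserves `sin t` and hence the integrand. -/
lemma cycleArea_neg_rev (q : Fin (n + 1) → ℝ) (k : Fin n) :
    cycleArea (fun i => -q i.rev) k = cycleArea q k.rev := by
  have hc : (k.castSucc).rev = k.rev.succ := Fin.rev_castSucc k
  have hs : (k.succ).rev = k.rev.castSucc := Fin.rev_succ k
  have hQ : ∀ t, cycleQ (fun i => -q i.rev) k t = -cycleQ q k.rev (Real.pi - t) := by
    intro t
    simp only [cycleQ, hc, hs, Real.cos_pi_sub]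
    ring
  have key : ∀ t, cycleP (fun i => -q i.rev) k t * deriv (cycleQ (fun i => -q i.rev) k) t =
      cycleP q k.rev (Real.pi - t) * deriv (cycleQ q k.rev) (Real.pi - t) := by
    intro t
    rw [cycleP_mul_deriv, cycleP_mul_deriv, Real.sin_pi_sub, hc, hs]
    congr 1
    · ring
    · congr 1
      refine Finset.prod_bij' (fun i _ => i.rev) (fun i _ => i.rev) ?_ ?_ ?_ ?_ ?_
      · intro i hi
        simp only [Finset.mem_sdiff, Finset.mem_insert, Finset.mem_singleton, not_or, ← hc, ← hs,
          Finset.mem_univ, true_and] at hi ⊢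
        exact ⟨fun h => hi.2 (Fin.rev_inj.1 h), fun h => hi.1 (Fin.rev_inj.1 h)⟩
      · intro i hi
        simp only [Finset.mem_sdiff, Finset.mem_insert, Finset.mem_singleton, not_or, ← hc, ← hs,
          Finset.mem_univ, true_and] at hi ⊢
        rw [← Fin.rev_inj, Fin.rev_rev, ← Fin.rev_inj (i := i.rev), Fin.rev_rev]
        exact hi.symm
      · intro i _; simp
      · intro i _; simp
      · intro i _
        rw [hQ, ← abs_neg]
        congr 1
        ring
  have hper : Function.Periodic (fun t => cycleP q k.rev t * deriv (cycleQ q k.rev) t)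
      (2 * Real.pi) := by
    intro t
    simp [deriv_cycleQ, cycleP_periodic]
  rw [cycleArea, cycleArea, intervalIntegral.integral_congr (g := fun t =>
    cycleP q k.rev (Real.pi - t) * deriv (cycleQ q k.rev) (Real.pi - t)) fun t _ => key t,
    intervalIntegral.integral_comp_sub_left
      (fun t => cycleP q k.rev t * deriv (cycleQ q k.rev) t) Real.pi]
  -- The substitution produces the interval from `π - 2π` to `π`, again one full period.
  have := hper.intervalIntegral_add_eq (Real.pi - 2 * Real.pi) 0
  simpa using this

end Cycle

/-! ### Transition maps between normal forms -/

/-- The germ at `0` of a pair of analytic diffeomorphisms of the phase space and of the base that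
preserves the canonical momentum map, together with its inverse. -/
structure IsTransition (n : ℕ) (η : ℝ) (G G' : Phase n → Phase n) (g g' : Base n → Base n) :
    Prop where
  analytic : AnalyticAt ℝ G 0
  analytic' : AnalyticAt ℝ G' 0
  base_analytic : AnalyticAt ℝ g 0
  base_analytic' : AnalyticAt ℝ g' 0
  map_zero : G 0 = 0
  map_zero' : G' 0 = 0
  base_map_zero : g 0 = 0
  base_map_zero' : g' 0 = 0
  left_inv : ∀ᶠ z in 𝓝 0, G' (G z) = z
  right_inv : ∀ᶠ z in 𝓝 0, G (G' z) = z
  base_left_inv : ∀ᶠ b in 𝓝 0, g' (g b) = b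
  base_right_inv : ∀ᶠ b in 𝓝 0, g (g' b) = b
  comm : ∀ᶠ z in 𝓝 0, canonicalMomentum n η (G z) = g (canonicalMomentum n η z)
  comm' : ∀ᶠ z in 𝓝 0, canonicalMomentum n η (G' z) = g' (canonicalMomentum n η z)
  jac : (fderiv ℝ G 0 (0, 0, 1, 0)).2.2.1 * (fderiv ℝ G 0 (0, 0, 0, 1)).2.2.2 -
    (fderiv ℝ G 0 (0, 0, 0, 1)).2.2.1 * (fderiv ℝ G 0 (0, 0, 1, 0)).2.2.2 ≠ 0
  jac' : (fderiv ℝ G' 0 (0, 0, 1, 0)).2.2.1 * (fderiv ℝ G' 0 (0, 0, 0, 1)).2.2.2 -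
    (fderiv ℝ G' 0 (0, 0, 0, 1)).2.2.1 * (fderiv ℝ G' 0 (0, 0, 1, 0)).2.2.2 ≠ 0

lemma IsTransition.symm {n : ℕ} {η : ℝ} {G G' : Phase n → Phase n} {g g' : Base n → Base n}
    (h : IsTransition n η G G' g g') : IsTransition n η G' G g' g :=
  ⟨h.analytic', h.analytic, h.base_analytic', h.base_analytic, h.map_zero', h.map_zero,
    h.base_map_zero', h.base_map_zero, h.right_inv, h.left_inv, h.base_right_inv, h.base_left_inv,
    h.comm', h.comm, h.jac', h.jac⟩

/-! ### Critical points of the canonical momentum map -/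

lemma canonicalMomentum_add_swPoly {n : ℕ} (η : ℝ) (z : Phase n) :
    η * z.2.2.1 ^ 2 + (swPoly (canonicalMomentum n η z)).eval z.2.2.2 = 0 := by
  rw [eval_swPoly]
  simp only [canonicalMomentum]
  ring

lemma canonicalMomentum_of_root {n : ℕ} (η : ℝ) {b : Base n} {x : ℝ}
    (hx : (swPoly b).eval x = 0) : canonicalMomentum n η (b.2, 0, 0, x) = b := by
  rw [eval_swPoly] at hx
  refine Prod.ext ?_ rfl
  simp only [canonicalMomentum]
  linarith

lemma derivative_swPoly_congr {n : ℕ} {b c : Base n} (h : b.2 = c.2) :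
    Polynomial.derivative (swPoly b) = Polynomial.derivative (swPoly c) := by
  simp [swPoly, h]

lemma contDiff_canonicalMomentum (n : ℕ) (η : ℝ) {k : ℕ∞ω} :
    ContDiff ℝ k (canonicalMomentum n η) := by
  have hp : ContDiff ℝ k (fun z : Phase n => z.2.2.1) := contDiff_snd.snd.fst
  have hq : ContDiff ℝ k (fun z : Phase n => z.2.2.2) := contDiff_snd.snd.snd
  refine ContDiff.prodMk ?_ contDiff_fst
  refine ((contDiff_const.mul (hp.pow _)).add (hq.pow _)).add (ContDiff.sum fun j _ => ?_)
  exact ((contDiff_apply ℝ ℝ j).comp contDiff_fst).mul (hq.pow _)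

@[simp] lemma canonicalMomentum_zero {n : ℕ} (η : ℝ) : canonicalMomentum n η 0 = 0 := by
  refine Prod.ext ?_ rfl
  simp [canonicalMomentum]

lemma fderiv_canonicalMomentum {n : ℕ} (η : ℝ) (z v : Phase n) :
    fderiv ℝ (canonicalMomentum n η) z v =
      (2 * η * z.2.2.1 * v.2.2.1 +
        (Polynomial.derivative (swPoly (canonicalMomentum n η z))).eval z.2.2.2 * v.2.2.2 +
        ∑ j : Fin (n - 1), v.1 j * z.2.2.2 ^ ((j : ℕ) + 1), v.1) := by
  have hd : HasDerivAt (fun s : ℝ => canonicalMomentum n η (z + s • v))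
      (2 * η * z.2.2.1 * v.2.2.1 +
        (Polynomial.derivative (swPoly (canonicalMomentum n η z))).eval z.2.2.2 * v.2.2.2 +
        ∑ j : Fin (n - 1), v.1 j * z.2.2.2 ^ ((j : ℕ) + 1), v.1) 0 := by
    have hlin : ∀ a c : ℝ, HasDerivAt (fun s : ℝ => a + s * c) c 0 := fun a c => by
      simpa using ((hasDerivAt_id (0 : ℝ)).mul_const c).const_add a
    refine HasDerivAt.prodMk ?_ ?_
    · have h1 := ((hlin z.2.2.1 v.2.2.1).pow 2).const_mul η
      have h2 := (hlin z.2.2.2 v.2.2.2).pow (n + 1)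
      have h3 : ∀ j : Fin (n - 1), HasDerivAt (fun s : ℝ => (z.1 j + s * v.1 j) *
          (z.2.2.2 + s * v.2.2.2) ^ ((j : ℕ) + 1)) _ 0 := fun j =>
        (hlin (z.1 j) (v.1 j)).mul ((hlin z.2.2.2 v.2.2.2).pow ((j : ℕ) + 1))
      have h4 := (h1.add h2).add (HasDerivAt.fun_sum fun j (_ : j ∈ Finset.univ) => h3 j)
      refine (h4.congr_deriv ?_)
      rw [eval_derivative_swPoly]
      simp only [canonicalMomentum, zero_mul, add_zero, Nat.add_sub_cancel, Finset.sum_add_distrib,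
        add_mul, Finset.sum_mul]
      push_cast
      have : ∑ j : Fin (n - 1), z.1 j * ((((j : ℕ) : ℝ) + 1) * z.2.2.2 ^ (j : ℕ) * v.2.2.2) =
          ∑ j : Fin (n - 1), (((j : ℕ) : ℝ) * z.1 j * z.2.2.2 ^ (j : ℕ) * v.2.2.2 +
            1 * z.1 j * z.2.2.2 ^ (j : ℕ) * v.2.2.2) :=
        Finset.sum_congr rfl fun j _ => by ring
      simp only [add_mul] at this ⊢
      rw [this, Finset.sum_add_distrib]
      ring
    · exact hasDerivAt_pi.2 fun j => hlin (z.1 j) (v.1 j)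
  have hf : HasFDerivAt (canonicalMomentum n η) (fderiv ℝ (canonicalMomentum n η) z)
      (z + (0 : ℝ) • v) := by
    rw [zero_smul, add_zero]
    exact ((contDiff_canonicalMomentum n η (k := 1)).differentiable (by norm_num) z).hasFDerivAt
  have hl : HasDerivAt (fun s : ℝ => z + s • v) v 0 := by
    simpa using ((hasDerivAt_id (0 : ℝ)).smul_const v).const_add z
  have h5 := HasFDerivAt.comp_hasDerivAt (f := fun s : ℝ => z + s • v) (0 : ℝ) hf hl
  exact h5.unique hd

/-- The critical points of the canonical momentum map. -/
def IsCrit {n : ℕ} (η : ℝ) (z : Phase n) : Prop :=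
  z.2.2.1 = 0 ∧ (Polynomial.derivative (swPoly (canonicalMomentum n η z))).eval z.2.2.2 = 0

lemma isCrit_iff {n : ℕ} {η : ℝ} (hη : η ≠ 0) (z : Phase n) :
    IsCrit η z ↔ ¬ Function.Surjective (fderiv ℝ (canonicalMomentum n η) z) := by
  constructor
  · rintro ⟨h1, h2⟩ hs
    obtain ⟨v, hv⟩ := hs (1, 0)
    rw [fderiv_canonicalMomentum, h1, h2] at hv
    have e2 : v.1 = 0 := congrArg Prod.snd hv
    have e1 := congrArg Prod.fst hv
    simp [e2] at e1
  · intro hs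
    by_contra hc
    refine hs fun y => ?_
    by_cases h1 : z.2.2.1 = 0
    · have h2 : (Polynomial.derivative (swPoly (canonicalMomentum n η z))).eval z.2.2.2 ≠ 0 :=
        fun h2 => hc ⟨h1, h2⟩
      refine ⟨(y.2, 0, 0, (y.1 - ∑ j : Fin (n - 1), y.2 j * z.2.2.2 ^ ((j : ℕ) + 1)) /
        (Polynomial.derivative (swPoly (canonicalMomentum n η z))).eval z.2.2.2), ?_⟩
      rw [fderiv_canonicalMomentum]
      refine Prod.ext ?_ rfl
      simp only [mul_zero, zero_add]
      field_simp
      ring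
    · refine ⟨(y.2, 0, (y.1 - ∑ j : Fin (n - 1), y.2 j * z.2.2.2 ^ ((j : ℕ) + 1)) /
        (2 * η * z.2.2.1), 0), ?_⟩
      rw [fderiv_canonicalMomentum]
      refine Prod.ext ?_ rfl
      simp only [mul_zero, add_zero]
      field_simp
      ring

section Transition

variable {n : ℕ} {η : ℝ} {G G' : Phase n → Phase n} {g g' : Base n → Base n}

lemma tendsto_canonicalMomentum_zero (n : ℕ) (η : ℝ) :
    Filter.Tendsto (canonicalMomentum n η) (𝓝 0) (𝓝 0) :=
  ((contDiff_canonicalMomentum n η (k := 0)).continuous).tendsto' 0 0 (canonicalMomentum_zero η)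

lemma IsTransition.tendsto (h : IsTransition n η G G' g g') : Filter.Tendsto G (𝓝 0) (𝓝 0) := by
  simpa [h.map_zero] using h.analytic.continuousAt.tendsto

lemma IsTransition.base_tendsto (h : IsTransition n η G G' g g') :
    Filter.Tendsto g (𝓝 0) (𝓝 0) := by
  simpa [h.base_map_zero] using h.base_analytic.continuousAt.tendsto

/-- Being critical means that the differential of the momentum map is not onto (`isCrit_iff`). This
is invariant because `G` and `g` intertwine the momentum map with itself and have invertible
differentials. -/
lemma IsTransition.eventually_isCrit (h : IsTransition n η G G' g g') (hη : η ≠ 0) :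
    ∀ᶠ z in 𝓝 0, IsCrit η z → IsCrit η (G z) := by
  have hF := tendsto_canonicalMomentum_zero n η
  filter_upwards [h.analytic.eventually_analyticAt,
    h.tendsto.eventually h.analytic'.eventually_analyticAt, h.left_inv,
    h.tendsto.eventually h.right_inv.eventually_nhds, h.comm.eventually_nhds,
    hF.eventually h.base_analytic.eventually_analyticAt,
    hF.eventually (h.base_tendsto.eventually h.base_analytic'.eventually_analyticAt),
    hF.eventually h.base_left_inv.eventually_nhds]
    with z hGz hG'z hl hr hc hgz hg'z hlb hcrit
  have hFd : ∀ w, HasFDerivAt (canonicalMomentum n η) (fderiv ℝ (canonicalMomentum n η) w) w :=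
    fun w => ((contDiff_canonicalMomentum n η (k := 1)).differentiable (by norm_num) w).hasFDerivAt
  rw [isCrit_iff hη] at hcrit ⊢
  refine fun hs => hcrit fun y => ?_
  have d1 : (fderiv ℝ (canonicalMomentum n η) (G z)) ∘L fderiv ℝ G z =
      (fderiv ℝ g (canonicalMomentum n η z)) ∘L fderiv ℝ (canonicalMomentum n η) z :=
    ((hFd (G z)).comp z hGz.differentiableAt.hasFDerivAt).unique
      ((hgz.differentiableAt.hasFDerivAt.comp z (hFd z)).congr_of_eventuallyEq hc)
  have d2 : (fderiv ℝ G z) ∘L fderiv ℝ G' (G z) = ContinuousLinearMap.id ℝ (Phase n) := by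
    have h1 : HasFDerivAt G (fderiv ℝ G z) (G' (G z)) := by
      rw [hl]; exact hGz.differentiableAt.hasFDerivAt
    exact (h1.comp (G z) hG'z.differentiableAt.hasFDerivAt).unique
      ((hasFDerivAt_id (G z)).congr_of_eventuallyEq hr)
  have d3 : (fderiv ℝ g' (g (canonicalMomentum n η z))) ∘L fderiv ℝ g (canonicalMomentum n η z) =
      ContinuousLinearMap.id ℝ (Base n) :=
    (hg'z.differentiableAt.hasFDerivAt.comp _ hgz.differentiableAt.hasFDerivAt).unique
      ((hasFDerivAt_id _).congr_of_eventuallyEq hlb)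
  obtain ⟨u, hu⟩ := hs (fderiv ℝ g (canonicalMomentum n η z) y)
  refine ⟨fderiv ℝ G' (G z) u, ?_⟩
  have e1 := congrArg (fun T => T (fderiv ℝ G' (G z) u)) d1
  have e2 := congrArg (fun T => T u) d2
  simp only [ContinuousLinearMap.comp_apply, ContinuousLinearMap.id_apply] at e1 e2
  rw [e2, hu] at e1
  have e3 := congrArg (fderiv ℝ g' (g (canonicalMomentum n η z))) e1
  have e4 := fun w => congrArg (fun T => T w) d3
  simp only [ContinuousLinearMap.comp_apply, ContinuousLinearMap.id_apply] at e4
  rw [e4, e4] at e3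
  exact e3.symm

/-- A multiple root `x` for `b = (h, λ)` is a critical point `(λ, 0, 0, x)` over `b`, and `G`
carries it to a critical point over `g b`. Roots are small for small `b`, so this point stays in the
domain where `G` is controlled. -/
lemma IsTransition.eventually_hasMultipleRoot (h : IsTransition n η G G' g g') (hη : η ≠ 0) :
    ∀ᶠ b in 𝓝 0, HasMultipleRoot b → HasMultipleRoot (g b) := by
  obtain ⟨δ, hδ, hδ'⟩ := Metric.eventually_nhds_iff_ball.1 ((h.eventually_isCrit hη).and h.comm)
  filter_upwards [Metric.ball_mem_nhds (0 : Base n) hδ, eventually_abs_root_lt n hδ]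
    with b hb hbr ⟨x, hx, hx'⟩
  have hF := canonicalMomentum_of_root η hx
  have hz : ((b.2, 0, 0, x) : Phase n) ∈ Metric.ball 0 δ := by
    rw [mem_ball_zero_iff] at hb ⊢
    simp only [Prod.norm_def, norm_zero, Real.norm_eq_abs, max_lt_iff]
    exact ⟨(norm_snd_le b).trans_lt hb, hδ, hδ, hbr x hx⟩
  obtain ⟨hc, hcomm⟩ := hδ' _ hz
  obtain ⟨h1, h2⟩ := hc ⟨rfl, by rw [hF]; exact hx'⟩
  have h3 := canonicalMomentum_add_swPoly η (G (b.2, 0, 0, x))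
  rw [h1] at h3
  rw [hcomm, hF] at h2 h3
  exact ⟨_, by simpa using h3, h2⟩

end Transition

/-! ### Quasi-homogeneous limits of transition maps -/

/-- Cramer's rule expresses `w` through the determinant and the adjugate, which are continuous in
the matrix. -/
lemma tendsto_of_mulVec_tendsto {ι α : Type*} [Fintype ι] [DecidableEq ι] {l : Filter α}
    {A : α → Matrix ι ι ℝ} {A₀ : Matrix ι ι ℝ} {w : α → ι → ℝ} {w₀ : ι → ℝ}
    (hA : Filter.Tendsto A l (𝓝 A₀)) (hdet : A₀.det ≠ 0)
    (hr : Filter.Tendsto (fun s => (A s).mulVec (w s)) l (𝓝 (A₀.mulVec w₀))) :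
    Filter.Tendsto w l (𝓝 w₀) := by
  have hd : Filter.Tendsto (fun s => (A s).det) l (𝓝 A₀.det) :=
    ((continuous_id.matrix_det).tendsto A₀).comp hA
  have ha : Filter.Tendsto (fun s => (A s).adjugate) l (𝓝 A₀.adjugate) :=
    ((continuous_id.matrix_adjugate).tendsto A₀).comp hA
  have hsolve : ∀ (B : Matrix ι ι ℝ) (v : ι → ℝ), B.det ≠ 0 →
      (B.det)⁻¹ • B.adjugate.mulVec (B.mulVec v) = v := by
    intro B v hB
    rw [Matrix.mulVec_mulVec, Matrix.adjugate_mul, Matrix.smul_mulVec, Matrix.one_mulVec, smul_smul,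
      inv_mul_cancel₀ hB, one_smul]
  have hm : Filter.Tendsto (fun s => (A s).adjugate.mulVec ((A s).mulVec (w s))) l
      (𝓝 (A₀.adjugate.mulVec (A₀.mulVec w₀))) := by
    refine tendsto_pi_nhds.2 fun i => ?_
    simp only [Matrix.mulVec, dotProduct] at hr ⊢
    exact tendsto_finsetSum _ fun j _ =>
      (tendsto_pi_nhds.1 (tendsto_pi_nhds.1 ha i) j).mul (tendsto_pi_nhds.1 hr j)
  have := (hd.inv₀ hdet).smul hm
  rw [hsolve _ _ hdet] at this
  refine this.congr' ?_
  filter_upwards [hd.eventually_ne hdet] with s hs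
  exact hsolve _ _ hs

lemma eval_derivative_swPoly_scale {n : ℕ} {a : ℝ} (ha : a ≠ 0) (b : Base n) (x : ℝ) :
    (Polynomial.derivative (swPoly (scale a b))).eval (a * x) =
      a ^ n * (Polynomial.derivative (swPoly b)).eval x := by
  have h1 : HasDerivAt (fun y => (swPoly (scale a b)).eval (a * y))
      ((Polynomial.derivative (swPoly (scale a b))).eval (a * x) * a) x := by
    have := (Polynomial.hasDerivAt (swPoly (scale a b)) (a * x)).comp x
      ((hasDerivAt_id x).const_mul a)
    simpa using! this
  have h2 : HasDerivAt (fun y => (swPoly (scale a b)).eval (a * y))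
      (a ^ (n + 1) * (Polynomial.derivative (swPoly b)).eval x) x := by
    simp only [eval_swPoly_scale]
    exact (Polynomial.hasDerivAt (swPoly b) x).const_mul _
  have := h1.unique h2
  apply mul_right_cancel₀ ha
  rw [this]
  ring

lemma IsRootTuple.exists_critical {n : ℕ} {b : Base n} {q : Fin (n + 1) → ℝ} (h : IsRootTuple b q)
    (i : Fin n) : ∃ x ∈ Set.Ioo (q i.castSucc) (q i.succ),
      (Polynomial.derivative (swPoly b)).eval x = 0 := by
  have h0 : ∀ i, (swPoly b).eval (q i) = 0 := fun i => (h.eval_eq_zero_iff _).2 ⟨i, rfl⟩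
  obtain ⟨x, hx, hx'⟩ := exists_deriv_eq_zero (f := fun x => (swPoly b).eval x)
    (h.1 i.castSucc_lt_succ) (swPoly b).continuous.continuousOn (by simp only [h0])
  exact ⟨x, hx, by simpa using hx'⟩

/-- The sign alternates from gap to gap; this is used to separate two critical values. -/
lemma IsRootTuple.eval_of_mem_Ioo {n : ℕ} {b : Base n} {q : Fin (n + 1) → ℝ} (h : IsRootTuple b q)
    {i : Fin n} {x : ℝ} (hx : x ∈ Set.Ioo (q i.castSucc) (q i.succ)) :
    ∃ c : ℝ, 0 < c ∧ (swPoly b).eval x = (-1) ^ (n - (i : ℕ)) * c := by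
  have hx' : x ∈ Set.Icc (q i.castSucc) (q i.succ) := Set.Ioo_subset_Icc_self hx
  refine ⟨(x - q i.castSucc) * (q i.succ - x) *
    ∏ j ∈ Finset.univ \ {i.castSucc, i.succ}, |x - q j|, ?_, ?_⟩
  · refine mul_pos (mul_pos (sub_pos.2 hx.1) (sub_pos.2 hx.2)) (Finset.prod_pos fun j hj => ?_)
    refine abs_pos.2 (sub_ne_zero.2 fun hxj => ?_)
    rw [hxj] at hx
    have h1 := h.1.lt_iff_lt.1 hx.1
    have h2 := h.1.lt_iff_lt.1 hx.2
    simp only [Fin.lt_def, Fin.val_succ, Fin.val_castSucc] at h1 h2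
    omega
  · rw [← h.prod_eq, Polynomial.eval_prod]
    simp only [Polynomial.eval_sub, Polynomial.eval_X, Polynomial.eval_C]
    rw [prod_eq_mul_prod_sdiff i, prod_sub_eq_of_mem_Icc h.1 hx',
      show n - (i : ℕ) = (n - 1 - i) + 1 by omega, pow_succ]
    ring

section Limit

variable {n : ℕ} {η : ℝ} {G G' : Phase n → Phase n} {g g' : Base n → Base n}

/-- Both points move with `s`, so differentiability at 0 would not do: strict differentiability of
`g` is used. -/
lemma IsTransition.tendsto_base_sub (h : IsTransition n η G G' g g') {c c' : ℝ → Base n}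
    {w : Base n} {m : ℕ} (hc : Filter.Tendsto c (𝓝[>] 0) (𝓝 0))
    (hc' : Filter.Tendsto c' (𝓝[>] 0) (𝓝 0)) (hcc : ∀ s, c s - c' s = s ^ m • w) :
    Filter.Tendsto (fun s => (s ^ m)⁻¹ • (g (c s) - g (c' s))) (𝓝[>] 0) (𝓝 (fderiv ℝ g 0 w)) := by
  have hs := h.base_analytic.hasStrictFDerivAt
  have ho := (hs.isLittleO.comp_tendsto (hc.prodMk_nhds hc'))
  have ho' : (fun s => g (c s) - g (c' s) - s ^ m • fderiv ℝ g 0 w) =o[𝓝[>] 0]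
      fun s : ℝ => s ^ m := by
    refine (ho.congr_left fun s => ?_).trans_isBigO ?_
    · simp only [Function.comp_apply]
      rw [hcc, map_smul]
    · refine Asymptotics.IsBigO.of_bound ‖w‖ (Filter.Eventually.of_forall fun s => ?_)
      simp only [Function.comp_apply, hcc, norm_smul]
      rw [mul_comm]
  have h1 : Filter.Tendsto (fun s : ℝ => (s ^ m)⁻¹ • (g (c s) - g (c' s) - s ^ m • fderiv ℝ g 0 w))
      (𝓝[>] 0) (𝓝 0) := by
    refine squeeze_zero_norm' (Filter.Eventually.of_forall fun s => ?_)
      (ho'.norm_norm.tendsto_div_nhds_zero)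
    rw [norm_smul, norm_inv, inv_mul_eq_div]
  have h2 := h1.add_const (fderiv ℝ g 0 w)
  rw [zero_add] at h2
  refine h2.congr' ?_
  filter_upwards [self_mem_nhdsWithin] with s hs
  have : s ^ m ≠ 0 := pow_ne_zero _ (ne_of_gt hs)
  rw [smul_sub, smul_smul, inv_mul_cancel₀ this, one_smul, sub_add_cancel]

lemma IsTransition.tendsto_phase (h : IsTransition n η G G' g g') {z : ℝ → Phase n} {v : Phase n}
    (hz : HasDerivAt z v 0) (hz0 : z 0 = 0) :
    Filter.Tendsto (fun s => s⁻¹ • G (z s)) (𝓝[>] 0) (𝓝 (fderiv ℝ G 0 v)) := by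
  have h1 : HasFDerivAt G (fderiv ℝ G 0) (z 0) := by
    rw [hz0]; exact h.analytic.differentiableAt.hasFDerivAt
  have h2 := (hasDerivAt_iff_tendsto_slope_zero.1 (h1.comp_hasDerivAt 0 hz)).mono_left
    (nhdsGT_le_nhdsNE 0)
  simpa [hz0, h.map_zero] using h2

lemma tendsto_inv_pow_mul_pow {f : ℝ → ℝ} {L : ℝ} {m k : ℕ} (hk : k < m)
    (hf : Filter.Tendsto (fun s => (s ^ m)⁻¹ * f s) (𝓝[>] 0) (𝓝 L)) :
    Filter.Tendsto (fun s => (s ^ k)⁻¹ * f s) (𝓝[>] 0) (𝓝 0) := by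
  have h1 : Filter.Tendsto (fun s : ℝ => s ^ (m - k)) (𝓝[>] 0) (𝓝 0) :=
    ((continuous_pow (m - k)).tendsto' 0 0 (zero_pow (by omega))).mono_left nhdsWithin_le_nhds
  have h2 := h1.mul hf
  rw [zero_mul] at h2
  refine h2.congr' ?_
  filter_upwards [self_mem_nhdsWithin] with s hs
  have hs' : s ≠ 0 := ne_of_gt hs
  rw [show s ^ m = s ^ (m - k) * s ^ k by rw [← pow_add]; congr 1; omega]
  field_simp

/-- The weights `n - j` of the components of `λ` are at least 2, so only the `q`-coordinate has a
first-order term. -/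
lemma hasDerivAt_phase_path (b : Base n) (x : ℝ) :
    HasDerivAt (fun s : ℝ => (((scale s b).2, 0, 0, s * x) : Phase n)) (0, 0, 0, x) 0 := by
  refine HasDerivAt.prodMk (hasDerivAt_pi.2 fun j => ?_) ((hasDerivAt_const _ _).prodMk
    ((hasDerivAt_const _ _).prodMk ?_))
  · have := (hasDerivAt_pow (n - (j : ℕ)) (0 : ℝ)).mul_const (b.2 j)
    have h0 : n - (j : ℕ) - 1 ≠ 0 := by omega
    simpa [h0] using! this
  · simpa using (hasDerivAt_id (0 : ℝ)).mul_const x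

lemma tendsto_zero_of_inv_smul {V : Type*} [NormedAddCommGroup V] [NormedSpace ℝ V] {f : ℝ → V}
    {L : V} (hf : Filter.Tendsto (fun s => s⁻¹ • f s) (𝓝[>] 0) (𝓝 L)) :
    Filter.Tendsto f (𝓝[>] 0) (𝓝 0) := by
  have h1 : Filter.Tendsto (fun s : ℝ => s) (𝓝[>] 0) (𝓝 0) := nhdsWithin_le_nhds
  have h2 := h1.smul hf
  rw [zero_smul] at h2
  refine h2.congr' ?_
  filter_upwards [self_mem_nhdsWithin] with s hs
  rw [smul_smul, mul_inv_cancel₀ (ne_of_gt hs), one_smul]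

/-- The derivative of the `q`-component of a transition map along the `q`-axis. -/
def axisFactor (G : Phase n → Phase n) : ℝ := (fderiv ℝ G 0 (0, 0, 0, 1)).2.2.2

/-- On the `q`-axis the momentum is `(s ^ (n + 1), 0)`, so its image under `g` is `O(s ^ (n + 1)) =
o(s²)` because `n ≥ 2`. Dividing the energy of the image point by `s²` leaves only `η` times the
square of the first-order `p`-component, which must vanish. The Jacobian `jac` then reduces to a
product with the factor `axisFactor G`. -/
lemma IsTransition.axisFactor_ne_zero (h : IsTransition n η G G' g g') (hn : 2 ≤ n) (hη : η ≠ 0) :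
    axisFactor G ≠ 0 := by
  have hz := hasDerivAt_phase_path (0 : Base n) 1
  have ht := h.tendsto_phase hz (by simp)
  simp only [scale_zero_right, mul_one] at ht hz
  set P : ℝ → ℝ := fun s => (G ((0 : Base n).2, 0, 0, s)).2.2.1 with hP
  set Q : ℝ → ℝ := fun s => (G ((0 : Base n).2, 0, 0, s)).2.2.2 with hQ
  have hp : Filter.Tendsto (fun s => s⁻¹ * P s) (𝓝[>] 0) (𝓝 (fderiv ℝ G 0 (0, 0, 0, 1)).2.2.1) :=
    (((continuous_fst.comp continuous_snd).comp continuous_snd).tendsto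
      (fderiv ℝ G 0 (0, 0, 0, 1))).comp ht
  have hq : Filter.Tendsto (fun s => s⁻¹ * Q s) (𝓝[>] 0) (𝓝 (fderiv ℝ G 0 (0, 0, 0, 1)).2.2.2) :=
    (((continuous_snd.comp continuous_snd).comp continuous_snd).tendsto
      (fderiv ℝ G 0 (0, 0, 0, 1))).comp ht
  have hQ0 : Filter.Tendsto Q (𝓝[>] 0) (𝓝 0) := tendsto_zero_of_inv_smul hq
  have hc : Filter.Tendsto (fun s : ℝ => ((s ^ (n + 1), 0) : Base n)) (𝓝[>] 0) (𝓝 0) := by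
    have : Continuous (fun s : ℝ => ((s ^ (n + 1), 0) : Base n)) := by fun_prop
    exact (this.tendsto' 0 0 (by simp)).mono_left nhdsWithin_le_nhds
  have hg := h.tendsto_base_sub (m := n + 1) (w := (1, 0)) hc
    (tendsto_const_nhds (x := (0 : Base n))) (fun s => by simp)
  simp only [h.base_map_zero, sub_zero] at hg
  have hg1 := tendsto_inv_pow_mul_pow (k := 2) (by omega)
    ((continuous_fst.tendsto _).comp hg : Filter.Tendsto
      (fun s : ℝ => (s ^ (n + 1))⁻¹ * (g (s ^ (n + 1), 0)).1) (𝓝[>] 0) _)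
  have hgj : ∀ j, Filter.Tendsto (fun s : ℝ => (s ^ 2)⁻¹ * (g (s ^ (n + 1), 0)).2 j) (𝓝[>] 0)
      (𝓝 0) := fun j => tendsto_inv_pow_mul_pow (m := n + 1) (by omega)
    ((((continuous_apply j).comp continuous_snd).tendsto _).comp hg : Filter.Tendsto
      (fun s : ℝ => (s ^ (n + 1))⁻¹ * (g (s ^ (n + 1), 0)).2 j) (𝓝[>] 0) _)
  have hz0 : Filter.Tendsto (fun s : ℝ => (((0 : Base n).2, 0, 0, s) : Phase n)) (𝓝[>] 0) (𝓝 0) := by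
    have := hz.continuousAt.tendsto.mono_left (nhdsWithin_le_nhds (s := Set.Ioi 0))
    simpa using! this
  have hQn : Filter.Tendsto (fun s : ℝ => (s ^ 2)⁻¹ * Q s ^ (n + 1)) (𝓝[>] 0) (𝓝 0) := by
    refine tendsto_inv_pow_mul_pow (m := n + 1) (by omega) ((hq.pow (n + 1)).congr fun s => ?_)
    rw [mul_pow, inv_pow]
  have key : Filter.Tendsto (fun s => η * (s⁻¹ * P s) ^ 2) (𝓝[>] 0) (𝓝 0) := by
    have hsum : Filter.Tendsto (fun s : ℝ => ∑ j : Fin (n - 1),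
        ((s ^ 2)⁻¹ * (g (s ^ (n + 1), 0)).2 j) * Q s ^ ((j : ℕ) + 1)) (𝓝[>] 0) (𝓝 0) := by
      have := tendsto_finsetSum (Finset.univ : Finset (Fin (n - 1))) fun j _ =>
        (hgj j).mul (hQ0.pow ((j : ℕ) + 1))
      simpa using this
    have := (hg1.sub hQn).sub hsum
    simp only [sub_zero] at this
    refine this.congr' ?_
    filter_upwards [hz0.eventually h.comm, self_mem_nhdsWithin] with s hs hs0
    have hs0' : s ≠ 0 := ne_of_gt hs0
    have e0 : canonicalMomentum n η ((0 : Base n).2, 0, 0, s) = (s ^ (n + 1), 0) := by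
      refine Prod.ext ?_ rfl
      simp [canonicalMomentum]
    rw [e0] at hs
    have e1 := congrArg Prod.fst hs
    have e2 := congrArg Prod.snd hs
    have e3 : (g (s ^ (n + 1), 0)).1 = η * P s ^ 2 + Q s ^ (n + 1) +
        ∑ j : Fin (n - 1), (g (s ^ (n + 1), 0)).2 j * Q s ^ ((j : ℕ) + 1) := by
      rw [← e2]; exact e1.symm
    rw [e3]
    simp only [mul_assoc, ← Finset.mul_sum]
    ring
  have hp2 := (hp.pow 2).const_mul η
  have hzero := tendsto_nhds_unique key hp2
  have hpz : (fderiv ℝ G 0 (0, 0, 0, 1)).2.2.1 = 0 := by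
    have := hzero.symm
    rcases mul_eq_zero.1 this with h' | h'
    · exact absurd h' hη
    · exact pow_eq_zero_iff (two_ne_zero) |>.1 h'
  intro ha
  apply h.jac
  rw [hpz]
  rw [axisFactor] at ha
  rw [ha]
  ring

/-- By Rolle the polynomial of `b` has a critical point in each gap. `G` sends the corresponding
critical points of the momentum map, located at `q = s xᵢ`, to critical points with `q ~ s a xᵢ`.
Knowing the critical points to leading order determines the coefficients `λ` to leading order, and
the critical values then determine `h`. -/
lemma IsTransition.tendsto_scale (h : IsTransition n η G G' g g') (hn : 2 ≤ n) (hη : η ≠ 0)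
    {b : Base n} (hb : b ∈ standardSwallowtail n) :
    Filter.Tendsto (fun s => scale s⁻¹ (g (scale s b))) (𝓝[>] 0)
      (𝓝 (scale (axisFactor G) b)) := by
  obtain ⟨q, hq⟩ := hb
  set a := axisFactor G with ha
  have ha0 : a ≠ 0 := h.axisFactor_ne_zero hn hη
  choose x hxmem hx using fun i : Fin n => hq.exists_critical i
  -- the critical points and their images
  set z : Fin n → ℝ → Phase n := fun i s => ((scale s b).2, 0, 0, s * x i) with hz
  -- The value of `h` for which `x i` becomes a multiple root, `λ` being kept.
  set v : Fin n → ℝ := fun i => b.1 + (swPoly b).eval (x i) with hv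
  set c : Fin n → ℝ → Base n := fun i s => (s ^ (n + 1) * v i, (scale s b).2) with hc
  have hFz : ∀ i s, canonicalMomentum n η (z i s) = c i s := by
    intro i s
    refine Prod.ext ?_ rfl
    have := eval_swPoly_scale s b (x i)
    rw [eval_swPoly] at this
    simp only [canonicalMomentum, hz, hc, hv]
    have e : (scale s b).1 = s ^ (n + 1) * b.1 := rfl
    rw [e] at this
    linear_combination this
  have hzder : ∀ i, HasDerivAt (z i) (0, 0, 0, x i) 0 := fun i => hasDerivAt_phase_path b (x i)
  have hz00 : ∀ i, z i 0 = 0 := fun i => by simp [hz, scale_zero_left]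
  have hz0 : ∀ i, Filter.Tendsto (z i) (𝓝[>] 0) (𝓝 0) := fun i => by
    have := (hzder i).continuousAt.tendsto.mono_left (nhdsWithin_le_nhds (s := Set.Ioi 0))
    rwa [hz00 i] at this
  set Q : Fin n → ℝ → ℝ := fun i s => (G (z i s)).2.2.2 with hQ
  have hQlim : ∀ i, Filter.Tendsto (fun s => s⁻¹ * Q i s) (𝓝[>] 0) (𝓝 (a * x i)) := by
    intro i
    have h1 := (((continuous_snd.comp continuous_snd).comp continuous_snd).tendsto
      (fderiv ℝ G 0 (0, 0, 0, x i))).comp (h.tendsto_phase (hzder i) (hz00 i))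
    have h2 : fderiv ℝ G 0 (0, 0, 0, x i) = x i • fderiv ℝ G 0 (0, 0, 0, 1) := by
      rw [← map_smul]; simp
    rw [h2] at h1
    simpa [ha, axisFactor, mul_comm] using! h1
  have hcrit : ∀ i, ∀ᶠ s in 𝓝[>] (0 : ℝ), (G (z i s)).2.2.1 = 0 ∧
      (Polynomial.derivative (swPoly (g (c i s)))).eval (Q i s) = 0 ∧
      (swPoly (g (c i s))).eval (Q i s) = 0 := by
    intro i
    filter_upwards [(hz0 i).eventually h.comm, (hz0 i).eventually (h.eventually_isCrit hη),
      self_mem_nhdsWithin] with s hs1 hs2 hs0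
    have hs0' : s ≠ 0 := ne_of_gt hs0
    rw [hFz] at hs1
    have hcr : IsCrit η (z i s) := by
      refine ⟨rfl, ?_⟩
      rw [hFz, derivative_swPoly_congr (b := c i s) (c := scale s b) rfl]
      rw [show (z i s).2.2.2 = s * x i from rfl, eval_derivative_swPoly_scale hs0', hx, mul_zero]
    obtain ⟨h1, h2⟩ := hs2 hcr
    have h3 := canonicalMomentum_add_swPoly η (G (z i s))
    rw [h1] at h3
    rw [hs1] at h2 h3
    exact ⟨h1, h2, by simpa using h3⟩
  -- comparison of the images of `c i s` and `scale s b`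
  have hsc0 : Filter.Tendsto (fun s => scale s b) (𝓝[>] 0) (𝓝 0) := by
    have : Continuous fun s => scale s b := continuous_scale.comp (continuous_id.prodMk continuous_const)
    exact (this.tendsto' 0 0 (scale_zero_left b)).mono_left nhdsWithin_le_nhds
  have hc0 : ∀ i, Filter.Tendsto (c i) (𝓝[>] 0) (𝓝 0) := fun i =>
    ((tendsto_canonicalMomentum_zero n η).comp (hz0 i)).congr fun s => hFz i s
  have hsub : ∀ i, Filter.Tendsto (fun s => (s ^ (n + 1))⁻¹ • (g (c i s) - g (scale s b))) (𝓝[>] 0)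
      (𝓝 (fderiv ℝ g 0 (v i - b.1, 0))) := fun i =>
    h.tendsto_base_sub (hc0 i) hsc0 fun s => by
      refine Prod.ext ?_ ?_
      · simp only [hc, scale, Prod.fst_sub, Prod.smul_fst, smul_eq_mul]; ring
      · simp [hc]
  -- `c i s` and `scale s b` differ by `O(s ^ (n + 1))`, which is negligible against the weights `n
  -- - j` of the components of `λ`.
  have hδ : ∀ i (j : Fin (n - 1)), Filter.Tendsto
      (fun s => (s ^ (n - (j : ℕ)))⁻¹ * ((g (c i s)).2 j - (g (scale s b)).2 j)) (𝓝[>] 0) (𝓝 0) :=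
    fun i j => tendsto_inv_pow_mul_pow (m := n + 1) (by omega)
      ((((continuous_apply j).comp continuous_snd).tendsto _).comp (hsub i))
  -- the components `λ`
  set w : ℝ → Fin (n - 1) → ℝ := fun s j =>
    (((j : ℕ) : ℝ) + 1) * ((s ^ (n - (j : ℕ)))⁻¹ * (g (scale s b)).2 j) with hw
  set w₀ : Fin (n - 1) → ℝ := fun j => (((j : ℕ) : ℝ) + 1) * (a ^ (n - (j : ℕ)) * b.2 j) with hw₀
  -- There are `n` critical points for `n - 1` unknowns; the lowest `n - 1` give a square
  -- Vandermonde system, invertible since the `x i` are distinct and `a ≠ 0`.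
  let ι : Fin (n - 1) → Fin n := Fin.castLE (Nat.sub_le n 1)
  have hwlim : Filter.Tendsto w (𝓝[>] 0) (𝓝 w₀) := by
    refine tendsto_of_mulVec_tendsto
      (A := fun s => Matrix.vandermonde fun i => s⁻¹ * Q (ι i) s)
      (A₀ := Matrix.vandermonde fun i => a * x (ι i)) ?_ ?_ ?_
    · refine tendsto_pi_nhds.2 fun i => tendsto_pi_nhds.2 fun j => ?_
      exact (hQlim (ι i)).pow _
    · rw [Matrix.det_vandermonde_ne_zero_iff]
      intro i i' hii
      have hxinj : StrictMono x := by
        intro i i' hii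
        refine (hxmem i).2.trans_le (le_trans (hq.1.monotone ?_) (hxmem i').1.le)
        rw [Fin.le_def, Fin.val_succ, Fin.val_castSucc]
        exact hii
      exact Fin.castLE_injective _ (hxinj.injective (mul_left_cancel₀ ha0 hii))
    · refine tendsto_pi_nhds.2 fun i => ?_
      have hlim : (Matrix.vandermonde fun i => a * x (ι i)).mulVec w₀ i =
          -((n + 1) * (a * x (ι i)) ^ n) - ∑ j : Fin (n - 1),
            (((j : ℕ) : ℝ) + 1) * 0 * (a * x (ι i)) ^ (j : ℕ) := by
        have h1 := eval_derivative_swPoly_scale ha0 b (x (ι i))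
        rw [hx, mul_zero, eval_derivative_swPoly] at h1
        simp only [Matrix.mulVec, dotProduct, Matrix.vandermonde_apply, hw₀, mul_zero, zero_mul,
          Finset.sum_const_zero, sub_zero]
        rw [eq_neg_iff_add_eq_zero, add_comm, ← h1]
        congr 1
        exact Finset.sum_congr rfl fun j _ => by simp only [scale]; ring
      rw [hlim]
      -- This is the vanishing of the derivative at `Q (ι i) s`, divided by `s ^ n`, with the
      -- coefficients of `g (c (ι i) s)` traded for those of `g (scale s b)` at the cost of the
      -- negligible terms of `hδ`.
      have hr : Filter.Tendsto (fun s => -((n + 1) * (s⁻¹ * Q (ι i) s) ^ n) -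
          ∑ j : Fin (n - 1), (((j : ℕ) : ℝ) + 1) *
            ((s ^ (n - (j : ℕ)))⁻¹ * ((g (c (ι i) s)).2 j - (g (scale s b)).2 j)) *
              (s⁻¹ * Q (ι i) s) ^ (j : ℕ)) (𝓝[>] 0)
          (𝓝 (-((n + 1) * (a * x (ι i)) ^ n) - ∑ j : Fin (n - 1),
            (((j : ℕ) : ℝ) + 1) * 0 * (a * x (ι i)) ^ (j : ℕ))) :=
        ((((hQlim (ι i)).pow n).const_mul _).neg).sub (tendsto_finsetSum _ fun j _ =>
          ((hδ (ι i) j).const_mul _).mul ((hQlim (ι i)).pow _))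
      refine hr.congr' ?_
      filter_upwards [hcrit (ι i), self_mem_nhdsWithin] with s hs hs0
      have hs0' : s ≠ 0 := ne_of_gt hs0
      have h1 := hs.2.1
      rw [eval_derivative_swPoly] at h1
      simp only [Matrix.mulVec, dotProduct, Matrix.vandermonde_apply, hw]
      rw [sub_eq_iff_eq_add, neg_eq_iff_add_eq_zero, ← Finset.sum_add_distrib]
      have h2 : ∀ j : Fin (n - 1), (s⁻¹ * Q (ι i) s) ^ (j : ℕ) *
          ((((j : ℕ) : ℝ) + 1) * ((s ^ (n - (j : ℕ)))⁻¹ * (g (scale s b)).2 j)) +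
          (((j : ℕ) : ℝ) + 1) *
            ((s ^ (n - (j : ℕ)))⁻¹ * ((g (c (ι i) s)).2 j - (g (scale s b)).2 j)) *
              (s⁻¹ * Q (ι i) s) ^ (j : ℕ) =
          (s ^ n)⁻¹ * ((((j : ℕ) : ℝ) + 1) * (g (c (ι i) s)).2 j * Q (ι i) s ^ (j : ℕ)) := by
        intro j
        rw [show s ^ n = s ^ (n - (j : ℕ)) * s ^ (j : ℕ) by rw [← pow_add]; congr 1; omega]
        simp only [mul_pow, inv_pow]
        field_simp
        ring
      rw [Finset.sum_congr rfl fun j _ => h2 j, ← Finset.mul_sum, mul_pow, inv_pow]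
      rw [show ((n : ℝ) + 1) * ((s ^ n)⁻¹ * Q (ι i) s ^ n) =
        (s ^ n)⁻¹ * ((n + 1) * Q (ι i) s ^ n) by ring, ← mul_add, h1, mul_zero]
  have hGj : ∀ j : Fin (n - 1), Filter.Tendsto
      (fun s => (s ^ (n - (j : ℕ)))⁻¹ * (g (scale s b)).2 j) (𝓝[>] 0)
      (𝓝 (a ^ (n - (j : ℕ)) * b.2 j)) := by
    intro j
    have h0 : (((j : ℕ) : ℝ) + 1) ≠ 0 := by positivity
    have h1 := ((tendsto_pi_nhds.1 hwlim) j).const_mul ((((j : ℕ) : ℝ) + 1)⁻¹)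
    simpa only [hw, hw₀, inv_mul_cancel_left₀ h0] using h1
  -- the component `h`
  have hGc : ∀ i, Filter.Tendsto (fun s => (s ^ (n + 1))⁻¹ * (g (c i s)).1) (𝓝[>] 0)
      (𝓝 (a ^ (n + 1) * v i)) := by
    intro i
    have hcj : ∀ j : Fin (n - 1), Filter.Tendsto
        (fun s => (s ^ (n - (j : ℕ)))⁻¹ * (g (c i s)).2 j) (𝓝[>] 0)
        (𝓝 (a ^ (n - (j : ℕ)) * b.2 j)) := by
      intro j
      have := (hGj j).add (hδ i j)
      rw [add_zero] at this
      exact this.congr fun s => by ring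
    have hlim : a ^ (n + 1) * v i = (a * x i) ^ (n + 1) +
        ∑ j : Fin (n - 1), a ^ (n - (j : ℕ)) * b.2 j * (a * x i) ^ ((j : ℕ) + 1) := by
      have := eval_swPoly_scale a b (x i)
      rw [eval_swPoly (scale a b)] at this
      have e : (scale a b).1 = a ^ (n + 1) * b.1 := rfl
      rw [e] at this
      simp only [hv, scale] at this ⊢
      linear_combination -this
    rw [hlim]
    have hr := ((hQlim i).pow (n + 1)).add (tendsto_finsetSum (Finset.univ : Finset (Fin (n - 1)))
      fun j _ => (hcj j).mul ((hQlim i).pow ((j : ℕ) + 1)))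
    refine hr.congr' ?_
    filter_upwards [hcrit i, self_mem_nhdsWithin] with s hs hs0
    have hs0' : s ≠ 0 := ne_of_gt hs0
    have h1 := hs.2.2
    rw [eval_swPoly, sub_eq_zero] at h1
    rw [← h1, mul_add, Finset.mul_sum]
    congr 1
    · rw [mul_pow, inv_pow]
    · refine Finset.sum_congr rfl fun j _ => ?_
      rw [show s ^ (n + 1) = s ^ (n - (j : ℕ)) * s ^ ((j : ℕ) + 1) by
        rw [← pow_add]; congr 1; omega]
      simp only [mul_pow, inv_pow]
      field_simp
  set κ := (fderiv ℝ g 0 (1, 0)).1 with hκ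
  have hsub1 : ∀ i, Filter.Tendsto (fun s => (s ^ (n + 1))⁻¹ * ((g (c i s)).1 - (g (scale s b)).1))
      (𝓝[>] 0) (𝓝 (κ * (v i - b.1))) := by
    intro i
    have h1 := (continuous_fst.tendsto _).comp (hsub i)
    have h2 : ((v i - b.1, 0) : Base n) = (v i - b.1) • (1, 0) := by simp
    rw [h2, map_smul] at h1
    simpa [hκ, mul_comm] using! h1
  have hG1 : ∀ i, Filter.Tendsto (fun s => (s ^ (n + 1))⁻¹ * (g (scale s b)).1)
      (𝓝[>] 0) (𝓝 (a ^ (n + 1) * v i - κ * (v i - b.1))) := fun i =>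
    ((hGc i).sub (hsub1 i)).congr fun s => by ring
  -- The limit in `hG1` does not depend on `i`. The critical values of two adjacent gaps lie on
  -- opposite sides of `b.1`, hence differ, and this forces the value of `κ`. Two gaps exist because
  -- `n ≥ 2`.
  have hκa : κ = a ^ (n + 1) := by
    let i₀ : Fin n := ⟨0, by omega⟩
    let i₁ : Fin n := ⟨1, by omega⟩
    have huniq := tendsto_nhds_unique (hG1 i₀) (hG1 i₁)
    obtain ⟨c₀, hc₀, e₀⟩ := hq.eval_of_mem_Ioo (hxmem i₀)
    obtain ⟨c₁, hc₁, e₁⟩ := hq.eval_of_mem_Ioo (hxmem i₁)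
    have hne : v i₀ - v i₁ ≠ 0 := by
      simp only [hv, e₀, e₁, i₀, i₁]
      rw [show n - 0 = (n - 1) + 1 by omega, pow_succ]
      have : b.1 + (-1) ^ (n - 1) * -1 * c₀ - (b.1 + (-1) ^ (n - 1) * c₁) =
        (-1) ^ (n - 1) * -(c₀ + c₁) := by ring
      rw [this]
      exact mul_ne_zero (pow_ne_zero _ (by norm_num)) (by linarith [add_pos hc₀ hc₁])
    have : (a ^ (n + 1) - κ) * (v i₀ - v i₁) = 0 := by linear_combination huniq
    rcases mul_eq_zero.1 this with h' | h'
    · linarith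
    · exact absurd h' hne
  refine Filter.Tendsto.prodMk_nhds ?_ (tendsto_pi_nhds.2 fun j => ?_)
  · have := hG1 ⟨0, by omega⟩
    rw [hκa] at this
    convert! this using 2
    · simp only [inv_pow]
    · ring
  · refine (hGj j).congr fun s => ?_
    simp only [inv_pow]

/-- The path `r ↦ g (scale r b)` is in the domain for small `r` by `tendsto_scale`. It never meets
the multiple-root locus, since the inverse transition would carry a multiple root back to `scale r
b`. -/
lemma IsTransition.eventually_mapsTo (h : IsTransition n η G G' g g') (hn : 2 ≤ n) (hη : η ≠ 0) :
    ∀ᶠ b in 𝓝 0, b ∈ standardSwallowtail n → g b ∈ standardSwallowtail n := by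
  obtain ⟨δ, hδ, hδ'⟩ := Metric.eventually_nhds_iff_ball.1
    ((h.base_tendsto.eventually (h.symm.eventually_hasMultipleRoot hη)).and
      (h.base_left_inv.and h.base_analytic.eventually_analyticAt))
  filter_upwards [Metric.ball_mem_nhds (0 : Base n) hδ] with b hb hbD
  have hmem : ∀ r ∈ Set.Ioc (0 : ℝ) 1, scale r b ∈ Metric.ball (0 : Base n) δ := by
    intro r hr
    rw [mem_ball_zero_iff] at hb ⊢
    exact (norm_scale_le (by rw [abs_of_pos hr.1]; exact hr.2) b).trans_lt hb
  have hcs : Continuous fun r : ℝ => scale r b :=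
    continuous_scale.comp (continuous_id.prodMk continuous_const)
  have := mem_standardSwallowtail_of_path (c := fun r => g (scale r b)) (fun r hr => ?_)
    (fun r hr hm => ?_) ?_ 1 (by simp)
  · simpa using this
  · exact (ContinuousAt.comp (f := fun r => scale r b) (hδ' _ (hmem r hr)).2.2.continuousAt
      hcs.continuousAt).continuousWithinAt
  · obtain ⟨h1, h2, -⟩ := hδ' _ (hmem r hr)
    have := h1 hm
    rw [h2] at this
    exact not_hasMultipleRoot (scale_mem_standardSwallowtail hr.1.ne' hbD) this
  · have h1 := (h.tendsto_scale hn hη hbD).eventually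
      ((isOpen_standardSwallowtail n).mem_nhds
        (scale_mem_standardSwallowtail (h.axisFactor_ne_zero hn hη) hbD))
    filter_upwards [h1, self_mem_nhdsWithin] with s hs hs0
    have hs0' : s ≠ 0 := ne_of_gt hs0
    have := scale_mem_standardSwallowtail hs0' hs
    rwa [scale_scale, mul_inv_cancel₀ hs0', scale_one] at this

end Limit

/-! ### Integrals over vanishing cycles -/

/-- The point of the contraction of the `k`-th vanishing cycle to the `q`-axis. -/
def cyclePoint {n : ℕ} (η : ℝ) (b : Base n) (k : Fin n) (σ t : ℝ) : Reduced ℂ n :=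
  (fun j => (b.2 j : ℂ), σ * (unitFactor η k * (cycleP (rootTuple b) k t : ℂ)),
    (cycleQ (rootTuple b) k t : ℂ))

/-- The integral of a 1-form over the `k`-th vanishing cycle. -/
def cycleIntegral {n : ℕ} (η : ℝ) (A : Reduced ℂ n → Reduced ℂ n →L[ℂ] ℂ) (b : Base n) (k : Fin n) :
    ℂ :=
  ∫ t in (0 : ℝ)..(2 * Real.pi),
    A (fun j => (b.2 j : ℂ), vanishingCycle η (rootTuple b) k t)
      (0, deriv (vanishingCycle η (rootTuple b) k) t)

section

variable {n : ℕ} {η : ℝ}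

/-- The vanishing cycles and their contractions to the `q`-axis shrink to the origin with `b`, so
whatever holds near the complex origin holds along them. -/
lemma eventually_cyclePoint {p : Reduced ℂ n → Prop} (hp : ∀ᶠ z in 𝓝 0, p z) :
    ∀ᶠ b in 𝓝 (0 : Base n), b ∈ standardSwallowtail n →
      ∀ k, ∀ σ ∈ Set.Icc (0 : ℝ) 1, ∀ t, p (cyclePoint η b k σ t) := by
  obtain ⟨δ, hδ, hδp⟩ := Metric.eventually_nhds_iff_ball.1 hp
  have hε : 0 < min (δ / 2) (1 / 2) := by positivity
  filter_upwards [eventually_abs_root_lt n hε, Metric.ball_mem_nhds (0 : Base n) hδ]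
    with b hb hbδ hbD k σ hσ t
  have hq := rootTuple_spec hbD
  have hr : ∀ i, |rootTuple b i| < min (δ / 2) (1 / 2) := fun i =>
    hb _ ((hq.eval_eq_zero_iff _).2 ⟨i, rfl⟩)
  refine hδp _ ?_
  rw [mem_ball_zero_iff] at hbδ ⊢
  have h1 : min (δ / 2) (1 / 2) < δ := (min_le_left _ _).trans_lt (by linarith)
  have h2 : ‖(fun j => (b.2 j : ℂ))‖ ≤ ‖b‖ := by
    refine (pi_norm_le_iff_of_nonneg (norm_nonneg _)).2 fun j => ?_
    rw [Complex.norm_real]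
    exact (norm_le_pi_norm b.2 j).trans (norm_snd_le b)
  refine max_lt (h2.trans_lt hbδ) (max_lt ?_ ?_)
  · simp only [cyclePoint, norm_mul, Complex.norm_real, norm_unitFactor, one_mul]
    refine lt_of_le_of_lt ?_ h1
    refine (mul_le_of_le_one_left (norm_nonneg _) ?_).trans
      (abs_cycleP_le (min_le_right _ _) hq.1 hr k t)
    rw [Real.norm_eq_abs, abs_of_nonneg hσ.1]
    exact hσ.2
  · simp only [cyclePoint, Complex.norm_real]
    exact (abs_cycleQ_lt hq.1 hr k t).trans h1

lemma cycleIntegral_eq {b : Base n} (hb : b ∈ standardSwallowtail n) (k : Fin n)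
    (A : Reduced ℂ n → Reduced ℂ n →L[ℂ] ℂ) :
    cycleIntegral η A b k = ∫ t in (0 : ℝ)..(2 * Real.pi), A (cyclePoint η b k 1 t)
      (0, deriv (fun s => unitFactor η k * (cycleP (rootTuple b) k s : ℂ)) t,
        ((deriv (cycleQ (rootTuple b) k) t : ℝ) : ℂ)) := by
  refine intervalIntegral.integral_congr fun t _ => ?_
  simp only [vanishingCycle_deriv (rootTuple_spec hb).1]
  simp [cyclePoint, vanishingCycle]

lemma contDiff_unit_cycleP {b : Base n} (hb : b ∈ standardSwallowtail n) (k : Fin n) :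
    ContDiff ℝ 2 (fun s => unitFactor η k * (cycleP (rootTuple b) k s : ℂ)) :=
  contDiff_const.mul (Complex.ofRealCLM.contDiff.comp
    (contDiff_cycleP_right (rootTuple_spec hb).1 k))

lemma cycleIntegral_eq_area {b : Base n} (hb : b ∈ standardSwallowtail n) (k : Fin n)
    {A : Reduced ℂ n → Reduced ℂ n →L[ℂ] ℂ}
    (hA : ∀ σ ∈ Set.Icc (0 : ℝ) 1, ∀ t, AnalyticAt ℂ A (cyclePoint η b k σ t)) :
    cycleIntegral η A b k = ∫ σ in (0 : ℝ)..1, ∫ t in (0 : ℝ)..(2 * Real.pi),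
      curlPQ A (cyclePoint η b k σ t) * (unitFactor η k *
        ((cycleP (rootTuple b) k t * deriv (cycleQ (rootTuple b) k) t : ℝ) : ℂ)) := by
  rw [cycleIntegral_eq hb]
  have := loop_integral_eq (lam := fun j => (b.2 j : ℂ)) (A := A)
    (contDiff_unit_cycleP (η := η) hb k) (contDiff_cycleQ_right (rootTuple b) k)
    (fun t => by rw [cycleP_periodic]) (cycleQ_periodic _ k) hA
  simp only [cyclePoint, Complex.ofReal_one, one_mul]
  rw [this]
  refine intervalIntegral.integral_congr fun σ _ => intervalIntegral.integral_congr fun t _ => ?_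
  push_cast
  ring

/-- The factor is `r ^ (n + 1)` from `p` times `r ^ 2` from `dq`. -/
lemma cyclePoint_scale {b : Base n} (hb : b ∈ standardSwallowtail n) {r : ℝ} (hr : 0 < r)
    (k : Fin n) (t : ℝ) :
    cycleP (rootTuple (scale (r ^ 2) b)) k t * deriv (cycleQ (rootTuple (scale (r ^ 2) b)) k) t =
      r ^ (n + 3) * (cycleP (rootTuple b) k t * deriv (cycleQ (rootTuple b) k) t) := by
  rw [rootTuple_scale (by positivity) hb, cycleP_smul hr.le, deriv_cycleQ, deriv_cycleQ]
  ring

lemma continuous_cycle_prod {b : Base n} (hb : b ∈ standardSwallowtail n) (k : Fin n) (t : ℝ) :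
    ContinuousAt (fun c => cycleP (rootTuple c) k t * deriv (cycleQ (rootTuple c) k) t) b := by
  have h1 := (rootTuple_contDiffAt hb).2.continuousAt
  have h2 : ContinuousAt (fun c => cycleP (rootTuple c) k t) b :=
    ContinuousAt.comp (g := fun u : (Fin (n + 1) → ℝ) × ℝ => cycleP u.1 k u.2)
      (f := fun c => (rootTuple c, t))
      (contDiffAt_cycleP (rootTuple_spec hb).1 k t).continuousAt (h1.prodMk continuousAt_const)
  have h3 : ∀ i, ContinuousAt (fun c => rootTuple c i) b := fun i =>
    (continuous_apply i).continuousAt.comp h1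
  simp only [deriv_cycleQ]
  exact h2.mul ((((h3 _).sub (h3 _)).div_const _).mul continuousAt_const)

/-- The rescaled integral of a 1-form over a shrinking family of vanishing cycles. -/
lemma tendsto_cycleIntegral {A : Reduced ℂ n → Reduced ℂ n →L[ℂ] ℂ} (hA : AnalyticAt ℂ A 0)
    {B : ℝ → Base n} {b₀ : Base n} (hb₀ : b₀ ∈ standardSwallowtail n)
    (hB : Filter.Tendsto B (𝓝[>] 0) (𝓝 0))
    (hlim : Filter.Tendsto (fun r => scale (r ^ 2)⁻¹ (B r)) (𝓝[>] 0) (𝓝 b₀)) (k : Fin n) :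
    Filter.Tendsto (fun r : ℝ => ((r : ℂ) ^ (n + 3))⁻¹ * cycleIntegral η A (B r) k) (𝓝[>] 0)
      (𝓝 (curlPQ A 0 * (unitFactor η k * (cycleArea (rootTuple b₀) k : ℂ)))) := by
  set w : Base n → ℝ → ℝ := fun c t =>
    cycleP (rootTuple c) k t * deriv (cycleQ (rootTuple c) k) t with hw
  set bs : ℝ → Base n := fun r => scale (r ^ 2)⁻¹ (B r) with hbs
  have hcurl : ContinuousAt (curlPQ A) 0 := by
    have := hA.fderiv.continuousAt
    exact ((this.clm_apply continuousAt_const).clm_apply continuousAt_const).sub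
      ((this.clm_apply continuousAt_const).clm_apply continuousAt_const)
  have hbsD : ∀ᶠ r in 𝓝[>] (0 : ℝ), bs r ∈ standardSwallowtail n :=
    hlim.eventually ((isOpen_standardSwallowtail n).mem_nhds hb₀)
  have hBbs : ∀ᶠ r in 𝓝[>] (0 : ℝ), B r = scale (r ^ 2) (bs r) := by
    filter_upwards [self_mem_nhdsWithin] with r hr
    have : r ^ 2 ≠ 0 := pow_ne_zero _ (ne_of_gt hr)
    rw [hbs, scale_scale, mul_inv_cancel₀ this, scale_one]
  -- a uniform bound for the integrands
  obtain ⟨R, hR⟩ : ∃ R : ℝ, ∀ᶠ r in 𝓝[>] (0 : ℝ), ∀ t, |w (bs r) t| ≤ R := by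
    have hev : ∀ᶠ c in 𝓝 b₀, ∀ i, |rootTuple c i| < ‖rootTuple b₀‖ + 1 := by
      have hc := (rootTuple_contDiffAt hb₀).2.continuousAt.norm
      filter_upwards [hc.eventually_lt_const (lt_add_one ‖rootTuple b₀‖)] with c hc i
      exact (norm_le_pi_norm (rootTuple c) i).trans_lt hc
    set M := ‖rootTuple b₀‖ + 1
    have hM : 0 ≤ M := by positivity
    refine ⟨M ^ 2 * √(∏ i ∈ Finset.univ \ {k.castSucc, k.succ}, (2 * M)), ?_⟩
    filter_upwards [hbsD, hlim.eventually hev] with r hr hr' t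
    have hq := rootTuple_spec hr
    simp only [hw]
    rw [cycleP_mul_deriv, abs_mul, abs_of_nonneg (sq_nonneg _), abs_of_nonneg (Real.sqrt_nonneg _)]
    have h1 := abs_lt.1 (hr' k.castSucc)
    have h2 := abs_lt.1 (hr' k.succ)
    have h3 : |(rootTuple (bs r) k.succ - rootTuple (bs r) k.castSucc) / 2 * Real.sin t| ≤ M := by
      rw [abs_mul, ← mul_one M]
      refine mul_le_mul ?_ (Real.abs_sin_le_one t) (abs_nonneg _) hM
      rw [abs_le]; constructor <;> linarith
    refine mul_le_mul ?_ (Real.sqrt_le_sqrt (Finset.prod_le_prod (fun _ _ => abs_nonneg _)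
      fun i _ => ?_)) (Real.sqrt_nonneg _) (by positivity)
    · rw [← sq_abs]
      exact pow_le_pow_left₀ (abs_nonneg _) h3 2
    · have h1 := abs_cycleQ_lt hq.1 hr' k t
      have h2 := hr' i
      have := abs_sub (cycleQ (rootTuple (bs r)) k t) (rootTuple (bs r) i)
      linarith
  have hR0 : 0 ≤ R := by
    obtain ⟨r, hr⟩ := hR.exists
    exact (abs_nonneg _).trans (hr 0)
  -- the rescaled integral is close to the integral with constant density
  have hformula : ∀ᶠ r : ℝ in 𝓝[>] (0 : ℝ), ((r : ℂ) ^ (n + 3))⁻¹ * cycleIntegral η A (B r) k =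
      ∫ σ in (0 : ℝ)..1, ∫ t in (0 : ℝ)..(2 * Real.pi),
        curlPQ A (cyclePoint η (B r) k σ t) * (unitFactor η k * (w (bs r) t : ℂ)) := by
    filter_upwards [hbsD, hBbs, hB.eventually (eventually_cyclePoint (η := η) hA.eventually_analyticAt),
      self_mem_nhdsWithin] with r h1 h2 h3 h4
    have hr : (0 : ℝ) < r := h4
    have hBD : B r ∈ standardSwallowtail n := by
      rw [h2]; exact scale_mem_standardSwallowtail (by positivity) h1
    rw [cycleIntegral_eq_area hBD k (h3 hBD k), ← intervalIntegral.integral_const_mul]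
    refine intervalIntegral.integral_congr fun σ _ => ?_
    simp only [← intervalIntegral.integral_const_mul]
    refine intervalIntegral.integral_congr fun t _ => ?_
    have : cycleP (rootTuple (B r)) k t * deriv (cycleQ (rootTuple (B r)) k) t =
        r ^ (n + 3) * w (bs r) t := by
      rw [h2, cyclePoint_scale h1 hr]
    rw [this]
    have hrc : (r : ℂ) ≠ 0 := by exact_mod_cast hr.ne'
    push_cast
    field_simp
  -- With the density frozen at the origin, dominated convergence applies: the rescaled cycles
  -- converge to those of `b₀`.
  have hinner : Filter.Tendsto (fun r => ∫ t in (0 : ℝ)..(2 * Real.pi),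
      curlPQ A 0 * (unitFactor η k * (w (bs r) t : ℂ))) (𝓝[>] 0)
      (𝓝 (curlPQ A 0 * (unitFactor η k * (cycleArea (rootTuple b₀) k : ℂ)))) := by
    have hval : curlPQ A 0 * (unitFactor η k * (cycleArea (rootTuple b₀) k : ℂ)) =
        ∫ t in (0 : ℝ)..(2 * Real.pi), curlPQ A 0 * (unitFactor η k * (w b₀ t : ℂ)) := by
      rw [intervalIntegral.integral_const_mul, intervalIntegral.integral_const_mul,
        intervalIntegral.integral_ofReal]
      rfl
    rw [hval]
    refine intervalIntegral.tendsto_integral_filter_of_dominated_convergence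
      (fun _ => ‖curlPQ A 0‖ * R) ?_ ?_ intervalIntegrable_const ?_
    · filter_upwards [hbsD] with r hr
      have := continuous_cycleP_mul_deriv (rootTuple_spec hr).1 k
      have h2 : Continuous fun t => curlPQ A 0 * (unitFactor η k * (w (bs r) t : ℂ)) :=
        continuous_const.mul (continuous_const.mul (Complex.continuous_ofReal.comp this))
      exact h2.aestronglyMeasurable
    · filter_upwards [hR] with r hr
      refine Filter.Eventually.of_forall fun t _ => ?_
      rw [norm_mul, norm_mul, norm_unitFactor, one_mul, Complex.norm_real]
      exact mul_le_mul_of_nonneg_left (hr t) (norm_nonneg _)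
    · refine Filter.Eventually.of_forall fun t _ => ?_
      have h1 : Filter.Tendsto (fun r => w (bs r) t) (𝓝[>] 0) (𝓝 (w b₀ t)) :=
        (continuous_cycle_prod hb₀ k t).tendsto.comp hlim
      exact ((((Complex.continuous_ofReal.tendsto _).comp h1).const_mul _).const_mul _)
  have hdiff : Filter.Tendsto (fun r : ℝ => ((r : ℂ) ^ (n + 3))⁻¹ * cycleIntegral η A (B r) k -
      ∫ t in (0 : ℝ)..(2 * Real.pi), curlPQ A 0 * (unitFactor η k * (w (bs r) t : ℂ)))
      (𝓝[>] 0) (𝓝 0) := by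
    rw [Metric.tendsto_nhds]
    intro ε hε
    -- A density error of this size, integrated against a weight bounded by `R` over an interval of
    -- length `2π`, stays below `ε`; the `+ 1` covers `R = 0`.
    have hε' : 0 < ε / (2 * (R * (2 * Real.pi) + 1)) := by positivity
    have hnear : ∀ᶠ z in 𝓝 (0 : Reduced ℂ n),
        AnalyticAt ℂ A z ∧ ‖curlPQ A z - curlPQ A 0‖ < ε / (2 * (R * (2 * Real.pi) + 1)) := by
      refine hA.eventually_analyticAt.and ?_
      have := (hcurl.sub (continuousAt_const (y := curlPQ A 0))).norm
      exact this.eventually_lt_const (by simpa using hε')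
    filter_upwards [hformula, hbsD, hBbs, hR, hB.eventually (eventually_cyclePoint (η := η) hnear),
      self_mem_nhdsWithin] with r h1 h2 h3 h4 h5 h6
    have hr : (0 : ℝ) < r := h6
    have hBD : B r ∈ standardSwallowtail n := by
      rw [h3]; exact scale_mem_standardSwallowtail (by positivity) h2
    have h5' := h5 hBD k
    rw [dist_zero_right, h1]
    have hwc : Continuous (w (bs r)) := continuous_cycleP_mul_deriv (rootTuple_spec h2).1 k
    -- Clamping `σ` to `[0, 1]` makes the integrand continuous on the whole plane, as the theorem on
    -- parametric integrals requires.
    have hproj : ∀ σ : ℝ, max 0 (min σ 1) ∈ Set.Icc (0 : ℝ) 1 := fun σ =>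
      ⟨le_max_left _ _, max_le zero_le_one (min_le_right _ _)⟩
    have hproj' : ∀ σ ∈ Set.Icc (0 : ℝ) 1, max 0 (min σ 1) = σ := fun σ hσ => by
      rw [min_eq_left hσ.2, max_eq_right hσ.1]
    have hjoint : Continuous fun u : ℝ × ℝ =>
        curlPQ A (cyclePoint η (B r) k (max 0 (min u.1 1)) u.2) := by
      have hc : Continuous fun u : ℝ × ℝ => cyclePoint η (B r) k (max 0 (min u.1 1)) u.2 := by
        refine continuous_const.prodMk (Continuous.prodMk ?_ ?_)
        · exact (Complex.continuous_ofReal.comp (by fun_prop)).mul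
            ((contDiff_unit_cycleP hBD k).continuous.comp continuous_snd)
        · exact Complex.continuous_ofReal.comp
            ((contDiff_cycleQ_right _ k).continuous.comp continuous_snd)
      refine continuous_iff_continuousAt.2 fun u => ?_
      have hd := (h5' _ (hproj u.1) u.2).1.fderiv.continuousAt
      have : ContinuousAt (curlPQ A) (cyclePoint η (B r) k (max 0 (min u.1 1)) u.2) :=
        ((hd.clm_apply continuousAt_const).clm_apply continuousAt_const).sub
          ((hd.clm_apply continuousAt_const).clm_apply continuousAt_const)
      exact ContinuousAt.comp
        (f := fun u : ℝ × ℝ => cyclePoint η (B r) k (max 0 (min u.1 1)) u.2) this hc.continuousAt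
    have hsub : ∀ σ ∈ Set.Icc (0 : ℝ) 1,
        Continuous fun t => curlPQ A (cyclePoint η (B r) k σ t) := by
      intro σ hσ
      have := hjoint.comp (f := fun t : ℝ => (σ, t)) (by fun_prop)
      simpa [Function.comp_def, hproj' σ hσ] using this
    have hinn : ∀ σ ∈ Set.Icc (0 : ℝ) 1, ‖(∫ t in (0 : ℝ)..(2 * Real.pi),
        curlPQ A (cyclePoint η (B r) k σ t) * (unitFactor η k * (w (bs r) t : ℂ))) -
        ∫ t in (0 : ℝ)..(2 * Real.pi), curlPQ A 0 * (unitFactor η k * (w (bs r) t : ℂ))‖ ≤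
        ε / (2 * (R * (2 * Real.pi) + 1)) * R * |2 * Real.pi - 0| := by
      intro σ hσ
      have hwc' : Continuous fun t => unitFactor η k * (w (bs r) t : ℂ) :=
        continuous_const.mul (Complex.continuous_ofReal.comp hwc)
      have hi1 : Continuous fun t => curlPQ A (cyclePoint η (B r) k σ t) *
          (unitFactor η k * (w (bs r) t : ℂ)) := (hsub σ hσ).mul hwc'
      have hi2 : Continuous fun t => curlPQ A 0 * (unitFactor η k * (w (bs r) t : ℂ)) :=
        continuous_const.mul hwc'
      rw [← intervalIntegral.integral_sub (hi1.intervalIntegrable _ _)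
        (hi2.intervalIntegrable _ _)]
      refine intervalIntegral.norm_integral_le_of_norm_le_const fun t _ => ?_
      rw [← sub_mul, norm_mul, norm_mul, norm_unitFactor, one_mul, Complex.norm_real]
      exact mul_le_mul (h5' σ hσ t).2.le (h4 t) (norm_nonneg _) hε'.le
    have hconst : (∫ t in (0 : ℝ)..(2 * Real.pi), curlPQ A 0 * (unitFactor η k * (w (bs r) t : ℂ))) =
        ∫ _σ in (0 : ℝ)..1, ∫ t in (0 : ℝ)..(2 * Real.pi),
          curlPQ A 0 * (unitFactor η k * (w (bs r) t : ℂ)) := by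
      simp
    have hI : IntervalIntegrable (fun σ => ∫ t in (0 : ℝ)..(2 * Real.pi),
        curlPQ A (cyclePoint η (B r) k σ t) * (unitFactor η k * (w (bs r) t : ℂ)))
        MeasureTheory.volume 0 1 := by
      have hc := intervalIntegral.continuous_parametric_intervalIntegral_of_continuous'
        (μ := MeasureTheory.volume) (f := fun σ t => curlPQ A
          (cyclePoint η (B r) k (max 0 (min σ 1)) t) * (unitFactor η k * (w (bs r) t : ℂ)))
        (hjoint.mul (continuous_const.mul (Complex.continuous_ofReal.comp
          (hwc.comp continuous_snd)))) 0 (2 * Real.pi)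
      refine (hc.intervalIntegrable 0 1).congr fun σ hσ => ?_
      rw [Set.uIoc_of_le zero_le_one] at hσ
      simp only [hproj' σ ⟨hσ.1.le, hσ.2⟩]
    rw [hconst, ← intervalIntegral.integral_sub hI intervalIntegrable_const]
    refine (intervalIntegral.norm_integral_le_of_norm_le_const (C :=
      ε / (2 * (R * (2 * Real.pi) + 1)) * R * |2 * Real.pi - 0|) fun σ hσ => ?_).trans_lt ?_
    · rw [Set.uIoc_of_le zero_le_one] at hσ
      exact hinn σ ⟨hσ.1.le, hσ.2⟩
    · rw [sub_zero, sub_zero, abs_one, mul_one, abs_of_pos (by positivity : 0 < 2 * Real.pi)]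
      have h7 : 0 < 2 * (R * (2 * Real.pi) + 1) := by positivity
      rw [div_mul_eq_mul_div, div_mul_eq_mul_div, div_lt_iff₀ h7]
      have h8 : 0 ≤ R * (2 * Real.pi) := by positivity
      nlinarith [mul_nonneg hε.le h8]
  have := hdiff.add hinner
  simpa using this

end

/-! ### Rescaled areas of loops on the standard curves -/

lemma aeval_swPoly_scale {n : ℕ} (a : ℝ) (b : Base n) (x : ℂ) :
    Polynomial.aeval (a * x) (swPoly (scale a b)) =
      (a : ℂ) ^ (n + 1) * Polynomial.aeval x (swPoly b) := by
  rw [aeval_swPoly, aeval_swPoly, mul_sub, mul_add, Finset.mul_sum, mul_pow]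
  congr 2
  · refine Finset.sum_congr rfl fun j _ => ?_
    simp only [scale]
    rw [show n + 1 = (n - j) + ((j : ℕ) + 1) by omega, pow_add (a : ℂ) (n - j), mul_pow]
    push_cast
    ring
  · simp [scale]

lemma contDiffAt_cyclePoint {n : ℕ} {η : ℝ} {B : ℝ → Base n} {r : ℝ} (hB : ContDiffAt ℝ 2 B r)
    (hD : B r ∈ standardSwallowtail n) (k : Fin n) (t : ℝ) :
    ContDiffAt ℝ 2 (fun u : ℝ × ℝ => cyclePoint η (B u.1) k 1 u.2) (r, t) := by
  have hB' : ContDiffAt ℝ 2 (fun u : ℝ × ℝ => B u.1) (r, t) :=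
    ContDiffAt.comp (r, t) hB contDiffAt_fst
  have hR : ContDiffAt ℝ 2 (fun u : ℝ × ℝ => rootTuple (B u.1)) (r, t) :=
    ContDiffAt.comp (g := rootTuple) (f := fun u : ℝ × ℝ => B u.1) (r, t)
      (rootTuple_contDiffAt hD).2 hB'
  have hc := Complex.ofRealCLM.contDiff (n := 2)
  have hP : ContDiffAt ℝ 2 (fun u : ℝ × ℝ => cycleP (rootTuple (B u.1)) k u.2) (r, t) :=
    ContDiffAt.comp (g := fun u : (Fin (n + 1) → ℝ) × ℝ => cycleP u.1 k u.2)
      (f := fun u : ℝ × ℝ => (rootTuple (B u.1), u.2)) (r, t)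
      (contDiffAt_cycleP (rootTuple_spec hD).1 k t) (hR.prodMk contDiffAt_snd)
  have hQ : ContDiffAt ℝ 2 (fun u : ℝ × ℝ => cycleQ (rootTuple (B u.1)) k u.2) (r, t) :=
    ContDiffAt.comp (g := fun u : (Fin (n + 1) → ℝ) × ℝ => cycleQ u.1 k u.2)
      (f := fun u : ℝ × ℝ => (rootTuple (B u.1), u.2)) (r, t)
      (contDiff_cycleQ k).contDiffAt (hR.prodMk contDiffAt_snd)
  refine ContDiffAt.prodMk (contDiffAt_pi.2 fun j => ?_) (ContDiffAt.prodMk ?_ ?_)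
  · exact hc.contDiffAt.comp (r, t)
      (ContDiffAt.comp (r, t) (contDiff_apply ℝ ℝ j).contDiffAt hB'.snd)
  · exact contDiffAt_const.mul (contDiffAt_const.mul (hc.contDiffAt.comp (r, t) hP))
  · exact hc.contDiffAt.comp (r, t) hQ

lemma cyclePoint_periodic {n : ℕ} (η : ℝ) (b : Base n) (k : Fin n) (σ t : ℝ) :
    cyclePoint η b k σ (t + 2 * Real.pi) = cyclePoint η b k σ t := by
  simp only [cyclePoint, cycleP_periodic, cycleQ_periodic]

/-- Two vectors in the kernel of a nonzero linear form on the plane are collinear. -/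
lemma mul_sub_mul_eq_zero_of_ker {𝕜 : Type*} [Field 𝕜] {a b : 𝕜} (hab : a ≠ 0 ∨ b ≠ 0)
    {v w : 𝕜 × 𝕜} (hv : a * v.1 + b * v.2 = 0) (hw : a * w.1 + b * w.2 = 0) :
    v.1 * w.2 - w.1 * v.2 = 0 := by
  rcases hab with h | h
  · refine (mul_eq_zero.1 (?_ : a * _ = 0)).resolve_left h
    linear_combination w.2 * hv - v.2 * hw
  · refine (mul_eq_zero.1 (?_ : b * _ = 0)).resolve_left h
    linear_combination v.1 * hw - w.1 * hv

/-- The area enclosed by a family of loops on a fixed smooth curve is constant, after rescaling. -/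
lemma rescaled_area_eq {n : ℕ} {η : ℝ} (hη : η ≠ 0) {pC qC : Reduced ℂ n → ℂ} {β : Base n}
    (hβ : β ∈ standardSwallowtail n) {B : ℝ → Base n} {r₀ r₁ : ℝ} (hr₀ : 0 < r₀) (hr : r₀ ≤ r₁)
    (hB : ∀ r ∈ Set.Icc r₀ r₁, ContDiffAt ℝ 2 B r)
    (hD : ∀ r ∈ Set.Icc r₀ r₁, B r ∈ standardSwallowtail n) (k : Fin n)
    (hp : ∀ r ∈ Set.Icc r₀ r₁, ∀ t, AnalyticAt ℂ pC (cyclePoint η (B r) k 1 t))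
    (hq : ∀ r ∈ Set.Icc r₀ r₁, ∀ t, AnalyticAt ℂ qC (cyclePoint η (B r) k 1 t))
    (hcurve : ∀ r ∈ Set.Icc r₀ r₁, ∀ᶠ r' in 𝓝 r, ∀ t,
      (η : ℂ) * pC (cyclePoint η (B r') k 1 t) ^ 2 +
        Polynomial.aeval (qC (cyclePoint η (B r') k 1 t)) (swPoly (scale (r' ^ 2) β)) = 0) :
    ((r₁ : ℂ) ^ (n + 3))⁻¹ * (∫ t in (0 : ℝ)..(2 * Real.pi), pC (cyclePoint η (B r₁) k 1 t) *
        deriv (fun t : ℝ => qC (cyclePoint η (B r₁) k 1 t)) t) =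
      ((r₀ : ℂ) ^ (n + 3))⁻¹ * ∫ t in (0 : ℝ)..(2 * Real.pi), pC (cyclePoint η (B r₀) k 1 t) *
        deriv (fun t : ℝ => qC (cyclePoint η (B r₀) k 1 t)) t := by
  -- Undoing the scaling by `r ^ 2`, under which `p` has weight `n + 1` and `q` weight 2 in `r`,
  -- places all loops on the curve of `β`.
  set Λ : ℝ × ℝ → ℂ × ℂ := fun u =>
    (((u.1 : ℂ) ^ (n + 1))⁻¹ * pC (cyclePoint η (B u.1) k 1 u.2),
      ((u.1 : ℂ) ^ 2)⁻¹ * qC (cyclePoint η (B u.1) k 1 u.2)) with hΛdef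
  -- The 1-form `p dq`.
  set A : ℂ × ℂ →L[ℝ] ℂ × ℂ →L[ℝ] ℂ := (ContinuousLinearMap.mul ℝ ℂ).bilinearComp
    (ContinuousLinearMap.fst ℝ ℂ ℂ) (ContinuousLinearMap.snd ℝ ℂ ℂ) with hA
  have hAv : ∀ v w, A v w = v.1 * w.2 := fun v w => rfl
  have hIcc : Set.uIcc r₀ r₁ = Set.Icc r₀ r₁ := Set.uIcc_of_le hr
  have hpos : ∀ r ∈ Set.Icc r₀ r₁, (r : ℂ) ≠ 0 := fun r h => by
    exact_mod_cast (hr₀.trans_le h.1).ne'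
  have hcomp : ∀ {f : Reduced ℂ n → ℂ}, (∀ r ∈ Set.Icc r₀ r₁, ∀ t,
      AnalyticAt ℂ f (cyclePoint η (B r) k 1 t)) → ∀ r ∈ Set.Icc r₀ r₁, ∀ t,
      ContDiffAt ℝ 2 (fun u : ℝ × ℝ => f (cyclePoint η (B u.1) k 1 u.2)) (r, t) := by
    intro f hf r h t
    exact ContDiffAt.comp (r, t) (f := fun u : ℝ × ℝ => cyclePoint η (B u.1) k 1 u.2)
      ((hf r h t).contDiffAt.restrict_scalars ℝ)
      (contDiffAt_cyclePoint (hB r h) (hD r h) k t)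
  have hΛ : ∀ r ∈ Set.Icc r₀ r₁, ∀ t, ContDiffAt ℝ 2 Λ (r, t) := by
    intro r h t
    have hx : ContDiffAt ℝ 2 (fun u : ℝ × ℝ => (u.1 : ℂ)) (r, t) :=
      (Complex.ofRealCLM.contDiff.comp contDiff_fst).contDiffAt
    exact (((hx.pow _).inv (pow_ne_zero _ (hpos r h))).mul (hcomp hp r h t)).prodMk
      (((hx.pow _).inv (pow_ne_zero _ (hpos r h))).mul (hcomp hq r h t))
  set E : ℂ × ℂ → ℂ := fun x => (η : ℂ) * x.1 ^ 2 + Polynomial.aeval x.2 (swPoly β) with hE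
  have hEΛ : ∀ r ∈ Set.Icc r₀ r₁, ∀ t, ∀ᶠ u in 𝓝 (r, t), E (Λ u) = 0 := by
    intro r h t
    have hne : ∀ᶠ r' in 𝓝 r, r' ≠ 0 :=
      isOpen_ne.mem_nhds (hr₀.trans_le h.1).ne'
    have h1 := (continuous_fst.tendsto (r, t)).eventually ((hcurve r h).and hne)
    filter_upwards [h1] with u hu
    have hu0 : (u.1 : ℂ) ≠ 0 := by exact_mod_cast hu.2
    have h2 := hu.1 u.2
    have h3 := aeval_swPoly_scale (u.1 ^ 2) β (((u.1 : ℂ) ^ 2)⁻¹ *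
      qC (cyclePoint η (B u.1) k 1 u.2))
    push_cast at h3
    rw [mul_inv_cancel_left₀ (pow_ne_zero _ hu0)] at h3
    rw [h3] at h2
    have h4 : (u.1 ^ 2 : ℂ) ^ (n + 1) ≠ 0 := pow_ne_zero _ (pow_ne_zero _ hu0)
    refine (mul_eq_zero.1 (?_ : (u.1 ^ 2 : ℂ) ^ (n + 1) * _ = 0)).resolve_left h4
    simp only [hE, hΛdef]
    rw [mul_add]
    rw [← h2]
    congr 1
    rw [mul_pow, ← pow_mul, inv_pow, ← pow_mul, mul_comm 2 (n + 1)]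
    field_simp
  have hEd : ∀ x : ℂ × ℂ, HasFDerivAt E ((((2 * η * x.1 : ℂ)) • ContinuousLinearMap.fst ℝ ℂ ℂ) +
      (Polynomial.aeval x.2 (Polynomial.derivative (swPoly β))) •
        ContinuousLinearMap.snd ℝ ℂ ℂ) x := by
    intro x
    have h1 : HasFDerivAt (fun y : ℂ × ℂ => (η : ℂ) * y.1 ^ 2)
        ((2 * η * x.1 : ℂ) • ContinuousLinearMap.fst ℝ ℂ ℂ) x := by
      have := ((hasDerivAt_pow 2 x.1).const_mul (η : ℂ)).comp_hasFDerivAt_of_eq x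
        (hasFDerivAt_fst (𝕜 := ℂ) (E := ℂ) (F := ℂ) (p := x)) rfl
      refine (this.restrictScalars ℝ).congr_fderiv ?_
      refine ContinuousLinearMap.ext fun y => ?_
      change ((η : ℂ) * (((2 : ℕ) : ℂ) * x.1 ^ (2 - 1))) * y.1 = 2 * η * x.1 * y.1
      push_cast
      ring
    have h2 : HasFDerivAt (fun y : ℂ × ℂ => Polynomial.aeval y.2 (swPoly β))
        ((Polynomial.aeval x.2 (Polynomial.derivative (swPoly β))) •
          ContinuousLinearMap.snd ℝ ℂ ℂ) x := by
      have := ((swPoly β).hasDerivAt_aeval x.2).comp_hasFDerivAt_of_eq x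
        (hasFDerivAt_snd (𝕜 := ℂ) (E := ℂ) (F := ℂ) (p := x)) rfl
      refine (this.restrictScalars ℝ).congr_fderiv ?_
      ext y <;> simp
    exact h1.add h2
  have hker : ∀ r ∈ Set.Icc r₀ r₁, ∀ t, ∀ v : ℝ × ℝ,
      (2 * η * (Λ (r, t)).1) * (fderiv ℝ Λ (r, t) v).1 +
        Polynomial.aeval (Λ (r, t)).2 (Polynomial.derivative (swPoly β)) *
          (fderiv ℝ Λ (r, t) v).2 = 0 := by
    intro r h t v
    have h1 := (hEd (Λ (r, t))).comp (r, t)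
      ((hΛ r h t).differentiableAt (by norm_num)).hasFDerivAt
    have h2 := h1.unique ((hasFDerivAt_const (0 : ℂ) (r, t)).congr_of_eventuallyEq (hEΛ r h t))
    exact congrArg (fun T => T v) h2
  -- The curve is smooth because the polynomial of `β` is separable.
  have hsep : ∀ r ∈ Set.Icc r₀ r₁, ∀ t, (2 * η * (Λ (r, t)).1 : ℂ) ≠ 0 ∨
      Polynomial.aeval (Λ (r, t)).2 (Polynomial.derivative (swPoly β)) ≠ 0 := by
    intro r h t
    by_cases h0 : (Λ (r, t)).1 = 0
    · right
      have h1 := (hEΛ r h t).self_of_nhds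
      simp only [hE, h0, ne_eq, OfNat.ofNat_ne_zero, not_false_eq_true, zero_pow, mul_zero,
        zero_add] at h1
      exact (rootTuple_spec hβ).separable.aeval_derivative_ne_zero h1
    · left
      have : (η : ℂ) ≠ 0 := by exact_mod_cast hη
      exact mul_ne_zero (mul_ne_zero two_ne_zero this) h0
  have hgreen := green_loops (A := fun x => A x) (Λ := Λ) (s₀ := r₀) (s₁ := r₁)
    (by rw [hIcc]; exact hΛ) (fun _ _ _ => A.contDiff.contDiffAt)
    (fun r t => by simp only [hΛdef, cyclePoint_periodic])
  -- Both partial derivatives of `Λ` lie in the complex tangent line of the curve, so `dp ∧ dq`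
  -- vanishes on them.
  have hzero : (∫ σ in r₀..r₁, ∫ t in (0 : ℝ)..(2 * Real.pi),
      (fderiv ℝ (fun x => A x) (Λ (σ, t)) (fderiv ℝ Λ (σ, t) (1, 0)) (fderiv ℝ Λ (σ, t) (0, 1)) -
        fderiv ℝ (fun x => A x) (Λ (σ, t)) (fderiv ℝ Λ (σ, t) (0, 1))
          (fderiv ℝ Λ (σ, t) (1, 0)))) = 0 := by
    refine (intervalIntegral.integral_congr fun σ hσ => (?_ : _ = (0 : ℂ))).trans
      intervalIntegral.integral_zero
    rw [hIcc] at hσ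
    refine (intervalIntegral.integral_congr fun t _ => (?_ : _ = (0 : ℂ))).trans
      intervalIntegral.integral_zero
    simp only [ContinuousLinearMap.fderiv, hAv]
    exact mul_sub_mul_eq_zero_of_ker (hsep σ hσ t) (hker σ hσ t _) (hker σ hσ t _)
  rw [hzero] at hgreen
  have hval : ∀ r ∈ Set.Icc r₀ r₁, (∫ t in (0 : ℝ)..(2 * Real.pi),
      A (Λ (r, t)) (fderiv ℝ Λ (r, t) (0, 1))) =
      ((r : ℂ) ^ (n + 3))⁻¹ * (∫ t in (0 : ℝ)..(2 * Real.pi), pC (cyclePoint η (B r) k 1 t) *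
        deriv (fun t : ℝ => qC (cyclePoint η (B r) k 1 t)) t) := by
    intro r h
    rw [← intervalIntegral.integral_const_mul]
    refine intervalIntegral.integral_congr fun t _ => ?_
    have hpath : HasDerivAt (fun s : ℝ => ((r, s) : ℝ × ℝ)) (0, 1) t :=
      (hasDerivAt_const t r).prodMk (hasDerivAt_id t)
    have h1 : HasDerivAt (fun s : ℝ => Λ (r, s)) (fderiv ℝ Λ (r, t) (0, 1)) t :=
      HasFDerivAt.comp_hasDerivAt (f := fun s : ℝ => ((r, s) : ℝ × ℝ)) t
        ((hΛ r h t).differentiableAt (by norm_num)).hasFDerivAt hpath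
    have h2 : HasDerivAt (fun s : ℝ => qC (cyclePoint η (B r) k 1 s)) _ t :=
      HasFDerivAt.comp_hasDerivAt (f := fun s : ℝ => ((r, s) : ℝ × ℝ)) t
        ((hcomp hq r h t).differentiableAt (by norm_num)).hasFDerivAt hpath
    have h4 : HasDerivAt (fun s : ℝ => (Λ (r, s)).2) (fderiv ℝ Λ (r, t) (0, 1)).2 t :=
      (ContinuousLinearMap.snd ℝ ℂ ℂ).hasFDerivAt.comp_hasDerivAt t h1
    have h3 := h4.unique (h2.differentiableAt.hasDerivAt.const_mul (((r : ℂ) ^ 2)⁻¹))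
    simp only [hAv]
    rw [h3]
    simp only [hΛdef]
    rw [pow_add _ n 3, pow_add _ n 1, mul_inv, mul_inv]
    field_simp
  rw [hval r₁ ⟨hr, le_rfl⟩, hval r₀ ⟨le_rfl, hr⟩] at hgreen
  exact (sub_eq_zero.1 hgreen.symm)

/-! ### Complexification of a transition map -/

/-- The inclusion of the `(λ, p, q)`-space as the slice `μ = 0` of the phase space. -/
def sliceL (n : ℕ) : Reduced ℝ n →L[ℝ] Phase n :=
  (ContinuousLinearMap.fst ℝ _ _).prod ((0 : Reduced ℝ n →L[ℝ] (Fin (n - 1) → ℝ)).prod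
    (ContinuousLinearMap.snd ℝ _ _))

lemma sliceL_apply {n : ℕ} (x : Reduced ℝ n) : sliceL n x = (x.1, 0, x.2) := rfl

/-- The first component of the complexified canonical momentum map. -/
def complexEnergy {n : ℕ} (η : ℝ) (z : Reduced ℂ n) : ℂ :=
  η * z.2.1 ^ 2 + z.2.2 ^ (n + 1) + ∑ j : Fin (n - 1), z.1 j * z.2.2 ^ ((j : ℕ) + 1)

lemma analyticAt_coord {n : ℕ} (j : Fin (n - 1)) (z : Reduced ℂ n) :
    AnalyticAt ℂ (fun z : Reduced ℂ n => z.1 j) z :=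
  ((ContinuousLinearMap.proj (R := ℂ) (φ := fun _ : Fin (n - 1) => ℂ) j).comp
    (ContinuousLinearMap.fst ℂ (Fin (n - 1) → ℂ) (ℂ × ℂ))).analyticAt z

lemma analyticAt_complexEnergy {n : ℕ} (η : ℝ) (z : Reduced ℂ n) :
    AnalyticAt ℂ (complexEnergy η) z := by
  have hp : AnalyticAt ℂ (fun z : Reduced ℂ n => z.2.1) z := analyticAt_fst.comp analyticAt_snd
  have hq : AnalyticAt ℂ (fun z : Reduced ℂ n => z.2.2) z := analyticAt_snd.comp analyticAt_snd
  refine ((analyticAt_const.mul (hp.pow 2)).add (hq.pow _)).add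
    (Finset.analyticAt_fun_sum _ fun j _ => ?_)
  exact (analyticAt_coord j z).mul (hq.pow _)

lemma complexEnergy_toComplex {n : ℕ} (η : ℝ) (x : Reduced ℝ n) :
    complexEnergy η (toComplex x) = ((canonicalMomentum n η (sliceL n x)).1 : ℂ) := by
  simp [complexEnergy, toComplex, canonicalMomentum, sliceL_apply]

lemma complexEnergy_cyclePoint {n : ℕ} {η : ℝ} (hη : η = 1 ∨ η = -1) {b : Base n}
    (hb : b ∈ standardSwallowtail n) (k : Fin n) (t : ℝ) :
    complexEnergy η (cyclePoint η b k 1 t) = b.1 := by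
  have h := cycle_mem_curve hη (rootTuple_spec hb) k t
  rw [aeval_swPoly] at h
  simp only [complexEnergy, cyclePoint, Complex.ofReal_one, one_mul]
  linear_combination h

section

variable {n : ℕ} {η : ℝ} {G G' : Phase n → Phase n} {g g' : Base n → Base n}

/-- A complexified transition map sends the vanishing cycles to curves on the standard curves. -/
lemma IsTransition.exists_complex (T : IsTransition n η G G' g g') (hη : η = 1 ∨ η = -1) :
    ∃ (lamC muC : Fin (n - 1) → Reduced ℂ n → ℂ) (pC qC : Reduced ℂ n → ℂ),
      (∀ j, AnalyticAt ℂ (lamC j) 0) ∧ (∀ j, AnalyticAt ℂ (muC j) 0) ∧ AnalyticAt ℂ pC 0 ∧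
      AnalyticAt ℂ qC 0 ∧
      (∀ᶠ x in 𝓝 (0 : Reduced ℝ n), (∀ j, lamC j (toComplex x) = ((G' (sliceL n x)).1 j : ℂ)) ∧
        (∀ j, muC j (toComplex x) = ((G' (sliceL n x)).2.1 j : ℂ)) ∧
        pC (toComplex x) = ((G' (sliceL n x)).2.2.1 : ℂ) ∧
        qC (toComplex x) = ((G' (sliceL n x)).2.2.2 : ℂ)) ∧
      ∀ᶠ b in 𝓝 (0 : Base n), b ∈ standardSwallowtail n → ∀ k t,
        (∀ j, lamC j (cyclePoint η b k 1 t) = ((g' b).2 j : ℂ)) ∧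
        (η : ℂ) * pC (cyclePoint η b k 1 t) ^ 2 +
          Polynomial.aeval (qC (cyclePoint η b k 1 t)) (swPoly (g' b)) = 0 := by
  have hΓ : AnalyticAt ℝ (fun x : Reduced ℝ n => G' (sliceL n x)) 0 :=
    AnalyticAt.comp (g := G') (by rw [(sliceL n).map_zero]; exact T.analytic') ((sliceL n).analyticAt 0)
  have hproj : ∀ (j : Fin (n - 1)) (v : Fin (n - 1) → ℝ),
      AnalyticAt ℝ (fun v : Fin (n - 1) → ℝ => v j) v := fun j v =>
    (ContinuousLinearMap.proj (R := ℝ) (φ := fun _ : Fin (n - 1) => ℝ) j).analyticAt v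
  have hfst : AnalyticAt ℝ (fun x : Reduced ℝ n => (G' (sliceL n x)).1) 0 :=
    analyticAt_fst.comp hΓ
  have hsnd : AnalyticAt ℝ (fun x : Reduced ℝ n => (G' (sliceL n x)).2) 0 :=
    analyticAt_snd.comp hΓ
  have hmu : AnalyticAt ℝ (fun x : Reduced ℝ n => (G' (sliceL n x)).2.1) 0 :=
    analyticAt_fst.comp hsnd
  have hpq : AnalyticAt ℝ (fun x : Reduced ℝ n => (G' (sliceL n x)).2.2) 0 :=
    analyticAt_snd.comp hsnd
  have hp : AnalyticAt ℝ (fun x : Reduced ℝ n => (G' (sliceL n x)).2.2.1) 0 :=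
    analyticAt_fst.comp hpq
  have hq : AnalyticAt ℝ (fun x : Reduced ℝ n => (G' (sliceL n x)).2.2.2) 0 :=
    analyticAt_snd.comp hpq
  -- A base point `(h, λ)` is encoded as `(λ, h, 0)`, so that the complexification lemmas for
  -- `Reduced` also apply to `g'`.
  set σL : Reduced ℝ n →L[ℝ] Base n :=
    ((ContinuousLinearMap.fst ℝ ℝ ℝ).comp (ContinuousLinearMap.snd ℝ _ _)).prod
      (ContinuousLinearMap.fst ℝ _ _) with hσL
  have hσ : ∀ x : Reduced ℝ n, σL x = (x.2.1, x.1) := fun x => rfl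
  have hγ : AnalyticAt ℝ (fun x : Reduced ℝ n => g' (σL x)) 0 :=
    AnalyticAt.comp (g := g') (by rw [σL.map_zero]; exact T.base_analytic') (σL.analyticAt 0)
  have hγ1 : AnalyticAt ℝ (fun x : Reduced ℝ n => (g' (σL x)).1) 0 := analyticAt_fst.comp hγ
  have hγ2 : AnalyticAt ℝ (fun x : Reduced ℝ n => (g' (σL x)).2) 0 := analyticAt_snd.comp hγ
  choose lamC hlamC hlam using fun j => exists_complexification
    (f := fun x : Reduced ℝ n => (G' (sliceL n x)).1 j) ((hproj j _).comp hfst)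
  choose muC hmuC hmuE using fun j => exists_complexification
    (f := fun x : Reduced ℝ n => (G' (sliceL n x)).2.1 j) ((hproj j _).comp hmu)
  obtain ⟨pC, hpC, hpE⟩ := exists_complexification hp
  obtain ⟨qC, hqC, hqE⟩ := exists_complexification hq
  obtain ⟨hC, hhC, hhE⟩ := exists_complexification hγ1
  choose gC hgC hgE using fun j => exists_complexification
    (f := fun x : Reduced ℝ n => (g' (σL x)).2 j) ((hproj j _).comp hγ2)
  have hext : ∀ᶠ x in 𝓝 (0 : Reduced ℝ n),
      (∀ j, lamC j (toComplex x) = ((G' (sliceL n x)).1 j : ℂ)) ∧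
      (∀ j, muC j (toComplex x) = ((G' (sliceL n x)).2.1 j : ℂ)) ∧
      pC (toComplex x) = ((G' (sliceL n x)).2.2.1 : ℂ) ∧
      qC (toComplex x) = ((G' (sliceL n x)).2.2.2 : ℂ) := by
    filter_upwards [Filter.eventually_all.2 hlam, Filter.eventually_all.2 hmuE, hpE, hqE]
      with x h1 h2 h3 h4
    exact ⟨h1, h2, h3, h4⟩
  refine ⟨lamC, muC, pC, qC, hlamC, hmuC, hpC, hqC, hext, ?_⟩
  -- The complexified momentum map in this encoding. The relations below say that it intertwines the
  -- complexifications of `G'` and `g'`; they extend from real points by the identity theorem.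
  set κ : Reduced ℂ n → Reduced ℂ n := fun z => (z.1, complexEnergy η z, 0) with hκ
  have hκ0 : κ 0 = 0 := by simp [hκ, complexEnergy]
  have hκa : AnalyticAt ℂ κ 0 := by
    have h1 : AnalyticAt ℂ (fun z : Reduced ℂ n => z.1) 0 := analyticAt_fst
    exact h1.prod ((analyticAt_complexEnergy η 0).prod analyticAt_const)
  have hslice : Filter.Tendsto (sliceL n) (𝓝 0) (𝓝 0) :=
    (sliceL n).continuous.tendsto' 0 0 (sliceL n).map_zero
  set κr : Reduced ℝ n → Reduced ℝ n := fun x =>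
    (x.1, (canonicalMomentum n η (sliceL n x)).1, 0) with hκr
  have hκrt : Filter.Tendsto κr (𝓝 0) (𝓝 0) := by
    have hc : Continuous κr := continuous_fst.prodMk ((continuous_fst.comp
      ((contDiff_canonicalMomentum n η (k := 0)).continuous.comp (sliceL n).continuous)).prodMk
      continuous_const)
    refine hc.tendsto' 0 0 ?_
    simp only [hκr, (sliceL n).map_zero, canonicalMomentum_zero]
    rfl
  have hκκ : ∀ x, κ (toComplex x) = toComplex (κr x) := by
    intro x
    simp only [hκ, hκr, complexEnergy_toComplex]
    simp [toComplex]
  have hσκ : ∀ x, σL (κr x) = canonicalMomentum n η (sliceL n x) := fun x => rfl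
  have hR1 : ∀ᶠ z in 𝓝 (0 : Reduced ℂ n), ∀ j, lamC j z - gC j (κ z) = 0 := by
    refine Filter.eventually_all.2 fun j => eventually_eq_zero_of_toComplex
      ((hlamC j).sub (AnalyticAt.comp (g := gC j) (by rw [hκ0]; exact hgC j) hκa)) ?_
    filter_upwards [hext, hκrt.eventually (hgE j), hslice.eventually T.comm'] with x h1 h2 h3
    rw [h1.1 j, hκκ, h2, hσκ, ← h3]
    simp [canonicalMomentum]
  have hR2 : ∀ᶠ z in 𝓝 (0 : Reduced ℂ n), (η * pC z ^ 2 + qC z ^ (n + 1) +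
      ∑ j : Fin (n - 1), lamC j z * qC z ^ ((j : ℕ) + 1)) - hC (κ z) = 0 := by
    refine eventually_eq_zero_of_toComplex (AnalyticAt.sub
      (((analyticAt_const.mul (hpC.pow 2)).add (hqC.pow _)).add
      (Finset.analyticAt_fun_sum _ fun j _ => (hlamC j).mul (hqC.pow _)))
      (AnalyticAt.comp (g := hC) (by rw [hκ0]; exact hhC) hκa)) ?_
    filter_upwards [hext, hκrt.eventually hhE, hslice.eventually T.comm'] with x h1 h2 h3
    rw [h1.2.2.1, h1.2.2.2, hκκ, h2, hσκ, ← h3]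
    simp only [h1.1]
    simp [canonicalMomentum]
  set τ : Base n → Reduced ℝ n := fun b => (b.2, b.1, 0) with hτ
  have hτt : Filter.Tendsto τ (𝓝 0) (𝓝 0) :=
    (by fun_prop : Continuous τ).tendsto' 0 0 rfl
  filter_upwards [eventually_cyclePoint (η := η) (hR1.and hR2),
    hτt.eventually (Filter.eventually_all.2 hgE), hτt.eventually hhE] with b h1 h2 h3 hb k t
  obtain ⟨e1, e2⟩ := h1 hb k 1 ⟨zero_le_one, le_rfl⟩ t
  -- The energy is constant on a vanishing cycle, so the whole cycle lies over the real point `b`,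
  -- where the complexification of `g'` takes its real value.
  have hκc : κ (cyclePoint η b k 1 t) = toComplex (τ b) := by
    simp only [hκ, complexEnergy_cyclePoint hη hb]
    simp [cyclePoint, toComplex, hτ]
  have hστ : σL (τ b) = b := rfl
  rw [hκc] at e1 e2
  have e3 : ∀ j, lamC j (cyclePoint η b k 1 t) = ((g' b).2 j : ℂ) := fun j => by
    rw [sub_eq_zero.1 (e1 j), h2 j, hστ]
  refine ⟨e3, ?_⟩
  rw [h3, hστ] at e2
  rw [aeval_swPoly]
  simp only [e3] at e2
  linear_combination e2

end

/-! ### The action form in symplectic coordinates -/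

section

variable {n : ℕ}

lemma AnalyticAt.apply_const {𝕜 V W X : Type*} [NontriviallyNormedField 𝕜] [NormedAddCommGroup V]
    [NormedSpace 𝕜 V] [NormedAddCommGroup W] [NormedSpace 𝕜 W] [NormedAddCommGroup X]
    [NormedSpace 𝕜 X] {A : V → W →L[𝕜] X} {z : V} (hA : AnalyticAt 𝕜 A z) (w : W) :
    AnalyticAt 𝕜 (fun z => A z w) z :=
  ((ContinuousLinearMap.apply 𝕜 X w).analyticAt (A z)).comp hA

lemma curlPQ_add {A B : Reduced ℂ n → Reduced ℂ n →L[ℂ] ℂ} {z : Reduced ℂ n}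
    (hA : DifferentiableAt ℂ A z) (hB : DifferentiableAt ℂ B z) :
    curlPQ (fun z => A z + B z) z = curlPQ A z + curlPQ B z := by
  simp only [curlPQ, fderiv_fun_add hA hB, add_apply]
  ring

lemma curlPQ_sub {A B : Reduced ℂ n → Reduced ℂ n →L[ℂ] ℂ} {z : Reduced ℂ n}
    (hA : DifferentiableAt ℂ A z) (hB : DifferentiableAt ℂ B z) :
    curlPQ (fun z => A z - B z) z = curlPQ A z - curlPQ B z := by
  simp only [curlPQ, fderiv_fun_sub hA hB, sub_apply]
  ring

lemma curlPQ_sum {ι : Type*} [Fintype ι] {A : ι → Reduced ℂ n → Reduced ℂ n →L[ℂ] ℂ}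
    {z : Reduced ℂ n} (hA : ∀ i, DifferentiableAt ℂ (A i) z) :
    curlPQ (fun z => ∑ i, A i z) z = ∑ i, curlPQ (A i) z := by
  simp only [curlPQ, fderiv_fun_sum fun i _ => hA i, sum_apply,
    Finset.sum_sub_distrib]

/-- This is `d(f dm) = df ∧ dm`, by symmetry of the second derivative of `m`. -/
lemma curlPQ_smul_fderiv {f m : Reduced ℂ n → ℂ} {z : Reduced ℂ n} (hf : AnalyticAt ℂ f z)
    (hm : AnalyticAt ℂ m z) :
    curlPQ (fun z => f z • fderiv ℂ m z) z =
      fderiv ℂ f z (0, 1, 0) * fderiv ℂ m z (0, 0, 1) -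
        fderiv ℂ f z (0, 0, 1) * fderiv ℂ m z (0, 1, 0) := by
  have hs : IsSymmSndFDerivAt ℂ m z :=
    (hm.contDiffAt (n := ω)).isSymmSndFDerivAt (by simp)
  simp only [curlPQ, fderiv_fun_smul hf.differentiableAt hm.fderiv.differentiableAt]
  simp only [add_apply, smul_apply,
    ContinuousLinearMap.smulRight_apply, smul_eq_mul, hs.eq (0, 1, 0) (0, 0, 1)]
  ring

/-- The 1-form `∑ⱼ λⱼ dμⱼ + p dq`. -/
def liouvilleForm (lamC muC : Fin (n - 1) → Reduced ℂ n → ℂ) (pC qC : Reduced ℂ n → ℂ)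
    (z : Reduced ℂ n) : Reduced ℂ n →L[ℂ] ℂ :=
  (∑ j, lamC j z • fderiv ℂ (muC j) z) + pC z • fderiv ℂ qC z

variable {η : ℝ} {lamC muC : Fin (n - 1) → Reduced ℂ n → ℂ} {pC qC : Reduced ℂ n → ℂ}

lemma analyticAt_liouvilleForm {z : Reduced ℂ n} (hl : ∀ j, AnalyticAt ℂ (lamC j) z)
    (hm : ∀ j, AnalyticAt ℂ (muC j) z) (hp : AnalyticAt ℂ pC z) (hq : AnalyticAt ℂ qC z) :
    AnalyticAt ℂ (liouvilleForm lamC muC pC qC) z :=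
  (Finset.analyticAt_fun_sum _ fun j _ => (hl j).smul (hm j).fderiv).add (hp.smul hq.fderiv)

lemma curlPQ_liouvilleForm {z : Reduced ℂ n} (hl : ∀ j, AnalyticAt ℂ (lamC j) z)
    (hm : ∀ j, AnalyticAt ℂ (muC j) z) (hp : AnalyticAt ℂ pC z) (hq : AnalyticAt ℂ qC z) :
    curlPQ (liouvilleForm lamC muC pC qC) z =
      (∑ j, (fderiv ℂ (lamC j) z (0, 1, 0) * fderiv ℂ (muC j) z (0, 0, 1) -
        fderiv ℂ (lamC j) z (0, 0, 1) * fderiv ℂ (muC j) z (0, 1, 0))) +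
      (fderiv ℂ pC z (0, 1, 0) * fderiv ℂ qC z (0, 0, 1) -
        fderiv ℂ pC z (0, 0, 1) * fderiv ℂ qC z (0, 1, 0)) := by
  have h1 : ∀ j, DifferentiableAt ℂ (fun z => lamC j z • fderiv ℂ (muC j) z) z := fun j =>
    ((hl j).smul (hm j).fderiv).differentiableAt
  have h2 : DifferentiableAt ℂ (fun z => pC z • fderiv ℂ qC z) z :=
    (hp.smul hq.fderiv).differentiableAt
  unfold liouvilleForm
  rw [curlPQ_add (DifferentiableAt.fun_sum fun j _ => h1 j) h2, curlPQ_sum h1,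
    curlPQ_smul_fderiv hp hq]
  simp only [fun j => curlPQ_smul_fderiv (hl j) (hm j)]

lemma analyticAt_curlPQ {A : Reduced ℂ n → Reduced ℂ n →L[ℂ] ℂ} {z : Reduced ℂ n}
    (hA : AnalyticAt ℂ A z) : AnalyticAt ℂ (curlPQ A) z :=
  (AnalyticAt.apply_const (AnalyticAt.apply_const hA.fderiv _) _).sub
    (AnalyticAt.apply_const (AnalyticAt.apply_const hA.fderiv _) _)

lemma eventually_curlPQ_toComplex {α : Reduced ℝ n → Reduced ℝ n →L[ℝ] ℝ}
    {αC : Reduced ℂ n → Reduced ℂ n →L[ℂ] ℂ} (hα : AnalyticAt ℝ α 0) (hαC : AnalyticAt ℂ αC 0)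
    (hext : ∀ᶠ x in 𝓝 (0 : Reduced ℝ n), ∀ v, αC (toComplex x) (toComplex v) = (α x v : ℂ)) :
    ∀ᶠ x in 𝓝 (0 : Reduced ℝ n),
      curlPQ αC (toComplex x) = (dOneForm α x (0, 1, 0) (0, 0, 1) : ℂ) := by
  have hp : toComplex ((0, 1, 0) : Reduced ℝ n) = (0, 1, 0) := by simp [toComplex]; rfl
  have hq : toComplex ((0, 0, 1) : Reduced ℝ n) = (0, 0, 1) := by simp [toComplex]; rfl
  have key : ∀ v : Reduced ℝ n, ∀ᶠ x in 𝓝 (0 : Reduced ℝ n), ∀ w,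
      fderiv ℂ αC (toComplex x) (toComplex w) (toComplex v) = (fderiv ℝ α x w v : ℂ) := by
    intro v
    have h1 := eventually_fderiv_complexification (fC := fun z => αC z (toComplex v))
      (f := fun x => α x v) (AnalyticAt.apply_const hαC _) (AnalyticAt.apply_const hα _)
      (hext.mono fun x h => h v)
    have h2 : ∀ᶠ x in 𝓝 (0 : Reduced ℝ n), AnalyticAt ℂ αC (toComplex x) :=
      continuous_toComplex.continuousAt.eventually
        (by rw [toComplex_zero]; exact hαC.eventually_analyticAt)
    filter_upwards [h1, h2, hα.eventually_analyticAt] with x e1 e2 e3 w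
    have := e1 w
    rw [fderiv_clm_apply e2.differentiableAt (differentiableAt_const _),
      fderiv_clm_apply e3.differentiableAt (differentiableAt_const _)] at this
    simpa using this
  filter_upwards [key (0, 1, 0), key (0, 0, 1)] with x h1 h2
  have e1 := h1 (0, 0, 1)
  have e2 := h2 (0, 1, 0)
  rw [hp, hq] at e1 e2
  simp only [curlPQ, dOneForm, e1, e2]
  push_cast
  ring

lemma hasDerivAt_cyclePoint {b : Base n} (hb : b ∈ standardSwallowtail n) (k : Fin n) (t : ℝ) :
    HasDerivAt (fun t => cyclePoint η b k 1 t)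
      (0, deriv (fun s => unitFactor η k * (cycleP (rootTuple b) k s : ℂ)) t,
        ((deriv (cycleQ (rootTuple b) k) t : ℝ) : ℂ)) t := by
  refine (hasDerivAt_const t _).prodMk (HasDerivAt.prodMk ?_ ?_)
  · simpa using ((contDiff_unit_cycleP hb k).differentiable (by norm_num) t).hasDerivAt
  · exact ((contDiff_cycleQ_right _ k).differentiable (by norm_num) t).hasDerivAt.ofReal_comp

lemma continuous_cyclePoint {b : Base n} (hb : b ∈ standardSwallowtail n) (k : Fin n) :
    Continuous fun t => cyclePoint η b k 1 t :=
  continuous_iff_continuousAt.2 fun t => (hasDerivAt_cyclePoint hb k t).continuousAt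

lemma continuous_deriv_cyclePoint {b : Base n} (hb : b ∈ standardSwallowtail n) (k : Fin n) :
    Continuous fun t => ((0, deriv (fun s => unitFactor η k * (cycleP (rootTuple b) k s : ℂ)) t,
      ((deriv (cycleQ (rootTuple b) k) t : ℝ) : ℂ)) : Reduced ℂ n) :=
  continuous_const.prodMk (((contDiff_unit_cycleP hb k).continuous_deriv (by norm_num)).prodMk
    (Complex.continuous_ofReal.comp
      ((contDiff_cycleQ_right _ k).continuous_deriv (by norm_num))))

/-- A 1-form and a Liouville form with the same `dp ∧ dq`-coefficient have the same integral over
a vanishing cycle on which the functions `λⱼ` are constant. -/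
lemma cycleIntegral_eq_of_curl {A : Reduced ℂ n → Reduced ℂ n →L[ℂ] ℂ} {b : Base n}
    (hb : b ∈ standardSwallowtail n) (k : Fin n) {c : Fin (n - 1) → ℂ}
    (hlam : ∀ j t, lamC j (cyclePoint η b k 1 t) = c j)
    (h : ∀ σ ∈ Set.Icc (0 : ℝ) 1, ∀ t, AnalyticAt ℂ A (cyclePoint η b k σ t) ∧
      (∀ j, AnalyticAt ℂ (lamC j) (cyclePoint η b k σ t)) ∧
      (∀ j, AnalyticAt ℂ (muC j) (cyclePoint η b k σ t)) ∧
      AnalyticAt ℂ pC (cyclePoint η b k σ t) ∧ AnalyticAt ℂ qC (cyclePoint η b k σ t) ∧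
      curlPQ A (cyclePoint η b k σ t) =
        curlPQ (liouvilleForm lamC muC pC qC) (cyclePoint η b k σ t)) :
    cycleIntegral η A b k = ∫ t in (0 : ℝ)..(2 * Real.pi), pC (cyclePoint η b k 1 t) *
      deriv (fun t : ℝ => qC (cyclePoint η b k 1 t)) t := by
  have hone : (1 : ℝ) ∈ Set.Icc (0 : ℝ) 1 := ⟨zero_le_one, le_rfl⟩
  set L := liouvilleForm lamC muC pC qC with hL
  have hLa : ∀ σ ∈ Set.Icc (0 : ℝ) 1, ∀ t, AnalyticAt ℂ L (cyclePoint η b k σ t) := fun σ hσ t =>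
    analyticAt_liouvilleForm (h σ hσ t).2.1 (h σ hσ t).2.2.1 (h σ hσ t).2.2.2.1
      (h σ hσ t).2.2.2.2.1
  -- The difference has no `dp ∧ dq`-part, which is all that enters the contraction formula.
  have h1 : cycleIntegral η (fun z => A z - L z) b k = 0 := by
    rw [cycleIntegral_eq_area hb k fun σ hσ t => (h σ hσ t).1.fun_sub (hLa σ hσ t)]
    refine (intervalIntegral.integral_congr fun σ hσ => (?_ : _ = (0 : ℂ))).trans
      intervalIntegral.integral_zero
    rw [Set.uIcc_of_le zero_le_one] at hσ
    refine (intervalIntegral.integral_congr fun t _ => (?_ : _ = (0 : ℂ))).trans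
      intervalIntegral.integral_zero
    rw [curlPQ_sub (h σ hσ t).1.differentiableAt (hLa σ hσ t).differentiableAt,
      (h σ hσ t).2.2.2.2.2, sub_self, zero_mul]
  have hcont : ∀ {B : Reduced ℂ n → Reduced ℂ n →L[ℂ] ℂ},
      (∀ t, AnalyticAt ℂ B (cyclePoint η b k 1 t)) → Continuous fun t => B (cyclePoint η b k 1 t)
        (0, deriv (fun s => unitFactor η k * (cycleP (rootTuple b) k s : ℂ)) t,
          ((deriv (cycleQ (rootTuple b) k) t : ℝ) : ℂ)) := by
    intro B hB
    refine Continuous.clm_apply ?_ (continuous_deriv_cyclePoint hb k)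
    exact continuous_iff_continuousAt.2 fun t => ContinuousAt.comp
      (f := fun t => cyclePoint η b k 1 t) (hB t).continuousAt
      (continuous_cyclePoint hb k).continuousAt
  have h2 : cycleIntegral η A b k = cycleIntegral η L b k := by
    rw [cycleIntegral_eq hb] at h1
    simp only [sub_apply] at h1
    rw [intervalIntegral.integral_sub ((hcont fun t => (h 1 hone t).1).intervalIntegrable _ _)
      ((hcont fun t => hLa 1 hone t).intervalIntegrable _ _)] at h1
    rw [cycleIntegral_eq hb, cycleIntegral_eq hb]
    exact sub_eq_zero.1 h1
  have hder : ∀ {f : Reduced ℂ n → ℂ}, (∀ t, AnalyticAt ℂ f (cyclePoint η b k 1 t)) → ∀ t,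
      HasDerivAt (fun t : ℝ => f (cyclePoint η b k 1 t)) (fderiv ℂ f (cyclePoint η b k 1 t)
        (0, deriv (fun s => unitFactor η k * (cycleP (rootTuple b) k s : ℂ)) t,
          ((deriv (cycleQ (rootTuple b) k) t : ℝ) : ℂ))) t := by
    intro f hf t
    exact HasFDerivAt.comp_hasDerivAt (f := fun t => cyclePoint η b k 1 t) t
      ((hf t).differentiableAt.hasFDerivAt.restrictScalars ℝ) (hasDerivAt_cyclePoint hb k t)
  -- With `λⱼ` constant on the loop, `∑ⱼ λⱼ dμⱼ` is exact there and integrates to 0.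
  have hmu : ∀ t, HasDerivAt (fun t : ℝ => ∑ j, c j * muC j (cyclePoint η b k 1 t))
      (∑ j, c j * fderiv ℂ (muC j) (cyclePoint η b k 1 t)
        (0, deriv (fun s => unitFactor η k * (cycleP (rootTuple b) k s : ℂ)) t,
          ((deriv (cycleQ (rootTuple b) k) t : ℝ) : ℂ))) t := fun t =>
    HasDerivAt.fun_sum fun j _ => (hder (fun t => (h 1 hone t).2.2.1 j) t).const_mul _
  have hmuc : Continuous fun t : ℝ => ∑ j, c j * fderiv ℂ (muC j) (cyclePoint η b k 1 t)
        (0, deriv (fun s => unitFactor η k * (cycleP (rootTuple b) k s : ℂ)) t,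
          ((deriv (cycleQ (rootTuple b) k) t : ℝ) : ℂ)) :=
    continuous_finsetSum _ fun j _ => continuous_const.mul
      (hcont fun t => ((h 1 hone t).2.2.1 j).fderiv)
  have hmu0 : ∫ t in (0 : ℝ)..(2 * Real.pi), (∑ j, c j * fderiv ℂ (muC j) (cyclePoint η b k 1 t)
        (0, deriv (fun s => unitFactor η k * (cycleP (rootTuple b) k s : ℂ)) t,
          ((deriv (cycleQ (rootTuple b) k) t : ℝ) : ℂ))) = 0 := by
    rw [intervalIntegral.integral_eq_sub_of_hasDerivAt (fun t _ => hmu t)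
      (hmuc.intervalIntegrable _ _), sub_eq_zero]
    refine Finset.sum_congr rfl fun j _ => ?_
    have := cyclePoint_periodic η b k 1 0
    rw [zero_add] at this
    rw [this]
  have hpq : Continuous fun t => pC (cyclePoint η b k 1 t) *
      deriv (fun t : ℝ => qC (cyclePoint η b k 1 t)) t := by
    simp only [fun t => (hder (fun t => (h 1 hone t).2.2.2.2.1) t).deriv]
    refine Continuous.mul ?_ (hcont fun t => (h 1 hone t).2.2.2.2.1.fderiv)
    exact continuous_iff_continuousAt.2 fun t =>
      (hder (fun t => (h 1 hone t).2.2.2.1) t).continuousAt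
  rw [h2, cycleIntegral_eq hb, ← zero_add (∫ t in (0 : ℝ)..(2 * Real.pi), _ * _), ← hmu0,
    ← intervalIntegral.integral_add (hmuc.intervalIntegrable _ _) (hpq.intervalIntegrable _ _)]
  refine intervalIntegral.integral_congr fun t _ => ?_
  simp only [hL, liouvilleForm, add_apply, sum_apply,
    smul_apply, smul_eq_mul, hlam,
    (hder (fun t => (h 1 hone t).2.2.2.2.1) t).deriv]

end

/-! ### Actions as rescaled areas of standard vanishing cycles -/

section

variable {n : ℕ} {η : ℝ} {G G' : Phase n → Phase n} {g g' : Base n → Base n}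
  {α : Reduced ℝ n → Reduced ℝ n →L[ℝ] ℝ} {αC : Reduced ℂ n → Reduced ℂ n →L[ℂ] ℂ}

/-- The actions are the areas enclosed by the images of the vanishing cycles in symplectic
coordinates. -/
lemma IsTransition.exists_cycleIntegral_eq (T : IsTransition n η G G' g g') (hη : η = 1 ∨ η = -1)
    (hα : AnalyticAt ℝ α 0) (hαC : AnalyticAt ℂ αC 0)
    (hext : ∀ᶠ x in 𝓝 (0 : Reduced ℝ n), ∀ v, αC (toComplex x) (toComplex v) = (α x v : ℂ))
    (hform : ∀ᶠ x in 𝓝 (0 : Reduced ℝ n), dOneForm α x (0, 1, 0) (0, 0, 1) =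
      canonicalForm (fderiv ℝ G' (sliceL n x) (0, 0, 1, 0))
        (fderiv ℝ G' (sliceL n x) (0, 0, 0, 1))) :
    ∃ pC qC : Reduced ℂ n → ℂ, AnalyticAt ℂ pC 0 ∧ AnalyticAt ℂ qC 0 ∧
      ∀ᶠ b in 𝓝 (0 : Base n), b ∈ standardSwallowtail n → ∀ k,
        (∀ t, (η : ℂ) * pC (cyclePoint η b k 1 t) ^ 2 +
          Polynomial.aeval (qC (cyclePoint η b k 1 t)) (swPoly (g' b)) = 0) ∧
        cycleIntegral η αC b k = ∫ t in (0 : ℝ)..(2 * Real.pi), pC (cyclePoint η b k 1 t) *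
          deriv (fun t : ℝ => qC (cyclePoint η b k 1 t)) t := by
  obtain ⟨lamC, muC, pC, qC, hl, hm, hp, hq, hreal, hcyc⟩ := T.exists_complex hη
  refine ⟨pC, qC, hp, hq, ?_⟩
  have hslice : Filter.Tendsto (sliceL n) (𝓝 0) (𝓝 0) :=
    (sliceL n).continuous.tendsto' 0 0 (sliceL n).map_zero
  have hG'x : ∀ᶠ x in 𝓝 (0 : Reduced ℝ n), AnalyticAt ℝ G' (sliceL n x) :=
    hslice.eventually T.analytic'.eventually_analyticAt
  have hΓ : AnalyticAt ℝ (fun x : Reduced ℝ n => G' (sliceL n x)) 0 :=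
    AnalyticAt.comp (g := G') (by rw [(sliceL n).map_zero]; exact T.analytic')
      ((sliceL n).analyticAt 0)
  have hder : ∀ (ℓ : Phase n →L[ℝ] ℝ) {fC : Reduced ℂ n → ℂ}, AnalyticAt ℂ fC 0 →
      (∀ᶠ x in 𝓝 (0 : Reduced ℝ n), fC (toComplex x) = (ℓ (G' (sliceL n x)) : ℂ)) →
      ∀ᶠ x in 𝓝 (0 : Reduced ℝ n), ∀ v, fderiv ℂ fC (toComplex x) (toComplex v) =
        (ℓ (fderiv ℝ G' (sliceL n x) (sliceL n v)) : ℂ) := by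
    intro ℓ fC hfC h
    filter_upwards [eventually_fderiv_complexification hfC
      (f := fun x => ℓ (G' (sliceL n x))) ((ℓ.analyticAt _).comp hΓ) h, hG'x] with x h1 h2 v
    rw [h1]
    have : HasFDerivAt (fun x => ℓ (G' (sliceL n x)))
        (ℓ ∘L (fderiv ℝ G' (sliceL n x)) ∘L sliceL n) x :=
      ℓ.hasFDerivAt.comp x (h2.differentiableAt.hasFDerivAt.comp x (sliceL n).hasFDerivAt)
    rw [this.fderiv]
    rfl
  -- At real points both terms are the coefficient of `dp ∧ dq` in the pull-back of the canonical
  -- form by `G'` to the slice `μ = 0`; the identity theorem extends the equality.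
  have hcurl : ∀ᶠ z in 𝓝 (0 : Reduced ℂ n),
      curlPQ αC z - curlPQ (liouvilleForm lamC muC pC qC) z = 0 := by
    refine eventually_eq_zero_of_toComplex ((analyticAt_curlPQ hαC).sub
      (analyticAt_curlPQ (analyticAt_liouvilleForm hl hm hp hq))) ?_
    have hall : ∀ᶠ z in 𝓝 (0 : Reduced ℂ n), (∀ j, AnalyticAt ℂ (lamC j) z) ∧
        (∀ j, AnalyticAt ℂ (muC j) z) ∧ AnalyticAt ℂ pC z ∧ AnalyticAt ℂ qC z :=
      (Filter.eventually_all.2 fun j => (hl j).eventually_analyticAt).and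
        ((Filter.eventually_all.2 fun j => (hm j).eventually_analyticAt).and
          (hp.eventually_analyticAt.and hq.eventually_analyticAt))
    have hallx : ∀ᶠ x in 𝓝 (0 : Reduced ℝ n), (∀ j, AnalyticAt ℂ (lamC j) (toComplex x)) ∧
        (∀ j, AnalyticAt ℂ (muC j) (toComplex x)) ∧ AnalyticAt ℂ pC (toComplex x) ∧
        AnalyticAt ℂ qC (toComplex x) :=
      continuous_toComplex.continuousAt.eventually (by rw [toComplex_zero]; exact hall)
    have d1 := Filter.eventually_all.2 fun j => hder
      ((ContinuousLinearMap.proj (R := ℝ) (φ := fun _ : Fin (n - 1) => ℝ) j).comp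
        (ContinuousLinearMap.fst ℝ _ _)) (hl j) (hreal.mono fun x h => h.1 j)
    have d2 := Filter.eventually_all.2 fun j => hder
      ((ContinuousLinearMap.proj (R := ℝ) (φ := fun _ : Fin (n - 1) => ℝ) j).comp
        ((ContinuousLinearMap.fst ℝ _ _).comp (ContinuousLinearMap.snd ℝ _ _))) (hm j)
        (hreal.mono fun x h => h.2.1 j)
    have d3 := hder ((ContinuousLinearMap.fst ℝ ℝ ℝ).comp ((ContinuousLinearMap.snd ℝ _ _).comp
      (ContinuousLinearMap.snd ℝ _ _))) hp (hreal.mono fun x h => h.2.2.1)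
    have d4 := hder ((ContinuousLinearMap.snd ℝ ℝ ℝ).comp ((ContinuousLinearMap.snd ℝ _ _).comp
      (ContinuousLinearMap.snd ℝ _ _))) hq (hreal.mono fun x h => h.2.2.2)
    filter_upwards [hallx, d1, d2, d3, d4, hform, eventually_curlPQ_toComplex hα hαC hext]
      with x ha e1 e2 e3 e4 e5 e6
    have tp : toComplex ((0, 1, 0) : Reduced ℝ n) = (0, 1, 0) := by simp [toComplex]; rfl
    have tq : toComplex ((0, 0, 1) : Reduced ℝ n) = (0, 0, 1) := by simp [toComplex]; rfl
    have sp : sliceL n (0, 1, 0) = (0, 0, 1, 0) := rfl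
    have sq : sliceL n (0, 0, 1) = (0, 0, 0, 1) := rfl
    rw [e6, curlPQ_liouvilleForm ha.1 ha.2.1 ha.2.2.1 ha.2.2.2, e5, ← tp, ← tq]
    simp only [e1, e2, e3, e4, sp, sq, canonicalForm, lambdaMuForm]
    simp only [ContinuousLinearMap.comp_apply, ContinuousLinearMap.proj_apply,
      ContinuousLinearMap.coe_fst', ContinuousLinearMap.coe_snd']
    push_cast
    ring
  have hev : ∀ᶠ z in 𝓝 (0 : Reduced ℂ n), AnalyticAt ℂ αC z ∧
      (∀ j, AnalyticAt ℂ (lamC j) z) ∧ (∀ j, AnalyticAt ℂ (muC j) z) ∧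
      AnalyticAt ℂ pC z ∧ AnalyticAt ℂ qC z ∧
      curlPQ αC z = curlPQ (liouvilleForm lamC muC pC qC) z := by
    filter_upwards [hαC.eventually_analyticAt,
      Filter.eventually_all.2 fun j => (hl j).eventually_analyticAt,
      Filter.eventually_all.2 fun j => (hm j).eventually_analyticAt, hp.eventually_analyticAt,
      hq.eventually_analyticAt, hcurl] with z h1 h2 h3 h4 h5 h6
    exact ⟨h1, h2, h3, h4, h5, sub_eq_zero.1 h6⟩
  filter_upwards [hcyc, eventually_cyclePoint (η := η) hev] with b h1 h2 hb k
  exact ⟨fun t => (h1 hb k t).2, cycleIntegral_eq_of_curl hb k (fun j t => (h1 hb k t).1 j)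
    fun σ hσ t => h2 hb k σ hσ t⟩

/-- The actions are the rescaled areas of the vanishing cycles of a standard curve. -/
lemma IsTransition.eventually_cycleIntegral (T : IsTransition n η G G' g g') (hn : 2 ≤ n)
    (hη : η = 1 ∨ η = -1) (hα : AnalyticAt ℝ α 0) (hαC : AnalyticAt ℂ αC 0)
    (hext : ∀ᶠ x in 𝓝 (0 : Reduced ℝ n), ∀ v, αC (toComplex x) (toComplex v) = (α x v : ℂ))
    (hform : ∀ᶠ x in 𝓝 (0 : Reduced ℝ n), dOneForm α x (0, 1, 0) (0, 0, 1) =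
      canonicalForm (fderiv ℝ G' (sliceL n x) (0, 0, 1, 0))
        (fderiv ℝ G' (sliceL n x) (0, 0, 0, 1))) :
    ∀ᶠ b in 𝓝 (0 : Base n), b ∈ standardSwallowtail n → ∀ k,
      cycleIntegral η αC (g b) k = unitFactor η k *
        ((dOneForm α 0 (0, 1, 0) (0, 0, 1) *
          cycleArea (rootTuple (scale (axisFactor G) b)) k : ℝ) : ℂ) := by
  have hη0 : η ≠ 0 := by rcases hη with rfl | rfl <;> norm_num
  obtain ⟨pC, qC, hp, hq, hcyc⟩ := T.exists_cycleIntegral_eq hη hα hαC hext hform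
  have hρ : curlPQ αC 0 = (dOneForm α 0 (0, 1, 0) (0, 0, 1) : ℂ) := by
    have := (eventually_curlPQ_toComplex hα hαC hext).self_of_nhds
    rwa [toComplex_zero] at this
  have hall := ((T.eventually_mapsTo hn hη0).and (T.base_left_inv.and
    (T.base_analytic.eventually_analyticAt.and (T.base_tendsto.eventually (hcyc.and
      (eventually_cyclePoint (η := η) (hp.eventually_analyticAt.and hq.eventually_analyticAt)))))))
  obtain ⟨δ, hδ, hδp⟩ := Metric.eventually_nhds_iff_ball.1 hall
  filter_upwards [Metric.ball_mem_nhds (0 : Base n) hδ] with β hβδ hβ k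
  have hsc : ∀ r : ℝ, |r| ≤ 1 → scale r β ∈ Metric.ball (0 : Base n) δ := fun r hr => by
    rw [mem_ball_zero_iff] at hβδ ⊢
    exact (norm_scale_le hr β).trans_lt hβδ
  set B : ℝ → Base n := fun r => g (scale (r ^ 2) β) with hB
  have hsq : ∀ r : ℝ, r ∈ Set.Ioc (0 : ℝ) 1 → |r ^ 2| ≤ 1 := fun r hr => by
    rw [abs_of_nonneg (sq_nonneg r)]
    exact pow_le_one₀ hr.1.le hr.2
  have hscD : ∀ r : ℝ, r ≠ 0 → scale (r ^ 2) β ∈ standardSwallowtail n := fun r hr =>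
    scale_mem_standardSwallowtail (pow_ne_zero 2 hr) hβ
  have hBD : ∀ r ∈ Set.Ioc (0 : ℝ) 1, B r ∈ standardSwallowtail n := fun r hr =>
    (hδp _ (hsc _ (hsq r hr))).1 (hscD r hr.1.ne')
  have hscale2 : ContDiff ℝ 2 (fun r : ℝ => scale (r ^ 2) β) :=
    contDiff_scale.comp ((contDiff_id.pow 2).prodMk contDiff_const)
  have hBs : ∀ r ∈ Set.Ioc (0 : ℝ) 1, ContDiffAt ℝ 2 B r := fun r hr =>
    ContDiffAt.comp (g := g) (f := fun r : ℝ => scale (r ^ 2) β) r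
      (hδp _ (hsc _ (hsq r hr))).2.2.1.contDiffAt hscale2.contDiffAt
  have hint : ∀ r ∈ Set.Ioc (0 : ℝ) 1, cycleIntegral η αC (B r) k =
      ∫ t in (0 : ℝ)..(2 * Real.pi), pC (cyclePoint η (B r) k 1 t) *
        deriv (fun t : ℝ => qC (cyclePoint η (B r) k 1 t)) t := fun r hr =>
    ((hδp _ (hsc _ (hsq r hr))).2.2.2.1 (hBD r hr) k).2
  have hone : (1 : ℝ) ∈ Set.Icc (0 : ℝ) 1 := ⟨zero_le_one, le_rfl⟩
  -- The value at `r` is compared with the value at 1, where `scale 1 β = β`. Being constant, the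
  -- rescaled integral equals its own limit as `r → 0`.
  have hconst : ∀ r ∈ Set.Ioc (0 : ℝ) 1,
      ((r : ℂ) ^ (n + 3))⁻¹ * cycleIntegral η αC (B r) k = cycleIntegral η αC (g β) k := by
    intro r hr
    have hI : ∀ s ∈ Set.Icc r 1, s ∈ Set.Ioc (0 : ℝ) 1 := fun s hs => ⟨hr.1.trans_le hs.1, hs.2⟩
    have key := rescaled_area_eq (pC := pC) (qC := qC) hη0 hβ (B := B) hr.1 hr.2
      (fun s hs => hBs s (hI s hs)) (fun s hs => hBD s (hI s hs)) k
      (fun s hs t => ((hδp _ (hsc _ (hsq s (hI s hs)))).2.2.2.2 (hBD s (hI s hs)) k 1 hone t).1)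
      (fun s hs t => ((hδp _ (hsc _ (hsq s (hI s hs)))).2.2.2.2 (hBD s (hI s hs)) k 1 hone t).2)
      (fun s hs => by
        have h1 : ∀ᶠ s' in 𝓝 s, scale (s' ^ 2) β ∈ Metric.ball (0 : Base n) δ :=
          hscale2.continuous.continuousAt.eventually
            (Metric.isOpen_ball.mem_nhds (hsc _ (hsq s (hI s hs))))
        have h2 : ∀ᶠ s' in 𝓝 s, s' ≠ 0 := isOpen_ne.mem_nhds (hI s hs).1.ne'
        filter_upwards [h1, h2] with s' h1 h2 t
        have h3 := hδp _ h1
        -- The curve is the one of `g' (B s')`, and `g'` undoes `g`, leaving `scale (s' ^ 2) β`.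
        have h4 := (h3.2.2.2.1 (h3.1 (hscD s' h2)) k).1 t
        rwa [h3.2.1] at h4)
    rw [← hint r hr, ← hint 1 ⟨zero_lt_one, le_rfl⟩] at key
    rw [← key]
    simp [hB]
  have hr0 : ∀ᶠ r in 𝓝[>] (0 : ℝ), r ∈ Set.Ioc (0 : ℝ) 1 :=
    Ioc_mem_nhdsGT zero_lt_one
  have hsqt : Filter.Tendsto (fun r : ℝ => r ^ 2) (𝓝[>] 0) (𝓝[>] 0) := by
    refine tendsto_nhdsWithin_iff.2 ⟨?_, ?_⟩
    · exact ((continuous_pow 2).tendsto' (0 : ℝ) 0 (by norm_num)).mono_left nhdsWithin_le_nhds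
    · filter_upwards [self_mem_nhdsWithin] with r hr
      exact Set.mem_Ioi.2 (pow_pos (Set.mem_Ioi.1 hr) 2)
  have hB0 : Filter.Tendsto B (𝓝[>] 0) (𝓝 0) := by
    refine T.base_tendsto.comp ?_
    have := hscale2.continuous.tendsto' (0 : ℝ) 0 (by
      rw [zero_pow two_ne_zero]; exact scale_zero_left β)
    exact this.mono_left nhdsWithin_le_nhds
  have hlim := tendsto_cycleIntegral (η := η) hαC
    (scale_mem_standardSwallowtail (T.axisFactor_ne_zero hn hη0) hβ) hB0
    ((T.tendsto_scale hn hη0 hβ).comp hsqt) k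
  have hlim' : Filter.Tendsto (fun r : ℝ => ((r : ℂ) ^ (n + 3))⁻¹ * cycleIntegral η αC (B r) k)
      (𝓝[>] 0) (𝓝 (cycleIntegral η αC (g β) k)) :=
    tendsto_const_nhds.congr' (hr0.mono fun r hr => (hconst r hr).symm)
  rw [tendsto_nhds_unique hlim' hlim, hρ]
  push_cast
  ring

end

/-! ### Transition maps between charts -/

section

variable {E : Type*} [NormedAddCommGroup E] [NormedSpace ℝ E]
  {M : Type*} [TopologicalSpace M] [ChartedSpace E M] {n : ℕ} {P : M}

lemma IsCenteredAnalyticChart.zero_mem {Φ : OpenPartialHomeomorph M (Phase n)}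
    (h : IsCenteredAnalyticChart (E := E) Φ P) : (0 : Phase n) ∈ Φ.target :=
  h.map_eq_zero ▸ Φ.map_source h.mem_source

lemma IsCenteredAnalyticChart.symm_zero {Φ : OpenPartialHomeomorph M (Phase n)}
    (h : IsCenteredAnalyticChart (E := E) Φ P) : Φ.symm 0 = P := by
  rw [← h.map_eq_zero, Φ.left_inv h.mem_source]

lemma IsCenteredAnalyticChart.target_mem {Φ : OpenPartialHomeomorph M (Phase n)}
    (h : IsCenteredAnalyticChart (E := E) Φ P) : ∀ᶠ z in 𝓝 (0 : Phase n), z ∈ Φ.target :=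
  Φ.open_target.mem_nhds h.zero_mem

lemma IsCenteredAnalyticChart.symm_tendsto {Φ : OpenPartialHomeomorph M (Phase n)}
    (h : IsCenteredAnalyticChart (E := E) Φ P) : Filter.Tendsto Φ.symm (𝓝 0) (𝓝 P) := by
  have := (Φ.continuousAt_symm h.zero_mem).tendsto
  rwa [h.symm_zero] at this

lemma IsCenteredAnalyticBaseChart.zero_mem {φ : OpenPartialHomeomorph (Base n) (Base n)}
    {b : Base n} (h : IsCenteredAnalyticBaseChart φ b) : (0 : Base n) ∈ φ.target :=
  h.map_eq_zero ▸ φ.map_source h.mem_source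

lemma IsCenteredAnalyticBaseChart.symm_zero {φ : OpenPartialHomeomorph (Base n) (Base n)}
    {b : Base n} (h : IsCenteredAnalyticBaseChart φ b) : φ.symm 0 = b := by
  rw [← h.map_eq_zero, φ.left_inv h.mem_source]

lemma IsCenteredAnalyticBaseChart.symm_tendsto {φ : OpenPartialHomeomorph (Base n) (Base n)}
    {b : Base n} (h : IsCenteredAnalyticBaseChart φ b) :
    Filter.Tendsto φ.symm (𝓝 0) (𝓝 b) := by
  have := (φ.continuousAt_symm h.zero_mem).tendsto
  rwa [h.symm_zero] at this

section Phase

variable {Φ₁ Φ₂ : OpenPartialHomeomorph M (Phase n)}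

lemma IsCenteredAnalyticChart.analyticAt_transition (h₁ : IsCenteredAnalyticChart (E := E) Φ₁ P)
    (h₂ : IsCenteredAnalyticChart (E := E) Φ₂ P) :
    AnalyticAt ℝ (fun z => Φ₁ (Φ₂.symm z)) 0 := by
  have d1 : ContMDiffAt 𝓘(ℝ, E) 𝓘(ℝ, Phase n) ω Φ₁ (Φ₂.symm 0) := by
    rw [h₂.symm_zero]
    exact h₁.analytic.contMDiffAt (Φ₁.open_source.mem_nhds h₁.mem_source)
  have d2 : ContMDiffAt 𝓘(ℝ, Phase n) 𝓘(ℝ, E) ω Φ₂.symm 0 :=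
    h₂.analytic_symm.contMDiffAt (Φ₂.open_target.mem_nhds h₂.zero_mem)
  exact (contMDiffAt_iff_contDiffAt.1 (d1.comp 0 d2)).analyticAt

lemma IsCenteredAnalyticChart.transition_zero (h₁ : IsCenteredAnalyticChart (E := E) Φ₁ P)
    (h₂ : IsCenteredAnalyticChart (E := E) Φ₂ P) : Φ₁ (Φ₂.symm 0) = 0 := by
  rw [h₂.symm_zero, h₁.map_eq_zero]

lemma IsCenteredAnalyticChart.eventually_mem_source (h₁ : IsCenteredAnalyticChart (E := E) Φ₁ P)
    (h₂ : IsCenteredAnalyticChart (E := E) Φ₂ P) :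
    ∀ᶠ z in 𝓝 (0 : Phase n), Φ₂.symm z ∈ Φ₁.source :=
  h₂.symm_tendsto.eventually (Φ₁.open_source.mem_nhds h₁.mem_source)

lemma IsCenteredAnalyticChart.transition_inv (h₁ : IsCenteredAnalyticChart (E := E) Φ₁ P)
    (h₂ : IsCenteredAnalyticChart (E := E) Φ₂ P) :
    ∀ᶠ z in 𝓝 (0 : Phase n), Φ₂ (Φ₁.symm (Φ₁ (Φ₂.symm z))) = z := by
  filter_upwards [h₁.eventually_mem_source h₂, h₂.target_mem] with z hz hz'
  rw [Φ₁.left_inv hz, Φ₂.right_inv hz']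

/-- Chain rule for `Φ₂⁻¹ = Φ₁⁻¹ ∘ (Φ₁ ∘ Φ₂⁻¹)`. -/
lemma pullbackForm_transition
    (Ω : (x : M) → TangentSpace 𝓘(ℝ, E) x →L[ℝ] TangentSpace 𝓘(ℝ, E) x →L[ℝ] ℝ)
    (h₁ : IsCenteredAnalyticChart (E := E) Φ₁ P) (h₂ : IsCenteredAnalyticChart (E := E) Φ₂ P) :
    ∀ᶠ z in 𝓝 (0 : Phase n), ∀ v w, pullbackForm Ω Φ₂.symm z v w =
      pullbackForm Ω Φ₁.symm (Φ₁ (Φ₂.symm z)) (fderiv ℝ (fun z => Φ₁ (Φ₂.symm z)) z v)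
        (fderiv ℝ (fun z => Φ₁ (Φ₂.symm z)) z w) := by
  filter_upwards [(h₁.eventually_mem_source h₂).eventually_nhds,
    (h₁.analyticAt_transition h₂).eventually_analyticAt] with z hz hza v w
  have hzs := hz.self_of_nhds
  have hcomp : HasMFDerivAt 𝓘(ℝ, Phase n) 𝓘(ℝ, E) (fun y => Φ₁.symm (Φ₁ (Φ₂.symm y))) z
      ((mfderiv 𝓘(ℝ, Phase n) 𝓘(ℝ, E) Φ₁.symm (Φ₁ (Φ₂.symm z))).comp
        (fderiv ℝ (fun z => Φ₁ (Φ₂.symm z)) z)) := by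
    have d1 : MDifferentiableAt 𝓘(ℝ, Phase n) 𝓘(ℝ, E) Φ₁.symm (Φ₁ (Φ₂.symm z)) :=
      (h₁.analytic_symm.contMDiffAt (Φ₁.open_target.mem_nhds
        (Φ₁.map_source hzs))).mdifferentiableAt (by simp)
    exact HasMFDerivAt.comp z d1.hasMFDerivAt hza.differentiableAt.hasFDerivAt.hasMFDerivAt
  have hcongr : HasMFDerivAt 𝓘(ℝ, Phase n) 𝓘(ℝ, E) Φ₂.symm z
      ((mfderiv 𝓘(ℝ, Phase n) 𝓘(ℝ, E) Φ₁.symm (Φ₁ (Φ₂.symm z))).comp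
        (fderiv ℝ (fun z => Φ₁ (Φ₂.symm z)) z)) :=
    hcomp.congr_of_eventuallyEq (hz.mono fun y hy => (Φ₁.left_inv hy).symm)
  have hΩ : ∀ {x y : M} (_ : x = y) (a b : E), Ω x a b = Ω y a b := by
    rintro x y rfl a b
    rfl
  simp only [pullbackForm]
  rw [hcongr.mfderiv]
  exact hΩ (Φ₁.left_inv hzs).symm _ _

end Phase

section Base

variable {φ₁ φ₂ : OpenPartialHomeomorph (Base n) (Base n)} {b : Base n}

lemma IsCenteredAnalyticBaseChart.analyticAt_transition (h₁ : IsCenteredAnalyticBaseChart φ₁ b)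
    (h₂ : IsCenteredAnalyticBaseChart φ₂ b) : AnalyticAt ℝ (fun c => φ₁ (φ₂.symm c)) 0 := by
  have d1 : ContDiffAt ℝ ω φ₁ (φ₂.symm 0) := by
    rw [h₂.symm_zero]
    exact h₁.analytic.contDiffAt (φ₁.open_source.mem_nhds h₁.mem_source)
  have d2 : ContDiffAt ℝ ω φ₂.symm 0 :=
    h₂.analytic_symm.contDiffAt (φ₂.open_target.mem_nhds h₂.zero_mem)
  exact (d1.comp 0 d2).analyticAt

lemma IsCenteredAnalyticBaseChart.transition_zero (h₁ : IsCenteredAnalyticBaseChart φ₁ b)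
    (h₂ : IsCenteredAnalyticBaseChart φ₂ b) : φ₁ (φ₂.symm 0) = 0 := by
  rw [h₂.symm_zero, h₁.map_eq_zero]

lemma IsCenteredAnalyticBaseChart.eventually_mem_source (h₁ : IsCenteredAnalyticBaseChart φ₁ b)
    (h₂ : IsCenteredAnalyticBaseChart φ₂ b) : ∀ᶠ c in 𝓝 (0 : Base n), φ₂.symm c ∈ φ₁.source :=
  h₂.symm_tendsto.eventually (φ₁.open_source.mem_nhds h₁.mem_source)

lemma IsCenteredAnalyticBaseChart.transition_inv (h₁ : IsCenteredAnalyticBaseChart φ₁ b)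
    (h₂ : IsCenteredAnalyticBaseChart φ₂ b) :
    ∀ᶠ c in 𝓝 (0 : Base n), φ₂ (φ₁.symm (φ₁ (φ₂.symm c))) = c := by
  filter_upwards [h₁.eventually_mem_source h₂, φ₂.open_target.mem_nhds h₂.zero_mem] with c hc hc'
  rw [φ₁.left_inv hc, φ₂.right_inv hc']

end Base

lemma transition_comm {η : ℝ} {F : M → Base n} {Φ₁ Φ₂ : OpenPartialHomeomorph M (Phase n)}
    {φ₁ φ₂ : OpenPartialHomeomorph (Base n) (Base n)}
    (h₁ : IsCenteredAnalyticChart (E := E) Φ₁ P) (h₂ : IsCenteredAnalyticChart (E := E) Φ₂ P)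
    (m₁ : ∀ x ∈ Φ₁.source, F x ∈ φ₁.source ∧ φ₁ (F x) = canonicalMomentum n η (Φ₁ x))
    (m₂ : ∀ x ∈ Φ₂.source, F x ∈ φ₂.source ∧ φ₂ (F x) = canonicalMomentum n η (Φ₂ x)) :
    ∀ᶠ z in 𝓝 (0 : Phase n), canonicalMomentum n η (Φ₁ (Φ₂.symm z)) =
      φ₁ (φ₂.symm (canonicalMomentum n η z)) := by
  filter_upwards [h₁.eventually_mem_source h₂, h₂.target_mem] with z hz hz'
  obtain ⟨e1, e2⟩ := m₂ _ (Φ₂.map_target hz')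
  rw [Φ₂.right_inv hz'] at e2
  rw [← (m₁ _ hz).2, ← e2, φ₂.left_inv e1]

end

/-! ### Vertical directions at the origin -/

section

variable {n : ℕ} {η : ℝ}

/-- A fibred diffeomorphism preserves the vertical directions at the origin. -/
lemma fst_fderiv_eq_zero {G : Phase n → Phase n} {g : Base n → Base n} (hn : n ≠ 0)
    (hG : AnalyticAt ℝ G 0) (hg : AnalyticAt ℝ g 0) (hG0 : G 0 = 0)
    (hcomm : ∀ᶠ z in 𝓝 0, canonicalMomentum n η (G z) = g (canonicalMomentum n η z))
    {v : Phase n} (hv : v.1 = 0) : (fderiv ℝ G 0 v).1 = 0 := by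
  have hF : ∀ w, HasFDerivAt (canonicalMomentum n η) (fderiv ℝ (canonicalMomentum n η) w) w :=
    fun w => ((contDiff_canonicalMomentum n η (k := 1)).differentiable (by norm_num) w).hasFDerivAt
  -- The energy has no linear part at the origin; `n ≠ 0` is needed for the term `q ^ (n + 1)`.
  have hF0 : ∀ w, fderiv ℝ (canonicalMomentum n η) 0 w = (0, w.1) := fun w => by
    rw [fderiv_canonicalMomentum, canonicalMomentum_zero, eval_derivative_swPoly]
    refine Prod.ext ?_ rfl
    simp [hn]
  have d1 : HasFDerivAt (fun z => canonicalMomentum n η (G z))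
      ((fderiv ℝ (canonicalMomentum n η) 0) ∘L fderiv ℝ G 0) 0 := by
    have := hF (G 0)
    rw [hG0] at this
    exact HasFDerivAt.comp (g := canonicalMomentum n η) 0 (by rw [hG0]; exact this)
      hG.differentiableAt.hasFDerivAt
  have d2 : HasFDerivAt (fun z => g (canonicalMomentum n η z))
      ((fderiv ℝ g 0) ∘L fderiv ℝ (canonicalMomentum n η) 0) 0 := by
    refine HasFDerivAt.comp (g := g) 0 ?_ (hF 0)
    rw [canonicalMomentum_zero]
    exact hg.differentiableAt.hasFDerivAt
  have h := congrArg (fun T => T v) (d1.unique (d2.congr_of_eventuallyEq hcomm))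
  simp only [ContinuousLinearMap.comp_apply, hF0, hv] at h
  have h0 : ((0, 0) : Base n) = 0 := rfl
  rw [h0, map_zero] at h
  exact congrArg Prod.snd h

lemma lambdaMuForm_of_fst_eq_zero {v w : Phase n} (hv : v.1 = 0) (hw : w.1 = 0) :
    lambdaMuForm v w = 0 := by
  simp [lambdaMuForm, hv, hw]

/-- An alternating form on the `(p, q)`-plane is a multiple of `dp ∧ dq`. -/
lemma dOneForm_of_fst_eq_zero {α : Reduced ℝ n → Reduced ℝ n →L[ℝ] ℝ} {x v w : Reduced ℝ n}
    (hv : v.1 = 0) (hw : w.1 = 0) :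
    dOneForm α x v w =
      dOneForm α x (0, 1, 0) (0, 0, 1) * (v.2.1 * w.2.2 - w.2.1 * v.2.2) := by
  have hdec : ∀ u : Reduced ℝ n, u.1 = 0 →
      u = u.2.1 • ((0, 1, 0) : Reduced ℝ n) + u.2.2 • ((0, 0, 1) : Reduced ℝ n) := by
    rintro ⟨u1, u2, u3⟩ h
    simp only at h
    subst h
    simp
  have hval : ∀ u u' : Reduced ℝ n, u.1 = 0 → u'.1 = 0 → fderiv ℝ α x u u' =
      u.2.1 * (u'.2.1 * fderiv ℝ α x (0, 1, 0) (0, 1, 0) +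
        u'.2.2 * fderiv ℝ α x (0, 1, 0) (0, 0, 1)) +
      u.2.2 * (u'.2.1 * fderiv ℝ α x (0, 0, 1) (0, 1, 0) +
        u'.2.2 * fderiv ℝ α x (0, 0, 1) (0, 0, 1)) := by
    intro u u' hu hu'
    conv_lhs => rw [hdec u hu, hdec u' hu']
    simp only [map_add, map_smul, add_apply, smul_apply, smul_eq_mul]
    ring
  rw [dOneForm, hval v w hv hw, hval w v hw hv, dOneForm]
  ring

end

/-! ### Comparison of the two normal forms -/

section

variable {E : Type*} [NormedAddCommGroup E] [NormedSpace ℝ E]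
  {M : Type*} [TopologicalSpace M] [ChartedSpace E M]
  {n : ℕ} {η : ℝ} {Ω : (x : M) → TangentSpace 𝓘(ℝ, E) x →L[ℝ] TangentSpace 𝓘(ℝ, E) x →L[ℝ] ℝ}
  {F : M → Base n} {P : M}

lemma PreliminaryNormalForm.analyticAt_alpha (N : PreliminaryNormalForm n η Ω F P) :
    AnalyticAt ℝ N.α 0 :=
  N.alpha_analytic 0 ⟨0, N.chart.zero_mem, rfl⟩

lemma PreliminaryNormalForm.eventually_form_eq (N : PreliminaryNormalForm n η Ω F P)
    (S : SymplecticNormalForm n η Ω F P) :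
    ∀ᶠ z in 𝓝 (0 : Phase n), ∀ v w,
      lambdaMuForm v w + dOneForm N.α (forgetMu z) (forgetMu v) (forgetMu w) =
        canonicalForm (fderiv ℝ (fun z => S.Φ (N.Φ.symm z)) z v)
          (fderiv ℝ (fun z => S.Φ (N.Φ.symm z)) z w) := by
  filter_upwards [pullbackForm_transition Ω S.chart N.chart, N.chart.target_mem,
    S.chart.eventually_mem_source N.chart] with z h1 h2 h3 v w
  rw [← N.form_eq z h2, h1, S.form_eq _ (S.Φ.map_source h3)]

lemma PreliminaryNormalForm.eventually_form_eq' (N : PreliminaryNormalForm n η Ω F P)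
    (S : SymplecticNormalForm n η Ω F P) :
    ∀ᶠ z in 𝓝 (0 : Phase n), ∀ v w, canonicalForm v w =
      lambdaMuForm (fderiv ℝ (fun z => N.Φ (S.Φ.symm z)) z v)
          (fderiv ℝ (fun z => N.Φ (S.Φ.symm z)) z w) +
        dOneForm N.α (forgetMu (N.Φ (S.Φ.symm z)))
          (forgetMu (fderiv ℝ (fun z => N.Φ (S.Φ.symm z)) z v))
          (forgetMu (fderiv ℝ (fun z => N.Φ (S.Φ.symm z)) z w)) := by
  filter_upwards [pullbackForm_transition Ω N.chart S.chart, S.chart.target_mem,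
    N.chart.eventually_mem_source S.chart] with z h1 h2 h3 v w
  rw [← S.form_eq z h2, h1, N.form_eq _ (N.Φ.map_source h3)]

lemma PreliminaryNormalForm.isTransition (N : PreliminaryNormalForm n η Ω F P)
    (S : SymplecticNormalForm n η Ω F P) (hn : n ≠ 0) :
    IsTransition n η (fun z => N.Φ (S.Φ.symm z)) (fun z => S.Φ (N.Φ.symm z))
      (fun b => N.φ (S.φ.symm b)) (fun b => S.φ (N.φ.symm b)) := by
  have hG := N.chart.analyticAt_transition S.chart
  have hG' := S.chart.analyticAt_transition N.chart
  have hg := N.base_chart.analyticAt_transition S.base_chart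
  have hg' := S.base_chart.analyticAt_transition N.base_chart
  have hc := transition_comm N.chart S.chart N.momentum_eq S.momentum_eq
  have hc' := transition_comm S.chart N.chart S.momentum_eq N.momentum_eq
  refine ⟨hG, hG', hg, hg', N.chart.transition_zero S.chart, S.chart.transition_zero N.chart,
    N.base_chart.transition_zero S.base_chart, S.base_chart.transition_zero N.base_chart,
    N.chart.transition_inv S.chart, S.chart.transition_inv N.chart,
    N.base_chart.transition_inv S.base_chart, S.base_chart.transition_inv N.base_chart, hc, hc',
    ?_, ?_⟩
  -- On `∂_p` and `∂_q`, whose images have no `λ`-part, comparing the forms at 0 gives 1 as a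
  -- multiple of `jac`; in the other direction it gives `ρ = jac'`.
  · have h := (N.eventually_form_eq' S).self_of_nhds (0, 0, 1, 0) (0, 0, 0, 1)
    have hp := fst_fderiv_eq_zero hn hG hg (N.chart.transition_zero S.chart) hc
      (v := (0, 0, 1, 0)) rfl
    have hq := fst_fderiv_eq_zero hn hG hg (N.chart.transition_zero S.chart) hc
      (v := (0, 0, 0, 1)) rfl
    rw [lambdaMuForm_of_fst_eq_zero hp hq, dOneForm_of_fst_eq_zero hp hq] at h
    intro h0
    simp only [forgetMu] at h
    rw [h0] at h
    simp [canonicalForm, lambdaMuForm] at h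
  · have h := (N.eventually_form_eq S).self_of_nhds (0, 0, 1, 0) (0, 0, 0, 1)
    have hp := fst_fderiv_eq_zero hn hG' hg' (S.chart.transition_zero N.chart) hc'
      (v := (0, 0, 1, 0)) rfl
    have hq := fst_fderiv_eq_zero hn hG' hg' (S.chart.transition_zero N.chart) hc'
      (v := (0, 0, 0, 1)) rfl
    have h1 : dOneForm N.α (forgetMu 0) (forgetMu (0, 0, 1, 0)) (forgetMu (0, 0, 0, 1)) ≠ 0 :=
      N.area_pos.ne'
    intro h0
    rw [canonicalForm, lambdaMuForm_of_fst_eq_zero hp hq, h0,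
      lambdaMuForm_of_fst_eq_zero rfl rfl, zero_add, zero_add] at h
    exact h1 h

/-- The local actions in terms of the areas of the vanishing cycles of standard curves. -/
lemma PreliminaryNormalForm.eventually_action (N : PreliminaryNormalForm n η Ω F P)
    (S : SymplecticNormalForm n η Ω F P) (hn : 2 ≤ n) (hη : η = 1 ∨ η = -1) :
    ∀ᶠ b in 𝓝 (0 : Base n), b ∈ standardSwallowtail n → ∀ k, N.action (S.φ.symm b) k =
      unitFactor η k * ((1 / (2 * Real.pi) * (dOneForm N.α 0 (0, 1, 0) (0, 0, 1) *
        cycleArea (rootTuple (scale (axisFactor fun z => N.Φ (S.Φ.symm z)) b)) k) : ℝ) : ℂ) := by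
  have T := N.isTransition S (by omega)
  have hslice : Filter.Tendsto (sliceL n) (𝓝 0) (𝓝 0) :=
    (sliceL n).continuous.tendsto' 0 0 (sliceL n).map_zero
  have hform : ∀ᶠ x in 𝓝 (0 : Reduced ℝ n), dOneForm N.α x (0, 1, 0) (0, 0, 1) =
      canonicalForm (fderiv ℝ (fun z => S.Φ (N.Φ.symm z)) (sliceL n x) (0, 0, 1, 0))
        (fderiv ℝ (fun z => S.Φ (N.Φ.symm z)) (sliceL n x) (0, 0, 0, 1)) := by
    filter_upwards [hslice.eventually (N.eventually_form_eq S)] with x hx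
    rw [← hx, lambdaMuForm_of_fst_eq_zero rfl rfl, zero_add]
    rfl
  filter_upwards [T.eventually_cycleIntegral hn hη N.analyticAt_alpha N.alphaC_analytic
    N.alphaC_extends hform] with b hb hbD k
  have h : N.action (S.φ.symm b) k =
      (1 / (2 * Real.pi) : ℂ) * cycleIntegral η N.αC (N.φ (S.φ.symm b)) k := rfl
  rw [h, hb hbD k]
  push_cast
  ring

end

end Unfolding

end

/-! ### Conclusion: the symmetry of the actions -/

theorem mainTheorem3 (n : ℕ) (hn : 2 ≤ n) (η : ℝ) (hη : η = 1 ∨ η = -1) (hηn : Even n → η = 1)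
    {E : Type*} [NormedAddCommGroup E] [NormedSpace ℝ E]
    {M : Type*} [TopologicalSpace M] [ChartedSpace E M] [IsManifold 𝓘(ℝ, E) ω M]
    (Ω : (x : M) → TangentSpace 𝓘(ℝ, E) x →L[ℝ] TangentSpace 𝓘(ℝ, E) x →L[ℝ] ℝ)
    (F : M → Unfolding.Base n) (hF : Unfolding.IsIntegrableSystem n Ω F)
    (P : M) (hP : Unfolding.IsUnfoldedAn n η Ω F P)
    (N : Unfolding.PreliminaryNormalForm n η Ω F P)
    (S : Unfolding.SymplecticNormalForm n η Ω F P) :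
    ∃ V : Set (Unfolding.Base n), IsOpen V ∧ F P ∈ V ∧
      V ⊆ N.φ.source ∧ V ⊆ S.φ.source ∧ (∀ f ∈ V, Unfolding.psi (S.φ f) ∈ S.φ.target) ∧
      Set.MapsTo S.involution V V ∧ (∀ f ∈ V, S.involution (S.involution f) = f) ∧
      S.involution '' (N.swallowtail ∩ V) = N.swallowtail ∩ V ∧
      Set.MapsTo N.action (N.swallowtail ∩ V) (Unfolding.octant n η) ∧
      ∀ f ∈ N.swallowtail ∩ V, Unfolding.chi η (N.action f) = N.action (S.involution f) := by
  open Unfolding in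
  have hη0 : η ≠ 0 := by rcases hη with rfl | rfl <;> norm_num
  have T := N.isTransition S (by omega)
  have htarget : ∀ᶠ b in 𝓝 (0 : Base n), b ∈ S.φ.target :=
    S.φ.open_target.mem_nhds S.base_chart.zero_mem
  obtain ⟨ε, hε, hball⟩ := Metric.eventually_nhds_iff_ball.1
    (htarget.and
      ((N.base_chart.eventually_mem_source S.base_chart).and
      ((T.eventually_mapsTo hn hη0).and ((T.base_left_inv.and
        (T.base_tendsto.eventually (T.symm.eventually_mapsTo hn hη0))).and
        (N.eventually_action S hn hη)))))
  set a := axisFactor fun z => N.Φ (S.Φ.symm z) with ha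
  have ha0 : a ≠ 0 := T.axisFactor_ne_zero hn hη0
  -- A ball around 0 is stable under `scale (-1)`, which only changes signs of coordinates.
  set V : Set (Base n) := S.φ.source ∩ S.φ ⁻¹' Metric.ball 0 ε with hV
  have hVb : ∀ f ∈ V, S.φ f ∈ Metric.ball 0 ε := fun f hf => hf.2
  have hsymm : ∀ f ∈ V, S.φ.symm (S.φ f) = f := fun f hf => S.φ.left_inv hf.1
  have hneg : ∀ f ∈ V, scale (-1) (S.φ f) ∈ Metric.ball (0 : Base n) ε := fun f hf => by
    have := hVb f hf
    rw [mem_ball_zero_iff] at this ⊢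
    exact (norm_scale_le (by norm_num) _).trans_lt this
  have hinv : ∀ f ∈ V, S.φ (S.involution f) = scale (-1) (S.φ f) := fun f hf => by
    rw [SymplecticNormalForm.involution, psi_eq_scale, S.φ.right_inv (hball _ (hneg f hf)).1]
  have hmaps : Set.MapsTo S.involution V V := fun f hf => by
    refine ⟨?_, ?_⟩
    · rw [SymplecticNormalForm.involution, psi_eq_scale]
      exact S.φ.map_target (hball _ (hneg f hf)).1
    · rw [Set.mem_preimage, hinv f hf]
      exact hneg f hf
  have hinvol : ∀ f ∈ V, S.involution (S.involution f) = f := fun f hf => by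
    rw [SymplecticNormalForm.involution, hinv f hf, psi_eq_scale, scale_scale]
    simp [hsymm f hf]
  have hNsrc : V ⊆ N.φ.source := fun f hf => by
    have := (hball _ (hVb f hf)).2.1
    rwa [hsymm f hf] at this
  -- The domain `D` is defined through the preliminary base chart; the base transition and its
  -- inverse both preserve the standard domain, so `D` may be read in the symplectic chart.
  have hsw : ∀ f ∈ V, f ∈ N.swallowtail ↔ S.φ f ∈ standardSwallowtail n := fun f hf => by
    obtain ⟨-, -, h1, ⟨h2, h3⟩, -⟩ := hball _ (hVb f hf)
    simp only [hsymm f hf] at h1 h2 h3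
    refine ⟨fun h => ?_, fun h => ⟨hNsrc hf, h1 h⟩⟩
    have := h3 h.2
    rwa [h2] at this
  have hswinv : ∀ f ∈ N.swallowtail ∩ V, S.involution f ∈ N.swallowtail ∩ V := fun f hf => by
    refine ⟨(hsw _ (hmaps hf.2)).2 ?_, hmaps hf.2⟩
    rw [hinv f hf.2]
    exact scale_mem_standardSwallowtail (by norm_num) ((hsw f hf.2).1 hf.1)
  have hact : ∀ f ∈ N.swallowtail ∩ V, ∀ k, N.action f k = unitFactor η k *
      ((1 / (2 * Real.pi) * (dOneForm N.α 0 (0, 1, 0) (0, 0, 1) *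
        cycleArea (rootTuple (scale a (S.φ f))) k) : ℝ) : ℂ) := fun f hf k => by
    have := (hball _ (hVb f hf.2)).2.2.2.2 ((hsw f hf.2).1 hf.1) k
    rwa [hsymm f hf.2] at this
  refine ⟨V, S.φ.isOpen_inter_preimage Metric.isOpen_ball,
    ⟨S.base_chart.mem_source, ?_⟩, hNsrc, Set.inter_subset_left, fun f hf => ?_, hmaps, hinvol,
    ?_, fun f hf k => ⟨_, ?_, hact f hf k⟩, fun f hf => funext fun k => ?_⟩
  · rw [Set.mem_preimage, S.base_chart.map_eq_zero]
    exact Metric.mem_ball_self hε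
  · rw [psi_eq_scale]
    exact (hball _ (hneg f hf)).1
  · refine Set.Subset.antisymm ?_ fun f hf => ⟨S.involution f, hswinv f hf, hinvol f hf.2⟩
    rintro _ ⟨f, hf, rfl⟩
    exact hswinv f hf
  · have h1 := N.area_pos
    have h2 := cycleArea_pos (rootTuple_spec
      (scale_mem_standardSwallowtail ha0 ((hsw f hf.2).1 hf.1))).1 k
    have h3 := Real.pi_pos
    positivity
  · have hD := scale_mem_standardSwallowtail ha0 ((hsw f hf.2).1 hf.1)
    -- Scalings commute, so `scale (-1)` acts last and reverses the roots of `scale a (S.φ f)`,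
    -- whether `a` is positive or negative.
    rw [hact _ (hswinv f hf), hinv f hf.2, scale_scale, mul_comm a (-1), ← scale_scale,
      rootTuple_scale_neg_one hD, cycleArea_neg_rev]
    simp only [chi, hact f hf]
    rw [mul_div_cancel_left₀ _ (unitFactor_ne_zero η k.rev)]
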